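/- Setting. Let $N\ge 2$, $m\ge 2$, and let $\mathcal A=[a_{ij}]$ ($a_{ij}=a_{ji}\ge 0$, $a_{ii}=0$) be the weighted adjacency matrix of a connected undirected graph on $\{1,\dots,N\}$, with $\lambda_2$ the second smallest eigenvalue of its Laplacian. Let $f^i:\mathbb R^n\to\mathbb R$ be differentiable with $(\nabla f^i(x)-\nabla f^i(y))^{\top}(x-y)\ge\rho_c\|x-y\|^2$ and $\|\nabla f^i(x)-\nabla f^i(y)\|\le\varrho_c\|x-y\|$ ($\rho_c,\varrho_c>0$), and let $z^*$ minimize $\sum_{i=1}^N f^i$. Put $$c_1^*=\max\Big\{\tfrac1{\lambda_2},\tfrac{1+2\varrho_c^2}{2\rho_c}\Big\},\qquad c_3^*=c_1^*\max\{1,\tfrac1{\lambda_2}\}+1,\qquad c^*=\frac1{4c_3^*}.$$ Fix $t_0\in\mathbb R$ and $T>0$, and let $\mu(t)=1/(T+t_0-t)$ for $t\in[t_0,t_0+T)$. Agents. Agent $i$ has states $x^i_q\in\mathbb R^n$ ($1\le q\le m$), output $y^i=x^i_1$, input $u^i\in\mathbb R^n$ and dynamics $$\dot x^i_1=x^i_2,\qquad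 \dot x^i_q=x^i_{q+1}+\theta^i\varphi^i_q(x^i_q)\ (2\le q\le m-1),\qquad \dot x^i_m=u^i+\theta^i\varphi^i_m(x^i_m),$$ where $\theta^i\in\mathbb R$ is an unknown constant and each $\varphi^i_q:\mathbb R^n\to\mathbb R^n$ is differentiable and locally Lipschitz with $\varphi^i_q(0)=0$. Generator. $\dot\varpi^i=-\alpha(\mu)\big(\sum_j a_{ij}(\varpi^i-\varpi^j)+\nabla f^i(\varpi^i)+p^i\big)$ and $\dot p^i=\alpha(\mu)\sum_j a_{ij}(\varpi^i-\varpi^j)$, with $\sum_i p^i(t_0)=0$. Here $\alpha\in\mathcal K_\infty$ is differentiable on $(0,\infty)$ with $\alpha'(s)\le\frac12c^*s^{-2}\alpha(s)^2$ for $s>0$. Controller (superscript $i$ omitted; $\theta,\varphi_q,\alpha_\xi,l,\sigma,c_q,\upsilon_q$ may depend on $i$). Let $l>0$, $\sigma>0$, $L_q=m+l+1-q$, and let $\alpha_\xi\in\mathcal K_\infty$ be differentiable on $(0,\infty)$ and satisfy the criterion $$\mathrm{DC}_\xi:\qquad \alpha_\xi'(s)\le s^{-2}\alpha_\xi(s)^2\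 (s>0),\qquad \alpha_\xi(s)\le\frac{c^*\alpha(s)}{2L_2}\ (s\ge0).$$ With filter states $\xi_{qf}$ ($2\le q\le m$) and the estimate $\hat\theta$, put $\tilde x_1=x_1-\varpi$, $\xi_1=-c_1\alpha_\xi(\mu)\tilde x_1$, and for $2\le q\le m$ $$\tilde x_q=x_q-\xi_{qf},\quad \tilde\xi_q=\xi_{qf}-\xi_{q-1},\quad \xi_q=-c_q\alpha_\xi(\mu)\tilde x_q-\hat\theta\varphi_q(x_q)-\upsilon_q\alpha_\xi(\mu)\tilde\xi_q,$$ $$\dot\xi_{qf}=\upsilon_q\alpha_\xi(\mu)(-\xi_{qf}+\xi_{q-1}),\qquad \dot{\hat\theta}=\sum_{q=2}^m\alpha_\xi(\mu)^{2L_q}\tilde x_q^{\top}\varphi_q(x_q)-\sigma\alpha_\xi(\mu)\hat\theta,\qquad u=\xi_m.$$ The transformed state is $\tilde e_s=(\omega,\eta,\tilde\theta)\in\mathbb R^{2mn+1-n}$ with $\omega_q=\alpha_\xi(\mu)^{L_q}\tilde x_q$ ($1\le q\le m$), $\eta_q=\alpha_\xi(\mu)^{L_q}\tilde\xi_q$ ($2\le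 q\le m$), $\tilde\theta=\theta-\hat\theta$, and $\Omega(h)=\{\tilde e_s:\|\tilde e_s\|^2\le h^2\}$. Theorem. For every bound $R$ there exist, for each agent, gains $c_q>0$ ($1\le q\le m$), $\upsilon_q>0$ ($2\le q\le m$) and a radius $h>0$ such that, whenever $\sum_ip^i(t_0)=0$ and $\|\varpi^i(t_0)\|,\|p^i(t_0)\|\le R$ for all $i$: 1. $\Omega(h)$ is invariant: along every solution of the closed loop on an interval $[t_0,t_1)$ with $t_1\le t_0+T$, if $\tilde e_s(s)\in\Omega(h)$ for some $s\in[t_0,t_1)$, then $\tilde e_s(t)\in\Omega(h)$ for all $t\in[s,t_1)$. 2. The distributed prescribed-time convex optimization (DPTCO) problem is solved from these sets: if $\tilde e^i_s(t_0)\in\Omega(h^i)$ for all $i$, then the closed loop has a solution on $[t_0,t_0+T)$ with the given initial state, and every such solution satisfies $\lim_{t\to t_0+T}\|y^i(t)-z^*\|=0$ for all $i$, with all $x^i_q$, $u^i$, $\varpi^i$, $p^i$, $\hat\theta^i$, $\xi^i_{qf}$ bounded on $[t_0,t_0+T)$. 3. These sets cover all bounded initial data: if moreover $\|x^i_q(t_0)\|\le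 R$ and $|\hat\theta^i(t_0)|\le R$ for all $i,q$, then the filter states $\xi^i_{qf}(t_0)$ can be initialized so that $\tilde e^i_s(t_0)\in\Omega(h^i)$ for all $i$. -/

import Mathlib

open Set Filter Topology

noncomputable section

namespace DPTCO

/-- The Euclidean space `ℝⁿ`. -/
abbrev Vec (n : ℕ) : Type := EuclideanSpace ℝ (Fin n)

/-- Class `𝓚_∞`: continuous, strictly increasing and unbounded on `[0, ∞)`, zero at zero. -/
structure IsKInfty (α : ℝ → ℝ) : Prop where
  continuousOn : ContinuousOn α (Ici 0)
  strictMonoOn : StrictMonoOn α (Ici 0)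
  map_zero : α 0 = 0
  tendsto_atTop : Tendsto α atTop atTop

/-! ### Communication graph -/

/-- A weighted undirected graph on `N` nodes without self edges, given by its adjacency
matrix `a`; `i` and `j` are joined by an edge iff `0 < a i j`. -/
structure Network (N : ℕ) where
  a : Matrix (Fin N) (Fin N) ℝ
  nonneg : ∀ i j, 0 ≤ a i j
  symm : ∀ i j, a i j = a j i
  diag : ∀ i, a i i = 0

namespace Network

variable {N : ℕ}

/-- The underlying simple graph. -/
def graph (G : Network N) : SimpleGraph (Fin N) where
  Adj i j := 0 < G.a i j
  symm := ⟨fun i j h => by rw [G.symm j i]; exact h⟩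
  loopless := ⟨fun i h => by rw [G.diag i] at h; exact lt_irrefl _ h⟩

/-- The Laplacian matrix: `l i i = ∑ j, a i j` and `l i j = - a i j` for `i ≠ j`. -/
def laplacian (G : Network N) : Matrix (Fin N) (Fin N) ℝ :=
  Matrix.diagonal (fun i => ∑ j, G.a i j) - G.a

theorem laplacian_isHermitian (G : Network N) : G.laplacian.IsHermitian := by
  ext i j
  by_cases h : i = j
  · subst h; simp [laplacian]
  · simp [laplacian, Matrix.diagonal, h, Ne.symm h, G.symm j i]

/-- The second smallest eigenvalue `λ₂` of the Laplacian, with multiplicity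
(`eigenvalues₀` lists the `N` eigenvalues in decreasing order). -/
def lambda2 (G : Network N) (hN : 2 ≤ N) : ℝ :=
  G.laplacian_isHermitian.eigenvalues₀ ⟨N - 2, by rw [Fintype.card_fin]; omega⟩

end Network

/-! ### Constants -/

/-- `c₁ = max {1/λ₂, (1 + 2 ϱ_c²)/(2 ρ_c)}`. -/
def const1 (lam2 rho varrho : ℝ) : ℝ := max (1 / lam2) ((1 + 2 * varrho ^ 2) / (2 * rho))

/-- `c₃ = c₁ max {1, 1/λ₂} + 1`. -/
def const3 (lam2 rho varrho : ℝ) : ℝ := const1 lam2 rho varrho * max 1 (1 / lam2) + 1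

/-- `c^* = 1/(4 c₃)`. -/
def cStar (lam2 rho varrho : ℝ) : ℝ := 1 / (4 * const3 lam2 rho varrho)

/-- The time-varying gain `μ(t) = 1/(T + t₀ - t)`. -/
def mu (t₀ T t : ℝ) : ℝ := 1 / (T + t₀ - t)

/-- The exponents `L_q = m + l + 1 - q`. -/
def expo (m : ℕ) (l : ℝ) (q : ℕ) : ℝ := m + l + 1 - q

/-! ### Assumptions on the data -/

/-- Differentiable, `ρ`-strongly convex (strong monotonicity of the gradient), with
`ϱ`-Lipschitz gradient. -/
structure IsAdmissibleCost {n : ℕ} (rho varrho : ℝ) (f : Vec n → ℝ) : Prop where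
  differentiable : Differentiable ℝ f
  strong : ∀ x y, rho * ‖x - y‖ ^ 2 ≤ inner ℝ (gradient f x - gradient f y) (x - y)
  lipschitz : ∀ x y, ‖gradient f x - gradient f y‖ ≤ varrho * ‖x - y‖

/-- Gain condition on the generator gain `α`. -/
structure IsGeneratorGain (cs : ℝ) (α : ℝ → ℝ) : Prop where
  kInfty : IsKInfty α
  differentiableOn : DifferentiableOn ℝ α (Ioi 0)
  deriv_le : ∀ s, 0 < s → deriv α s ≤ 1 / 2 * cs * (s ^ 2)⁻¹ * α s ^ 2

/-- The design criterion `DC_ξ` on `α_ξ`, where `L2` is the exponent `L₂`. -/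
structure IsTrackingGain (cs L2 : ℝ) (α αξ : ℝ → ℝ) : Prop where
  kInfty : IsKInfty αξ
  differentiableOn : DifferentiableOn ℝ αξ (Ioi 0)
  deriv_le : ∀ s, 0 < s → deriv αξ s ≤ (s ^ 2)⁻¹ * αξ s ^ 2
  le_gain : ∀ s, 0 ≤ s → αξ s ≤ cs * α s / (2 * L2)

/-- Assumption on the nonlinearities `φ_2, …, φ_m` of one agent. -/
def IsAdmissibleNonlinearity {n : ℕ} (m : ℕ) (φ : ℕ → Vec n → Vec n) : Prop :=
  ∀ q, 2 ≤ q → q ≤ m → φ q 0 = 0 ∧ Differentiable ℝ (φ q) ∧ LocallyLipschitz (φ q)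

/-! ### The closed loop -/

/-- The data of one agent: the unknown parameter `θ`, the nonlinearities `φ_q`
(`2 ≤ q ≤ m`), and the parameters `α_ξ`, `l`, `σ` of its controller. -/
structure Agent (n : ℕ) where
  θ : ℝ
  φ : ℕ → Vec n → Vec n
  αξ : ℝ → ℝ
  l : ℝ
  σ : ℝ

/-- The gains of one agent: `c_q` (`1 ≤ q ≤ m`) and `υ_q` (`2 ≤ q ≤ m`). -/
structure Gains where
  c : ℕ → ℝ
  υ : ℕ → ℝ

/-- The state of one agent: generator states `ϖ`, `p`, plant states `x_q` (`1 ≤ q ≤ m`),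
estimate `θhat` and filter states `ξ_{qf}` (`2 ≤ q ≤ m`). Entries `x q`, `ξf q` with other
indices are not used. -/
structure AgentState (n : ℕ) where
  ϖ : Vec n
  p : Vec n
  x : ℕ → Vec n
  θhat : ℝ
  ξf : ℕ → Vec n

/-- `x̃_1 = x_1 - ϖ` and `x̃_q = x_q - ξ_{qf}` for `q ≥ 2`. -/
def AgentState.xTilde {n : ℕ} (s : AgentState n) (q : ℕ) : Vec n :=
  if q = 1 then s.x 1 - s.ϖ else s.x q - s.ξf q

namespace Agent

variable {n : ℕ}

/-- The virtual controls `ξ_q`, with `g` standing for `α_ξ(μ)`: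
`ξ_1 = -c_1 g x̃_1` and `ξ_q = -c_q g x̃_q - θhat φ_q(x_q) - υ_q g ξ̃_q` for `q ≥ 2`,
where `ξ̃_q = ξ_{qf} - ξ_{q-1}`. -/
def xi (A : Agent n) (K : Gains) (g : ℝ) (s : AgentState n) : ℕ → Vec n
  | 0 => 0
  | 1 => -((K.c 1 * g) • s.xTilde 1)
  | q + 2 => -((K.c (q + 2) * g) • s.xTilde (q + 2)) - s.θhat • A.φ (q + 2) (s.x (q + 2))
      - (K.υ (q + 2) * g) • (s.ξf (q + 2) - xi A K g s (q + 1))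

/-- `ξ̃_q = ξ_{qf} - ξ_{q-1}` for `q ≥ 2`. -/
def xiTilde (A : Agent n) (K : Gains) (g : ℝ) (s : AgentState n) (q : ℕ) : Vec n :=
  s.ξf q - A.xi K g s (q - 1)

/-- The control input `u = ξ_m`. -/
def input (A : Agent n) (m : ℕ) (K : Gains) (g : ℝ) (s : AgentState n) : Vec n :=
  A.xi K g s m

/-- `τ = ∑_{q=2}^m g^{2 L_q} x̃_qᵀ φ_q(x_q)`. -/
def tau (A : Agent n) (m : ℕ) (g : ℝ) (s : AgentState n) : ℝ :=
  ∑ q ∈ Finset.Icc 2 m, g ^ (2 * expo m A.l q) * inner ℝ (s.xTilde q) (A.φ q (s.x q))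

end Agent

/-- `ℝ^{mn} × ℝ^{(m-1)n} × ℝ = ℝ^{2mn+1-n}` with the Euclidean norm. -/
abbrev TransformedState (m n : ℕ) : Type :=
  WithLp 2 (PiLp 2 (fun _ : Fin m => Vec n) ×
    WithLp 2 (PiLp 2 (fun _ : Fin (m - 1) => Vec n) × ℝ))

/-- The transformed state `ẽ_s = (ω, η, θ̃)` with `ω_q = g^{L_q} x̃_q` (`1 ≤ q ≤ m`),
`η_q = g^{L_q} ξ̃_q` (`2 ≤ q ≤ m`) and `θ̃ = θ - θhat`, where `g` stands for `α_ξ(μ)`. -/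
def Agent.transform {n : ℕ} (A : Agent n) (m : ℕ) (K : Gains) (g : ℝ) (s : AgentState n) :
    TransformedState m n :=
  WithLp.toLp 2
    (WithLp.toLp 2 fun k : Fin m => g ^ expo m A.l ((k : ℕ) + 1) • s.xTilde ((k : ℕ) + 1),
      WithLp.toLp 2
        (WithLp.toLp 2 fun k : Fin (m - 1) =>
            g ^ expo m A.l ((k : ℕ) + 2) • A.xiTilde K g s ((k : ℕ) + 2),
          A.θ - s.θhat))

/-- The ball `Ω(h)`. -/
def Omega (m n : ℕ) (h : ℝ) : Set (TransformedState m n) := {e | ‖e‖ ^ 2 ≤ h ^ 2}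

/-- `S` solves the closed-loop system on `[t₀, t₁)`: the optimum generator, the plants
with `u = ξ_m`, the adaptive laws and the filters. -/
structure IsSolution {N n : ℕ} (G : Network N) (f : Fin N → Vec n → ℝ) (α : ℝ → ℝ) (m : ℕ)
    (A : Fin N → Agent n) (K : Fin N → Gains) (t₀ T t₁ : ℝ)
    (S : ℝ → Fin N → AgentState n) : Prop where
  ϖ_eq : ∀ t ∈ Ico t₀ t₁, ∀ i, HasDerivWithinAt (fun r => (S r i).ϖ)
    (-(α (mu t₀ T t) • ((∑ j, G.a i j • ((S t i).ϖ - (S t j).ϖ))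
      + gradient (f i) (S t i).ϖ + (S t i).p))) (Ico t₀ t₁) t
  p_eq : ∀ t ∈ Ico t₀ t₁, ∀ i, HasDerivWithinAt (fun r => (S r i).p)
    (α (mu t₀ T t) • ∑ j, G.a i j • ((S t i).ϖ - (S t j).ϖ)) (Ico t₀ t₁) t
  x_first : ∀ t ∈ Ico t₀ t₁, ∀ i, HasDerivWithinAt (fun r => (S r i).x 1)
    ((S t i).x 2) (Ico t₀ t₁) t
  x_mid : ∀ t ∈ Ico t₀ t₁, ∀ i, ∀ q, 2 ≤ q → q < m → HasDerivWithinAt (fun r => (S r i).x q)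
    ((S t i).x (q + 1) + (A i).θ • (A i).φ q ((S t i).x q)) (Ico t₀ t₁) t
  x_last : ∀ t ∈ Ico t₀ t₁, ∀ i, HasDerivWithinAt (fun r => (S r i).x m)
    ((A i).input m (K i) ((A i).αξ (mu t₀ T t)) (S t i)
      + (A i).θ • (A i).φ m ((S t i).x m)) (Ico t₀ t₁) t
  θhat_eq : ∀ t ∈ Ico t₀ t₁, ∀ i, HasDerivWithinAt (fun r => (S r i).θhat)
    ((A i).tau m ((A i).αξ (mu t₀ T t)) (S t i)
      - (A i).σ * (A i).αξ (mu t₀ T t) * (S t i).θhat) (Ico t₀ t₁) t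
  ξf_eq : ∀ t ∈ Ico t₀ t₁, ∀ i, ∀ q, 2 ≤ q → q ≤ m → HasDerivWithinAt (fun r => (S r i).ξf q)
    (((K i).υ q * (A i).αξ (mu t₀ T t)) •
      (-(S t i).ξf q + (A i).xi (K i) ((A i).αξ (mu t₀ T t)) (S t i) (q - 1))) (Ico t₀ t₁) t

/-- The transformed state of agent `i` in the network state `s` at time `t`. -/
def transformAt {N n : ℕ} (m : ℕ) (A : Fin N → Agent n) (K : Fin N → Gains) (t₀ T t : ℝ)
    (s : Fin N → AgentState n) (i : Fin N) : TransformedState m n :=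
  (A i).transform m (K i) ((A i).αξ (mu t₀ T t)) (s i)

/-- Initial generator states of size at most `R` with `∑ p^i(t₀) = 0`. -/
def IsGeneratorInit {N n : ℕ} (R : ℝ) (s : Fin N → AgentState n) : Prop :=
  ∑ i, (s i).p = 0 ∧ ∀ i, ‖(s i).ϖ‖ ≤ R ∧ ‖(s i).p‖ ≤ R

/-- The trajectory `S` on `[t₀, t₀ + T)` achieves prescribed-time optimal agreement at `z`:
every output `y^i = x_1^i` tends to `z` as `t → t₀ + T`, and the plant states, the inputs
and the controller states are bounded. -/
structure AchievesAgreement {N n : ℕ} (m : ℕ) (A : Fin N → Agent n) (K : Fin N → Gains)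
    (t₀ T : ℝ) (z : Vec n) (S : ℝ → Fin N → AgentState n) : Prop where
  convergence : ∀ i, Tendsto (fun t => ‖(S t i).x 1 - z‖) (𝓝[<] (T + t₀)) (𝓝 0)
  bounded : ∃ B : ℝ, ∀ t ∈ Ico t₀ (t₀ + T), ∀ i,
    (∀ q, 1 ≤ q → q ≤ m → ‖(S t i).x q‖ ≤ B) ∧
    ‖(A i).input m (K i) ((A i).αξ (mu t₀ T t)) (S t i)‖ ≤ B ∧
    ‖(S t i).ϖ‖ ≤ B ∧ ‖(S t i).p‖ ≤ B ∧ |(S t i).θhat| ≤ B ∧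
    (∀ q, 2 ≤ q → q ≤ m → ‖(S t i).ξf q‖ ≤ B)

end DPTCO

end

noncomputable section

namespace DPTCO

/-! ### Spectrum of the graph Laplacian -/

namespace Network

variable {N : ℕ} (G : Network N)

/-! The closed loop is a cascade. The generator does not see the plants, so its states are bounded
once and for all; each agent then tracks a reference `ϖ` whose velocity is controlled by these
bounds.

Generator. Let w and p be the stacked deviations from equilibrium. The energy c/2 (‖w‖² + ⟨Qp, p⟩) +
½‖w + p‖² uses a `Q` that inverts the Laplacian on sum-zero stacks (`exists_lap_inverse`), so that
the cross terms ⟨w, p⟩ weighted by c cancel. The spectral gap (`lambda2_pos_and_gap`) and strong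
convexity make the energy decay at rate 2c*α (`generator_dissipation`), while the conditions on the
gains let the weight α αξ^{L₂} grow at rate at most c*α. Hence weight² times energy is nonincreasing
(`weighted_energy_le`): the deviations are O(1/weight), and αξ^{L₂}‖dϖ/dt‖ ≤ B with `B` independent
of the controller gains (`exists_generator_bound`).

Tracking. Write g = αξ(μ); the design criterion gives 0 ≤ g' ≤ g². Each level of the backstepping
costs one power of g, and the exponents L_q compensate for it. On the ball of radius h, the scaled
nonlinearity at level q is bounded by b_q and the scaled rate of ξ_{q-1}, apart from its τ part, by
b_q g, where b_q depends only on the gains below q (`exists_gain_bound`). The gains can thus be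
chosen recursively (`exists_gains`). The adaptation signal τ involves all levels, so it is kept
apart as a factor; its contribution is estimated by a quadratic form in ω and η
(`mul_sum_le_of_le_sum`), which the part m b_q² of the gains absorbs. Half the energy rate is then
at most g (drift − σ/2 · energy) (`energy_rate_le`). The drift depends neither on h nor on the
gains, so for large h the energy strictly decreases on the sphere, and the ball is invariant
(`energy_invariant`).

The radius must be fixed before the gains and still contain the initial data. With υ_q = 2c_q and
filters started at 2ξ_{q-1} − x_q the gain terms in ξ_q cancel for q ≥ 2 (`xi_initialFilter`), so
the initial energy is bounded independently of the gains (`exists_initial_energy_bound`).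

Invariance bounds all signals, and ‖x̃_1‖ ≤ h g^{-L₁} together with the decay of ϖ − z gives
convergence (`exists_agent_design`). Since the bounds hold for every solution on every shorter
interval, a solution extends to the whole interval (`exists_global_solution`). -/

theorem laplacian_mulVec (w : Fin N → ℝ) (i : Fin N) :
    G.laplacian.mulVec w i = ∑ j, G.a i j * (w i - w j) := by
  rw [laplacian, Matrix.sub_mulVec, Pi.sub_apply, Matrix.mulVec_diagonal]
  simp [Matrix.mulVec, dotProduct, mul_sub, Finset.sum_mul]

theorem sum_mul_laplacian (w : Fin N → ℝ) :
    ∑ i, w i * ∑ j, G.a i j * (w i - w j) = 1 / 2 * ∑ i, ∑ j, G.a i j * (w i - w j) ^ 2 := by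
  have h1 : ∑ i, w i * ∑ j, G.a i j * (w i - w j)
      = ∑ i, ∑ j, G.a i j * (w i * (w i - w j)) := by
    refine Finset.sum_congr rfl fun i _ => ?_
    rw [Finset.mul_sum]
    exact Finset.sum_congr rfl fun j _ => by ring
  have h2 : ∑ i, ∑ j, G.a i j * (w i * (w i - w j))
      = ∑ i, ∑ j, G.a i j * (w j * (w j - w i)) := by
    rw [Finset.sum_comm]
    exact Finset.sum_congr rfl fun i _ => Finset.sum_congr rfl fun j _ => by rw [G.symm]
  have h3 : ∑ i, ∑ j, G.a i j * (w i - w j) ^ 2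
      = ∑ i, ∑ j, G.a i j * (w i * (w i - w j)) + ∑ i, ∑ j, G.a i j * (w j * (w j - w i)) := by
    simp only [← Finset.sum_add_distrib]
    exact Finset.sum_congr rfl fun i _ => Finset.sum_congr rfl fun j _ => by ring
  rw [h1, h3, ← h2]; ring

theorem sum_mul_laplacian_nonneg (w : Fin N → ℝ) :
    0 ≤ ∑ i, w i * ∑ j, G.a i j * (w i - w j) := by
  rw [sum_mul_laplacian]
  exact mul_nonneg (by norm_num) (Finset.sum_nonneg fun i _ => Finset.sum_nonneg fun j _ =>
    mul_nonneg (G.nonneg i j) (sq_nonneg _))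

variable {G}

/-- The Dirichlet form is a sum of nonnegative edge terms, so each of them vanishes; the equality
then travels along walks of the connected graph. -/
theorem eq_of_sum_mul_laplacian_eq_zero (hG : G.graph.Connected) {w : Fin N → ℝ}
    (h : ∑ i, w i * ∑ j, G.a i j * (w i - w j) = 0) (i j : Fin N) : w i = w j := by
  rw [sum_mul_laplacian] at h
  have h0 : ∑ i, ∑ j, G.a i j * (w i - w j) ^ 2 = 0 := by linarith
  have hnn : ∀ i j, 0 ≤ G.a i j * (w i - w j) ^ 2 := fun i j =>
    mul_nonneg (G.nonneg i j) (sq_nonneg _)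
  have hadj : ∀ i j, G.graph.Adj i j → w i = w j := by
    intro i j hij
    have h1 := (Finset.sum_eq_zero_iff_of_nonneg
      (fun i _ => Finset.sum_nonneg fun j _ => hnn i j)).1 h0 i (Finset.mem_univ i)
    have h2 := (Finset.sum_eq_zero_iff_of_nonneg (fun j _ => hnn i j)).1 h1 j (Finset.mem_univ j)
    have hpos : 0 < G.a i j := hij
    rcases mul_eq_zero.1 h2 with h3 | h3
    · exact absurd h3 hpos.ne'
    · exact sub_eq_zero.1 (pow_eq_zero_iff two_ne_zero |>.1 h3)
  obtain ⟨p⟩ := hG.preconnected i j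
  induction p with
  | nil => rfl
  | cons hh _ ih => exact (hadj _ _ hh).trans ih

/-- Kernel eigenvectors are constant by connectedness, so two orthogonal ones cannot exist and only
the last eigenvalue vanishes. A sum-zero vector has no component along the last eigenvector, and the
remaining eigenvalues are at least λ₂. -/
theorem lambda2_pos_and_gap (hN : 2 ≤ N) (hG : G.graph.Connected) :
    0 < G.lambda2 hN ∧ ∀ w : Fin N → ℝ, ∑ i, w i = 0 →
      G.lambda2 hN * ∑ i, w i ^ 2 ≤ ∑ i, w i * ∑ j, G.a i j * (w i - w j) := by
  classical
  set hA := G.laplacian_isHermitian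
  set T := Matrix.toEuclideanLin G.laplacian
  have hT : T.IsSymmetric := Matrix.isSymmetric_toEuclideanLin_iff.mpr hA
  set b := hT.eigenvectorBasis (finrank_euclideanSpace (𝕜 := ℝ) (ι := Fin N))
  set ev := hA.eigenvalues₀
  have hTb : ∀ k, T (b k) = ev k • b k := fun k => hT.apply_eigenvectorBasis _ k
  have hTw : ∀ w : EuclideanSpace ℝ (Fin N), ∀ i, T w i = ∑ j, G.a i j * (w i - w j) := fun w i =>
    G.laplacian_mulVec w i
  have hinner : ∀ w : EuclideanSpace ℝ (Fin N),
      inner ℝ w (T w) = ∑ i, w i * ∑ j, G.a i j * (w i - w j) := by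
    intro w
    rw [PiLp.inner_apply]
    refine Finset.sum_congr rfl fun i _ => ?_
    rw [hTw]; simp [mul_comm]
  have hcoef : ∀ (w : EuclideanSpace ℝ (Fin N)) k,
      inner ℝ (b k) (T w) = ev k * inner ℝ (b k) w := by
    intro w k
    rw [← hT (b k) w, hTb, real_inner_smul_left]
  have hspec : ∀ w : EuclideanSpace ℝ (Fin N),
      inner ℝ w (T w) = ∑ k, ev k * (inner ℝ (b k) w) ^ 2 := by
    intro w
    rw [← b.sum_inner_mul_inner w (T w)]
    refine Finset.sum_congr rfl fun k _ => ?_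
    rw [hcoef, real_inner_comm w]; ring
  have hev : ∀ k, 0 ≤ ev k := by
    intro k
    have h1 := hinner (b k)
    rw [hTb, real_inner_smul_right, real_inner_self_eq_norm_sq, b.orthonormal.1 k] at h1
    have h2 := G.sum_mul_laplacian_nonneg (b k)
    nlinarith
  have hker : ∀ k, ev k = 0 → ∀ i j, b k i = b k j := by
    intro k hk i j
    refine eq_of_sum_mul_laplacian_eq_zero hG (w := b k) ?_ i j
    rw [← hinner, hTb, hk]; simp
  have hcard : Fintype.card (Fin N) = N := Fintype.card_fin N
  -- The eigenvalues decrease: index `N - 1` carries the smallest one and `N - 2` carries λ₂.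
  set kl : Fin (Fintype.card (Fin N)) := ⟨N - 1, by omega⟩
  set k2 : Fin (Fintype.card (Fin N)) := ⟨N - 2, by omega⟩
  have hlam : G.lambda2 hN = ev k2 := rfl
  have hanti : Antitone ev := hA.eigenvalues₀_antitone
  have hkl : ev kl = 0 := by
    set u : EuclideanSpace ℝ (Fin N) := WithLp.toLp 2 fun _ => 1
    have hu : T u = 0 := by
      ext i; rw [hTw]; simp [u]
    -- Otherwise all eigenvalues are positive, and the all-ones vector, which `T` kills, is
    -- orthogonal to the whole basis.
    by_contra hne
    have hall : ∀ k, inner ℝ (b k) u = 0 := by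
      intro k
      have h1 := hcoef u k
      rw [hu, inner_zero_right] at h1
      have h2 : ev kl ≤ ev k := hanti (by
        rw [Fin.le_def]; have := k.2; simp only [kl]; omega)
      have h3 : 0 < ev k := lt_of_lt_of_le (lt_of_le_of_ne (hev kl) (Ne.symm hne)) h2
      rcases mul_eq_zero.1 h1.symm with h | h
      · exact absurd h h3.ne'
      · exact h
    have h0 : u = 0 := by
      rw [← b.sum_repr u]
      refine Finset.sum_eq_zero fun k _ => ?_
      rw [b.repr_apply_apply, hall, zero_smul]
    have := congrArg (fun v : EuclideanSpace ℝ (Fin N) => v ⟨0, by omega⟩) h0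
    simp [u] at this
  have hconst : ∀ i j, b kl i = b kl j := hker kl hkl
  have hne : k2 ≠ kl := by
    intro h; have := congrArg Fin.val h; simp only [k2, kl] at this; omega
  have hpos : 0 < ev k2 := by
    refine lt_of_le_of_ne (hev k2) fun h => ?_
    have h2 := hker k2 h.symm
    -- Two nonzero constant vectors are never orthogonal.
    have horth : inner ℝ (b k2) (b kl) = 0 := b.orthonormal.2 hne
    have hn1 : ∀ k, (∀ i j, b k i = b k j) → b k ⟨0, by omega⟩ ≠ 0 := by
      intro k hk h0
      have : b k = 0 := by
        ext i; rw [hk i ⟨0, by omega⟩, h0]; rfl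
      have h1 := b.orthonormal.1 k
      rw [this, norm_zero] at h1
      exact zero_ne_one h1
    rw [PiLp.inner_apply] at horth
    have : ∑ i : Fin N, inner ℝ (b k2 i) (b kl i)
        = N * (b k2 ⟨0, by omega⟩ * b kl ⟨0, by omega⟩) := by
      rw [Finset.sum_congr rfl (g := fun _ => b k2 ⟨0, by omega⟩ * b kl ⟨0, by omega⟩)]
      · simp
      · intro i _
        rw [h2 i ⟨0, by omega⟩, hconst i ⟨0, by omega⟩]; simp [mul_comm]
    rw [this] at horth
    have hN0 : (N : ℝ) ≠ 0 := by exact_mod_cast (by omega : N ≠ 0)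
    exact (mul_ne_zero hN0 (mul_ne_zero (hn1 _ h2) (hn1 _ hconst))) horth
  refine ⟨hlam ▸ hpos, fun w hw => ?_⟩
  set w' : EuclideanSpace ℝ (Fin N) := WithLp.toLp 2 w
  have hnorm : ∑ i, w i ^ 2 = ∑ k, (inner ℝ (b k) w') ^ 2 := by
    have h1 : ‖w'‖ ^ 2 = ∑ i, w i ^ 2 := by
      rw [EuclideanSpace.norm_sq_eq]; simp [w']
    rw [← h1, ← real_inner_self_eq_norm_sq, ← b.sum_inner_mul_inner w' w']
    exact Finset.sum_congr rfl fun k _ => by rw [real_inner_comm w']; ring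
  have hlast : inner ℝ (b kl) w' = 0 := by
    rw [PiLp.inner_apply]
    have : ∑ i : Fin N, inner ℝ (b kl i) (w' i) = b kl ⟨0, by omega⟩ * ∑ i, w i := by
      rw [Finset.mul_sum]
      refine Finset.sum_congr rfl fun i _ => ?_
      rw [hconst i ⟨0, by omega⟩]; simp [w', mul_comm]
    rw [this, hw, mul_zero]
  have key := hspec w'
  rw [hinner] at key
  change ∑ i, w i * ∑ j, G.a i j * (w i - w j) = _ at key
  rw [key, hlam, hnorm, Finset.mul_sum]
  refine Finset.sum_le_sum fun k _ => ?_
  by_cases hk : k = kl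
  · rw [hk, hlast]; simp
  · refine mul_le_mul_of_nonneg_right (hanti ?_) (sq_nonneg _)
    rw [Fin.le_def]
    have h1 := k.2
    have h2 : (k : ℕ) ≠ N - 1 := fun h => hk (Fin.ext h)
    simp only [k2]; omega

end Network

/-! ### The quadratic form inverse to the Laplacian -/

/-- Coercivity makes `P` injective, hence invertible in finite dimension. For x = Qp it reads lam
‖x‖² ≤ ⟨x, p⟩, and combined with Cauchy–Schwarz this gives the upper bound on ⟨Qp, p⟩. -/
theorem exists_symmetric_inverse_of_coercive {H : Type*} [NormedAddCommGroup H]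
    [InnerProductSpace ℝ H] [FiniteDimensional ℝ H] (P : H →ₗ[ℝ] H) (hP : P.IsSymmetric)
    {lam : ℝ} (hlam : 0 < lam) (hc : ∀ x, lam * ‖x‖ ^ 2 ≤ inner ℝ (P x) x) :
    ∃ Q : H →ₗ[ℝ] H, Q.IsSymmetric ∧ (∀ p, P (Q p) = p) ∧ (∀ p, 0 ≤ inner ℝ (Q p) p) ∧
      ∀ p, lam * inner ℝ (Q p) p ≤ ‖p‖ ^ 2 := by
  have hinj : Function.Injective P := by
    rw [injective_iff_map_eq_zero]
    intro x hx
    have h1 := hc x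
    rw [hx, inner_zero_left] at h1
    have h2 : ‖x‖ ^ 2 ≤ 0 := by nlinarith [sq_nonneg ‖x‖]
    exact norm_eq_zero.1 (pow_eq_zero_iff two_ne_zero |>.1 (le_antisymm h2 (sq_nonneg _)))
  set e := LinearEquiv.ofInjectiveEndo P hinj
  have he : ∀ p, P (e.symm p) = p := fun p => e.apply_symm_apply p
  refine ⟨e.symm.toLinearMap, fun x y => ?_, he, fun p => ?_, fun p => ?_⟩
  · have h := hP (e.symm x) (e.symm y)
    rw [he, he] at h
    exact h.symm
  · have h := hc (e.symm p)
    rw [he, real_inner_comm] at h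
    exact (mul_nonneg hlam.le (sq_nonneg _)).trans h
  · have h := hc (e.symm p)
    rw [he, real_inner_comm] at h
    have h2 : inner ℝ (e.symm p) p ≤ ‖e.symm p‖ * ‖p‖ := real_inner_le_norm _ _
    change lam * inner ℝ (e.symm p) p ≤ ‖p‖ ^ 2
    nlinarith [sq_nonneg (lam * ‖e.symm p‖ - ‖p‖), norm_nonneg p, norm_nonneg (e.symm p)]

/-- The stacked states of all nodes. -/
abbrev Stack (N n : ℕ) : Type := PiLp 2 (fun _ : Fin N => Vec n)

theorem Stack.inner_eq {N n : ℕ} (x y : Stack N n) : inner ℝ x y = ∑ i, inner ℝ (x i) (y i) :=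
  PiLp.inner_apply x y

namespace Network

variable {N : ℕ} (G : Network N) {n : ℕ}

/-- The Laplacian acting on stacked vectors. -/
def lap (n : ℕ) : Stack N n →ₗ[ℝ] Stack N n where
  toFun z := WithLp.toLp 2 fun i => ∑ j, G.a i j • (z i - z j)
  map_add' x y := by
    ext1 i
    simp only [PiLp.add_apply, ← Finset.sum_add_distrib, ← smul_add]
    exact Finset.sum_congr rfl fun j _ => by congr 1; abel
  map_smul' c x := by
    ext1 i
    simp only [PiLp.smul_apply, Finset.smul_sum, RingHom.id_apply]
    exact Finset.sum_congr rfl fun j _ => by rw [← smul_sub, smul_comm]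

theorem lap_apply (z : Stack N n) (i : Fin N) : G.lap n z i = ∑ j, G.a i j • (z i - z j) := rfl

theorem sum_lap (z : Stack N n) : ∑ i, G.lap n z i = 0 := by
  have h : ∑ i, G.lap n z i = -∑ i, G.lap n z i := by
    simp only [lap_apply]
    conv_lhs => rw [Finset.sum_comm]
    rw [← Finset.sum_neg_distrib]
    refine Finset.sum_congr rfl fun i _ => ?_
    rw [← Finset.sum_neg_distrib]
    refine Finset.sum_congr rfl fun j _ => ?_
    rw [← smul_neg, neg_sub, G.symm]
  have h2 : (2 : ℝ) • ∑ i, G.lap n z i = 0 := by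
    rw [two_smul]; nth_rewrite 1 [h]; exact neg_add_cancel _
  exact (smul_eq_zero.1 h2).resolve_left two_ne_zero

/-- Exchanging the summation indices turns both pairings into the symmetric form ½ ∑ a_ij ⟨x_i −
x_j, y_i − y_j⟩. -/
theorem lap_isSymmetric : (G.lap n).IsSymmetric := by
  intro x y
  have key : ∀ x y : Stack N n, inner ℝ (G.lap n x) y
      = 1 / 2 * ∑ i, ∑ j, G.a i j * inner ℝ (x i - x j) (y i - y j) := by
    intro x y
    have h1 : inner ℝ (G.lap n x) y = ∑ i, ∑ j, G.a i j * inner ℝ (x i - x j) (y i) := by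
      rw [Stack.inner_eq]
      refine Finset.sum_congr rfl fun i _ => ?_
      rw [lap_apply, sum_inner]
      exact Finset.sum_congr rfl fun j _ => real_inner_smul_left _ _ _
    have h2 : ∑ i, ∑ j, G.a i j * inner ℝ (x i - x j) (y i)
        = ∑ i, ∑ j, G.a i j * inner ℝ (x i - x j) (-y j) := by
      rw [Finset.sum_comm]
      refine Finset.sum_congr rfl fun i _ => Finset.sum_congr rfl fun j _ => ?_
      rw [G.symm, ← neg_sub (x i) (x j), inner_neg_left, inner_neg_right]
    have h3 : ∑ i, ∑ j, G.a i j * inner ℝ (x i - x j) (y i - y j)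
        = ∑ i, ∑ j, G.a i j * inner ℝ (x i - x j) (y i)
          + ∑ i, ∑ j, G.a i j * inner ℝ (x i - x j) (-y j) := by
      simp only [← Finset.sum_add_distrib, ← mul_add, ← inner_add_right, sub_eq_add_neg]
    rw [h1, h3, ← h2]; ring
  rw [key, real_inner_comm, key]
  congr 1
  exact Finset.sum_congr rfl fun i _ => Finset.sum_congr rfl fun j _ => by rw [real_inner_comm]

/-- The average of a stacked vector, repeated at every node. -/
def avg (N n : ℕ) : Stack N n →ₗ[ℝ] Stack N n where
  toFun z := WithLp.toLp 2 fun _ => (N : ℝ)⁻¹ • ∑ j, z j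
  map_add' x y := by
    ext1 i; simp [Finset.sum_add_distrib, smul_add]
  map_smul' c x := by
    ext1 i; simp [← Finset.smul_sum, smul_comm c]

theorem avg_apply (z : Stack N n) (i : Fin N) : avg N n z i = (N : ℝ)⁻¹ • ∑ j, z j := rfl

theorem inner_avg (x y : Stack N n) :
    inner ℝ (avg N n x) y = (N : ℝ)⁻¹ * inner ℝ (∑ j, x j) (∑ j, y j) := by
  rw [Stack.inner_eq]
  simp only [avg_apply, real_inner_smul_left]
  rw [← Finset.mul_sum, inner_sum]

theorem avg_isSymmetric : (avg N n).IsSymmetric := fun x y => by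
  rw [inner_avg, real_inner_comm (avg N n y) x, inner_avg, real_inner_comm]

theorem sum_avg (hN : 2 ≤ N) (z : Stack N n) : ∑ i, avg N n z i = ∑ i, z i := by
  have h : (N : ℝ) ≠ 0 := by exact_mod_cast (by omega : N ≠ 0)
  simp only [avg_apply, Finset.sum_const, Finset.card_univ, Fintype.card_fin]
  rw [← Nat.cast_smul_eq_nsmul ℝ, smul_smul, mul_inv_cancel₀ h, one_smul]

theorem inner_avg_self (hN : 2 ≤ N) (z : Stack N n) :
    inner ℝ (avg N n z) z = ‖avg N n z‖ ^ 2 := by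
  rw [← real_inner_self_eq_norm_sq, inner_avg, inner_avg, sum_avg hN]

theorem lap_avg (z : Stack N n) : G.lap n (avg N n z) = 0 := by
  ext1 i; rw [lap_apply]; simp [avg_apply]

variable {G}

/-- The coordinates decouple, so the scalar spectral gap applies to each of them. -/
theorem gap_of_sum_eq_zero (hN : 2 ≤ N) (hG : G.graph.Connected) {z : Stack N n}
    (hz : ∑ i, z i = 0) : G.lambda2 hN * ‖z‖ ^ 2 ≤ inner ℝ z (G.lap n z) := by
  have h1 : ‖z‖ ^ 2 = ∑ k, ∑ i, (z i k) ^ 2 := by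
    rw [PiLp.norm_sq_eq_of_L2, Finset.sum_comm]
    exact Finset.sum_congr rfl fun i _ => by
      rw [EuclideanSpace.norm_sq_eq]; simp
  have h2 : inner ℝ z (G.lap n z) = ∑ k, ∑ i, z i k * ∑ j, G.a i j * (z i k - z j k) := by
    rw [Stack.inner_eq, Finset.sum_comm]
    refine Finset.sum_congr rfl fun i _ => ?_
    rw [PiLp.inner_apply]
    refine Finset.sum_congr rfl fun k _ => ?_
    rw [lap_apply]
    simp [mul_comm]
  rw [h1, h2, Finset.mul_sum]
  refine Finset.sum_le_sum fun k _ => (lambda2_pos_and_gap hN hG).2 (fun i => z i k) ?_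
  have := congrArg (fun v : Vec n => v k) hz
  simpa using this

theorem gap (hN : 2 ≤ N) (hG : G.graph.Connected) (z : Stack N n) :
    G.lambda2 hN * ‖z - avg N n z‖ ^ 2 ≤ inner ℝ z (G.lap n z) := by
  have h0 : ∑ i, (z - avg N n z) i = 0 := by
    simp only [PiLp.sub_apply, Finset.sum_sub_distrib, sum_avg hN, sub_self]
  refine (gap_of_sum_eq_zero hN hG h0).trans_eq ?_
  rw [map_sub, lap_avg, sub_zero, inner_sub_left, ← G.lap_isSymmetric (avg N n z), lap_avg,
    inner_zero_left, sub_zero]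

/-- The Laplacian is singular, but adding λ₂ times the averaging projection makes it coercive with
constant λ₂. On sum-zero stacks the added term is invisible, so there `Q` inverts the Laplacian
itself; this is what cancels the cross term in the generator energy. -/
theorem exists_lap_inverse (hN : 2 ≤ N) (hG : G.graph.Connected) (n : ℕ) :
    ∃ Q : Stack N n →ₗ[ℝ] Stack N n, Q.IsSymmetric ∧ (∀ p, 0 ≤ inner ℝ (Q p) p) ∧
      (∀ p, G.lambda2 hN * inner ℝ (Q p) p ≤ ‖p‖ ^ 2) ∧
      ∀ p z, ∑ i, p i = 0 → inner ℝ (Q p) (G.lap n z) = inner ℝ p z := by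
  have hlam := (lambda2_pos_and_gap hN hG).1
  obtain ⟨Q, hQ, hPQ, h0, h1⟩ := exists_symmetric_inverse_of_coercive
    (G.lap n + G.lambda2 hN • avg N n)
    (G.lap_isSymmetric.add (avg_isSymmetric.smul (by simp))) hlam (by
      intro x
      have hg := gap hN hG x
      have h2 : ‖x - avg N n x‖ ^ 2 = ‖x‖ ^ 2 - ‖avg N n x‖ ^ 2 := by
        rw [norm_sub_sq_real, real_inner_comm, inner_avg_self hN]; ring
      rw [LinearMap.add_apply, inner_add_left, LinearMap.smul_apply, real_inner_smul_left,
        inner_avg_self hN, real_inner_comm]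
      rw [h2] at hg
      linarith)
  refine ⟨Q, hQ, h0, h1, fun p z hp => ?_⟩
  -- Summing the components of P(Qp) = p kills the Laplacian part and leaves λ₂ ∑ Qp = ∑ p = 0.
  have hs : ∑ i, Q p i = 0 := by
    have h3 := congrArg (fun v : Stack N n => ∑ i, v i) (hPQ p)
    simp only [LinearMap.add_apply, LinearMap.smul_apply, PiLp.add_apply, PiLp.smul_apply,
      Finset.sum_add_distrib, sum_lap, ← Finset.smul_sum, sum_avg hN, hp, zero_add] at h3
    exact (smul_eq_zero.1 h3).resolve_left hlam.ne'
  have h4 : inner ℝ (avg N n z) (Q p) = 0 := by rw [inner_avg, hs, inner_zero_right, mul_zero]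
  have h5 : inner ℝ p z = inner ℝ ((G.lap n + G.lambda2 hN • avg N n) (Q p)) z := by rw [hPQ]
  rw [h5, LinearMap.add_apply, inner_add_left, LinearMap.smul_apply, real_inner_smul_left,
    avg_isSymmetric, real_inner_comm (avg N n z), h4, mul_zero, add_zero, G.lap_isSymmetric]

end Network

/-! ### Dissipation of the optimum generator -/

section Dissipation

variable {H : Type*} [NormedAddCommGroup H] [InnerProductSpace ℝ H]

/-- The two entries of `const1` pay for the two cross terms: the first lets the gap dominate ⟨zperp,
p⟩, the second lets strong monotonicity dominate ⟨p, F⟩ and leaves ½‖z‖². Each cross term consumes a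
quarter of ‖p‖². -/
theorem generator_dissipation {z zperp p F Lz : H} {lam rho varrho : ℝ} (hlam : 0 < lam)
    (hrho : 0 < rho) (hgap : lam * ‖zperp‖ ^ 2 ≤ inner ℝ z Lz)
    (hp : inner ℝ z p = inner ℝ zperp p) (hF : rho * ‖z‖ ^ 2 ≤ inner ℝ F z)
    (hF' : ‖F‖ ≤ varrho * ‖z‖) :
    -(const1 lam rho varrho * (inner ℝ z Lz + inner ℝ F z)) - inner ℝ (z + p) (F + p)
      ≤ -(1 / 2 * (‖z‖ ^ 2 + ‖p‖ ^ 2)) := by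
  set c := const1 lam rho varrho
  have h1 : 1 ≤ c * lam := by
    have : 1 / lam ≤ c := le_max_left _ _
    rwa [div_le_iff₀ hlam] at this
  have h2 : 1 / 2 + varrho ^ 2 ≤ c * rho := by
    have : (1 + 2 * varrho ^ 2) / (2 * rho) ≤ c := le_max_right _ _
    rw [div_le_iff₀ (by positivity)] at this
    linarith
  have hc : 0 ≤ c := le_trans (by positivity) (le_max_left (1 / lam) _)
  have e1 : ‖zperp‖ ^ 2 ≤ c * inner ℝ z Lz := by
    have := mul_le_mul_of_nonneg_left hgap hc
    nlinarith [sq_nonneg ‖zperp‖]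
  have e2 : (1 / 2 + varrho ^ 2) * ‖z‖ ^ 2 ≤ c * inner ℝ F z := by
    have := mul_le_mul_of_nonneg_left hF hc
    nlinarith [sq_nonneg ‖z‖]
  have e3 : -inner ℝ zperp p ≤ ‖zperp‖ * ‖p‖ := by
    have := abs_real_inner_le_norm zperp p
    exact (neg_le_abs _).trans this
  have e4 : -inner ℝ p F ≤ ‖p‖ * (varrho * ‖z‖) := by
    have := abs_real_inner_le_norm p F
    exact (neg_le_abs _).trans (this.trans (mul_le_mul_of_nonneg_left hF' (norm_nonneg _)))
  have e5 : 0 ≤ inner ℝ F z := le_trans (by positivity) hF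
  rw [inner_add_left, inner_add_right, inner_add_right, hp, real_inner_self_eq_norm_sq,
    real_inner_comm F z]
  nlinarith [sq_nonneg (‖zperp‖ - ‖p‖ / 2), sq_nonneg (‖p‖ / 2 - varrho * ‖z‖)]

/-- The Lyapunov function of the generator. -/
def generatorEnergy (c : ℝ) (Q : H →ₗ[ℝ] H) (z p : H) : ℝ :=
  c / 2 * (‖z‖ ^ 2 + inner ℝ (Q p) p) + 1 / 2 * ‖z + p‖ ^ 2

theorem generatorEnergy_le {Q : H →ₗ[ℝ] H} {lam rho varrho : ℝ} (hlam : 0 < lam)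
    (hQ : ∀ p, lam * inner ℝ (Q p) p ≤ ‖p‖ ^ 2) (z p : H) :
    generatorEnergy (const1 lam rho varrho) Q z p
      ≤ const3 lam rho varrho * (‖z‖ ^ 2 + ‖p‖ ^ 2) := by
  unfold generatorEnergy const3
  set c := const1 lam rho varrho
  have hc : 0 ≤ c := le_trans (by positivity) (le_max_left (1 / lam) _)
  set M := max 1 (1 / lam)
  have hM1 : 1 ≤ M := le_max_left _ _
  have hM2 : 1 / lam ≤ M := le_max_right _ _
  have h1 : inner ℝ (Q p) p ≤ M * ‖p‖ ^ 2 := by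
    have h2 : inner ℝ (Q p) p ≤ 1 / lam * ‖p‖ ^ 2 := by
      rw [div_mul_eq_mul_div, one_mul, le_div_iff₀ hlam, mul_comm]; exact hQ p
    exact h2.trans (mul_le_mul_of_nonneg_right hM2 (sq_nonneg _))
  have h3 : ‖z‖ ^ 2 ≤ M * ‖z‖ ^ 2 := le_mul_of_one_le_left (sq_nonneg _) hM1
  have h4 : ‖z + p‖ ^ 2 ≤ 2 * (‖z‖ ^ 2 + ‖p‖ ^ 2) := by
    have := norm_add_le z p
    nlinarith [sq_nonneg (‖z‖ - ‖p‖), norm_nonneg (z + p)]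
  have h5 : c / 2 * (‖z‖ ^ 2 + inner ℝ (Q p) p) ≤ c / 2 * (M * ‖z‖ ^ 2 + M * ‖p‖ ^ 2) :=
    mul_le_mul_of_nonneg_left (add_le_add h3 h1) (by positivity)
  have h6 : 0 ≤ c * M * (‖z‖ ^ 2 + ‖p‖ ^ 2) := by positivity
  nlinarith

/-- The energy controls `z` and `z + p`, hence `p`; the `Q` term is only needed to be nonnegative.
-/
theorem le_generatorEnergy {Q : H →ₗ[ℝ] H} (hQ : ∀ p, 0 ≤ inner ℝ (Q p) p) {c : ℝ} (hc : 0 < c)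
    (z p : H) : ‖z‖ ^ 2 + ‖p‖ ^ 2 ≤ (6 / c + 4) * generatorEnergy c Q z p := by
  unfold generatorEnergy
  have h1 : ‖p‖ ^ 2 ≤ 2 * ‖z + p‖ ^ 2 + 2 * ‖z‖ ^ 2 := by
    have h : ‖p‖ ≤ ‖z + p‖ + ‖z‖ := by
      have := norm_sub_le (z + p) z
      rwa [add_sub_cancel_left] at this
    nlinarith [sq_nonneg (‖z + p‖ - ‖z‖), norm_nonneg p]
  have h2 : (6 / c + 4) * (c / 2 * (‖z‖ ^ 2 + inner ℝ (Q p) p) + 1 / 2 * ‖z + p‖ ^ 2)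
      = 3 * ‖z‖ ^ 2 + 2 * ‖z + p‖ ^ 2 + (3 * inner ℝ (Q p) p + 3 / c * ‖z + p‖ ^ 2
        + 2 * c * (‖z‖ ^ 2 + inner ℝ (Q p) p)) := by
    field_simp; ring
  rw [h2]
  have h3 : 0 ≤ 3 * inner ℝ (Q p) p + 3 / c * ‖z + p‖ ^ 2
      + 2 * c * (‖z‖ ^ 2 + inner ℝ (Q p) p) := by
    have := hQ p; positivity
  linarith

theorem hasDerivWithinAt_generatorEnergy [FiniteDimensional ℝ H] {Q : H →ₗ[ℝ] H}
    (hQ : Q.IsSymmetric) (c : ℝ) {z p : ℝ → H} {z' p' : H} {I : Set ℝ} {t : ℝ}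
    (hz : HasDerivWithinAt z z' I t) (hp : HasDerivWithinAt p p' I t) :
    HasDerivWithinAt (fun r => generatorEnergy c Q (z r) (p r))
      (c * (inner ℝ (z t) z' + inner ℝ (Q (p t)) p') + inner ℝ (z t + p t) (z' + p')) I t := by
  have hQp : HasDerivWithinAt (fun r => Q (p r)) (Q p') I t :=
    (LinearMap.toContinuousLinearMap Q).hasFDerivAt.comp_hasDerivWithinAt t hp
  have h := (((hz.norm_sq).add (hQp.inner ℝ hp)).const_mul (c / 2)).add
    (((hz.add hp).norm_sq).const_mul (1 / 2))
  refine h.congr_deriv ?_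
  rw [hQ p' (p t), real_inner_comm p' (Q (p t))]
  simp only [Pi.add_apply]
  ring

end Dissipation

/-! ### The prescribed-time gains -/

section Gains

variable {t₀ T t : ℝ}

theorem mu_pos (ht : t ∈ Ico t₀ (t₀ + T)) : 0 < mu t₀ T t :=
  one_div_pos.2 (by linarith [ht.2])

theorem hasDerivAt_mu (ht : t ∈ Ico t₀ (t₀ + T)) :
    HasDerivAt (mu t₀ T) (mu t₀ T t ^ 2) t := by
  have hne : T + t₀ - t ≠ 0 := by have := ht.2; intro h; linarith
  have h := ((hasDerivAt_id t).const_sub (T + t₀)).inv hne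
  refine (h.congr_deriv ?_).congr_of_eventuallyEq (Eventually.of_forall fun r => by simp [mu])
  simp [mu]

theorem mu_mono {s : ℝ} (hst : s ≤ t) (ht : t < t₀ + T) : mu t₀ T s ≤ mu t₀ T t :=
  one_div_le_one_div_of_le (by linarith) (by linarith)

theorem tendsto_mu : Tendsto (mu t₀ T) (𝓝[<] (T + t₀)) atTop := by
  have h1 : Tendsto (fun t => T + t₀ - t) (𝓝[<] (T + t₀)) (𝓝[>] 0) := by
    refine tendsto_nhdsWithin_iff.2 ⟨?_, ?_⟩
    · have : Tendsto (fun t => T + t₀ - t) (𝓝 (T + t₀)) (𝓝 (T + t₀ - (T + t₀))) :=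
        tendsto_const_nhds.sub tendsto_id
      rw [sub_self] at this
      exact this.mono_left nhdsWithin_le_nhds
    · filter_upwards [self_mem_nhdsWithin] with t ht
      exact sub_pos.2 (mem_Iio.1 ht)
  refine (tendsto_inv_nhdsGT_zero.comp h1).congr fun t => ?_
  simp [mu]

variable {α : ℝ → ℝ}

theorem IsKInfty.pos (hα : IsKInfty α) {s : ℝ} (hs : 0 < s) : 0 < α s := by
  have := hα.strictMonoOn (mem_Ici.2 le_rfl) (mem_Ici.2 hs.le) hs
  rwa [hα.map_zero] at this

theorem IsKInfty.pos_mu (hα : IsKInfty α) (ht : t ∈ Ico t₀ (t₀ + T)) : 0 < α (mu t₀ T t) :=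
  hα.pos (mu_pos ht)

theorem IsKInfty.mono_mu (hα : IsKInfty α) {s : ℝ} (hs : t₀ ≤ s) (hst : s ≤ t)
    (ht : t < t₀ + T) : α (mu t₀ T s) ≤ α (mu t₀ T t) :=
  hα.strictMonoOn.monotoneOn (mem_Ici.2 (mu_pos ⟨hs, hst.trans_lt ht⟩).le)
    (mem_Ici.2 (mu_pos ⟨hs.trans hst, ht⟩).le) (mu_mono hst ht)

theorem IsKInfty.tendsto_mu (hα : IsKInfty α) :
    Tendsto (fun t => α (mu t₀ T t)) (𝓝[<] (T + t₀)) atTop :=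
  hα.tendsto_atTop.comp DPTCO.tendsto_mu

theorem hasDerivAt_gain (hd : DifferentiableOn ℝ α (Ioi 0)) (ht : t ∈ Ico t₀ (t₀ + T)) :
    HasDerivAt (fun r => α (mu t₀ T r)) (deriv α (mu t₀ T t) * mu t₀ T t ^ 2) t :=
  (hd.differentiableAt (Ioi_mem_nhds (mu_pos ht))).hasDerivAt.comp t (hasDerivAt_mu ht)

theorem deriv_gain_nonneg (hα : IsKInfty α) (ht : t ∈ Ico t₀ (t₀ + T)) :
    0 ≤ deriv α (mu t₀ T t) * mu t₀ T t ^ 2 := by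
  refine mul_nonneg ?_ (sq_nonneg _)
  rw [← derivWithin_of_mem_nhds (Ioi_mem_nhds (mu_pos ht))]
  exact (hα.strictMonoOn.monotoneOn.mono Ioi_subset_Ici_self).derivWithin_nonneg

/-- Since μ' = μ², the factor s⁻² of the gain criteria cancels, and the bound involves the current
gain alone. -/
theorem deriv_gain_le {k : ℝ} (h : ∀ s, 0 < s → deriv α s ≤ k * (s ^ 2)⁻¹ * α s ^ 2)
    (ht : t ∈ Ico t₀ (t₀ + T)) :
    deriv α (mu t₀ T t) * mu t₀ T t ^ 2 ≤ k * α (mu t₀ T t) ^ 2 := by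
  have hm := mu_pos ht
  refine (mul_le_mul_of_nonneg_right (h _ hm) (sq_nonneg _)).trans_eq ?_
  field_simp

end Gains

/-! ### Differentiation of stacked curves and first-order optimality -/

theorem hasDerivWithinAt_Ici_of_Ico {E : Type*} [NormedAddCommGroup E] [NormedSpace ℝ E]
    {f : ℝ → E} {f' : E} {a b t : ℝ} (h : HasDerivWithinAt f f' (Ico a b) t)
    (ht : t ∈ Ico a b) : HasDerivWithinAt f f' (Ici t) t :=
  h.mono_of_mem_nhdsWithin (Ico_mem_nhdsGE_of_mem ht)

instance Stack.instContinuousSMul (N n : ℕ) : ContinuousSMul ℝ (Stack N n) :=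
  IsBoundedSMul.continuousSMul

theorem hasDerivWithinAt_stack {N n : ℕ} {f : ℝ → Stack N n} {f' : Stack N n}
    {I : Set ℝ} {t : ℝ} (h : ∀ i, HasDerivWithinAt (fun r => f r i) (f' i) I t) :
    HasDerivWithinAt f f' I t := by
  have h1 : HasDerivWithinAt (fun r => WithLp.ofLp (f r)) (WithLp.ofLp f') I t :=
    hasDerivWithinAt_pi.2 h
  exact ((PiLp.continuousLinearEquiv 2 ℝ
    (fun _ : Fin N => Vec n)).symm.toContinuousLinearMap.hasFDerivAt).comp_hasDerivWithinAt t h1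

theorem sum_gradient_eq_zero {N n : ℕ} {f : Fin N → Vec n → ℝ}
    (hf : ∀ i, Differentiable ℝ (f i)) {z : Vec n}
    (hz : IsMinOn (fun w => ∑ i, f i w) Set.univ z) : ∑ i, gradient (f i) z = 0 := by
  have h1 : fderiv ℝ (fun w => ∑ i, f i w) z = 0 :=
    (hz.isLocalMin univ_mem).fderiv_eq_zero
  rw [fderiv_fun_sum fun i _ => (hf i).differentiableAt] at h1
  have h2 := congrArg (InnerProductSpace.toDual ℝ (Vec n)).symm h1
  rwa [map_sum, map_zero] at h2

/-! ### Decay of the optimum generator -/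

section Generator

variable {N n m : ℕ} {G : Network N} {f : Fin N → Vec n → ℝ} {α : ℝ → ℝ}
  {A : Fin N → Agent n} {K : Fin N → Gains} {t₀ T t₁ : ℝ} {S : ℝ → Fin N → AgentState n}

/-- Stacked deviation of the `ϖ`-states from `z`. -/
def devϖ (z : Vec n) (s : Fin N → AgentState n) : Stack N n := WithLp.toLp 2 fun i => (s i).ϖ - z

/-- Stacked deviation of the `p`-states from their equilibrium. -/
def devp (f : Fin N → Vec n → ℝ) (z : Vec n) (s : Fin N → AgentState n) : Stack N n :=
  WithLp.toLp 2 fun i => (s i).p + gradient (f i) z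

/-- Stacked deviation of the gradients. -/
def devGrad (f : Fin N → Vec n → ℝ) (z : Vec n) (s : Fin N → AgentState n) : Stack N n :=
  WithLp.toLp 2 fun i => gradient (f i) (s i).ϖ - gradient (f i) z

theorem lap_devϖ (z : Vec n) (s : Fin N → AgentState n) (i : Fin N) :
    G.lap n (devϖ z s) i = ∑ j, G.a i j • ((s i).ϖ - (s j).ϖ) := by
  rw [Network.lap_apply]
  exact Finset.sum_congr rfl fun j _ => by simp [devϖ]

theorem hasDerivWithinAt_devϖ (hS : IsSolution G f α m A K t₀ T t₁ S) (z : Vec n) {t : ℝ}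
    (ht : t ∈ Ico t₀ t₁) :
    HasDerivWithinAt (fun r => devϖ z (S r))
      (-(α (mu t₀ T t) • (G.lap n (devϖ z (S t)) + devGrad f z (S t) + devp f z (S t))))
      (Ico t₀ t₁) t := by
  refine hasDerivWithinAt_stack fun i => ?_
  have h : HasDerivWithinAt (fun r => devϖ z (S r) i) _ (Ico t₀ t₁) t :=
    (hS.ϖ_eq t ht i).sub_const z
  refine h.congr_deriv ?_
  rw [PiLp.neg_apply, PiLp.smul_apply, PiLp.add_apply, PiLp.add_apply, lap_devϖ]
  simp only [devGrad, devp]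
  congr 2; abel

theorem hasDerivWithinAt_devp (hS : IsSolution G f α m A K t₀ T t₁ S) (z : Vec n) {t : ℝ}
    (ht : t ∈ Ico t₀ t₁) :
    HasDerivWithinAt (fun r => devp f z (S r))
      (α (mu t₀ T t) • G.lap n (devϖ z (S t))) (Ico t₀ t₁) t := by
  refine hasDerivWithinAt_stack fun i => ?_
  have h : HasDerivWithinAt (fun r => devp f z (S r) i) _ (Ico t₀ t₁) t :=
    (hS.p_eq t ht i).add_const (gradient (f i) z)
  refine h.congr_deriv ?_
  rw [PiLp.smul_apply, lap_devϖ]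

/-- The components of a Laplacian sum to zero, so ∑ p is conserved. This keeps the deviation of `p`
where `Q` inverts the Laplacian. -/
theorem sum_p_eq_zero (hS : IsSolution G f α m A K t₀ T t₁ S) (h0 : ∑ i, (S t₀ i).p = 0) {t : ℝ}
    (ht : t ∈ Ico t₀ t₁) : ∑ i, (S t i).p = 0 := by
  have hd : ∀ r ∈ Ico t₀ t₁, HasDerivWithinAt (fun r => ∑ i, (S r i).p) 0 (Ico t₀ t₁) r := by
    intro r hr
    refine (HasDerivWithinAt.fun_sum fun i _ => hS.p_eq r hr i).congr_deriv ?_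
    have := G.sum_lap (devϖ 0 (S r))
    simp only [lap_devϖ] at this
    rw [← Finset.smul_sum, this, smul_zero]
  have hsub : Icc t₀ t ⊆ Ico t₀ t₁ := fun r hr => ⟨hr.1, hr.2.trans_lt ht.2⟩
  rw [← h0]
  exact constant_of_has_deriv_right_zero (f := fun r => ∑ i, (S r i).p)
    (fun r hr => ((hd r (hsub hr)).continuousWithinAt).mono hsub)
    (fun r hr => hasDerivWithinAt_Ici_of_Ico (hd r (hsub ⟨hr.1, hr.2.le⟩))
      (hsub ⟨hr.1, hr.2.le⟩)) t (right_mem_Icc.2 ht.1)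

variable {rho varrho : ℝ}

theorem devGrad_monotone (hf : ∀ i, IsAdmissibleCost rho varrho (f i)) (z : Vec n)
    (s : Fin N → AgentState n) :
    rho * ‖devϖ z s‖ ^ 2 ≤ inner ℝ (devGrad f z s) (devϖ z s) := by
  rw [Stack.inner_eq, PiLp.norm_sq_eq_of_L2, Finset.mul_sum]
  exact Finset.sum_le_sum fun i _ => (hf i).strong _ _

theorem norm_devGrad_le (hf : ∀ i, IsAdmissibleCost rho varrho (f i)) (hv : 0 < varrho)
    (z : Vec n) (s : Fin N → AgentState n) : ‖devGrad f z s‖ ≤ varrho * ‖devϖ z s‖ := by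
  refine le_of_sq_le_sq ?_ (by positivity)
  rw [mul_pow, PiLp.norm_sq_eq_of_L2, PiLp.norm_sq_eq_of_L2, Finset.mul_sum]
  refine Finset.sum_le_sum fun i _ => ?_
  rw [← mul_pow]
  exact pow_le_pow_left₀ (norm_nonneg _) ((hf i).lipschitz _ _) 2

theorem const1_pos {lam : ℝ} (hlam : 0 < lam) : 0 < const1 lam rho varrho :=
  lt_of_lt_of_le (by positivity) (le_max_left _ _)

theorem const3_pos {lam : ℝ} (hlam : 0 < lam) : 0 < const3 lam rho varrho := by
  have h := const1_pos (rho := rho) (varrho := varrho) hlam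
  have : 0 < max 1 (1 / lam) := lt_of_lt_of_le one_pos (le_max_left _ _)
  unfold const3; positivity

/-- The logarithmic derivative of the weight is at most ½ cs α + L2 αξ: the first term is the
condition on `α`, and `le_gain` bounds the second by ½ cs α as well. -/
theorem hasDerivWithinAt_weight {cs L2 : ℝ} (hL2 : 0 < L2) (hα : IsGeneratorGain cs α)
    {αξ : ℝ → ℝ} (hξ : IsTrackingGain cs L2 α αξ) {t : ℝ} (ht : t ∈ Ico t₀ (t₀ + T)) :
    ∃ b', HasDerivAt (fun r => α (mu t₀ T r) * αξ (mu t₀ T r) ^ L2) b' t ∧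
      b' ≤ cs * α (mu t₀ T t) * (α (mu t₀ T t) * αξ (mu t₀ T t) ^ L2) := by
  have hg := hξ.kInfty.pos_mu ht
  have ha := hα.kInfty.pos_mu ht
  have d1 := hasDerivAt_gain hα.differentiableOn ht
  have d2 := (hasDerivAt_gain hξ.differentiableOn ht).rpow_const (p := L2) (Or.inl hg.ne')
  have b1 := deriv_gain_le hα.deriv_le ht
  have b2 : deriv αξ (mu t₀ T t) * mu t₀ T t ^ 2 ≤ 1 * αξ (mu t₀ T t) ^ 2 :=
    deriv_gain_le (by simpa using hξ.deriv_le) ht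
  refine ⟨_, d1.mul d2, ?_⟩
  have b3 := hξ.le_gain _ (mu_pos ht).le
  set g := αξ (mu t₀ T t)
  set a := α (mu t₀ T t)
  have hgL : 0 < g ^ L2 := Real.rpow_pos_of_pos hg _
  rw [Real.rpow_sub_one hg.ne']
  have e1 : deriv α (mu t₀ T t) * mu t₀ T t ^ 2 * g ^ L2 ≤ 1 / 2 * cs * a ^ 2 * g ^ L2 :=
    mul_le_mul_of_nonneg_right b1 hgL.le
  rw [le_div_iff₀ (by positivity)] at b3
  have e2 : deriv αξ (mu t₀ T t) * mu t₀ T t ^ 2 * L2 * (g ^ L2 / g) ≤ L2 * g * g ^ L2 := by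
    have : deriv αξ (mu t₀ T t) * mu t₀ T t ^ 2 * (L2 * (g ^ L2 / g))
        ≤ 1 * g ^ 2 * (L2 * (g ^ L2 / g)) := mul_le_mul_of_nonneg_right b2 (by positivity)
    calc _ = deriv αξ (mu t₀ T t) * mu t₀ T t ^ 2 * (L2 * (g ^ L2 / g)) := by ring
      _ ≤ _ := this
      _ = _ := by field_simp
  have e3 : L2 * g * g ^ L2 ≤ cs * a / 2 * g ^ L2 := by
    refine mul_le_mul_of_nonneg_right ?_ hgL.le
    linarith
  calc _ ≤ 1 / 2 * cs * a ^ 2 * g ^ L2 + a * (cs * a / 2 * g ^ L2) :=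
        add_le_add e1 (mul_le_mul_of_nonneg_left (e2.trans e3) ha.le)
    _ = _ := by ring

/-- The energy decays at rate at least 2 c* α and the squared weight grows at rate at most 2 c* α,
so their product is nonincreasing. -/
theorem weighted_energy_le (hN : 2 ≤ N) (hG : G.graph.Connected) (hrho : 0 < rho)
    (hvarrho : 0 < varrho) (hf : ∀ i, IsAdmissibleCost rho varrho (f i)) {z : Vec n}
    (hz : IsMinOn (fun w => ∑ i, f i w) Set.univ z)
    (hα : IsGeneratorGain (cStar (G.lambda2 hN) rho varrho) α)
    {L2 : ℝ} (hL2 : 0 < L2) {αξ : ℝ → ℝ}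
    (hξ : IsTrackingGain (cStar (G.lambda2 hN) rho varrho) L2 α αξ)
    {Q : Stack N n →ₗ[ℝ] Stack N n} (hQ : Q.IsSymmetric) (hQ0 : ∀ p, 0 ≤ inner ℝ (Q p) p)
    (hQ1 : ∀ p, G.lambda2 hN * inner ℝ (Q p) p ≤ ‖p‖ ^ 2)
    (hQ2 : ∀ p z, ∑ i, p i = 0 → inner ℝ (Q p) (G.lap n z) = inner ℝ p z)
    (ht₁ : t₁ ≤ t₀ + T) (hS : IsSolution G f α m A K t₀ T t₁ S) (h0 : ∑ i, (S t₀ i).p = 0)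
    {t : ℝ} (ht : t ∈ Ico t₀ t₁) :
    (α (mu t₀ T t) * αξ (mu t₀ T t) ^ L2) ^ 2 *
        generatorEnergy (const1 (G.lambda2 hN) rho varrho) Q (devϖ z (S t)) (devp f z (S t))
      ≤ (α (mu t₀ T t₀) * αξ (mu t₀ T t₀) ^ L2) ^ 2 *
        generatorEnergy (const1 (G.lambda2 hN) rho varrho) Q (devϖ z (S t₀))
          (devp f z (S t₀)) := by
  have hlam := (Network.lambda2_pos_and_gap hN hG).1
  set lam := G.lambda2 hN
  set c := const1 lam rho varrho
  have hc3 := const3_pos (rho := rho) (varrho := varrho) hlam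
  set c3 := const3 lam rho varrho
  have hcs : cStar lam rho varrho = 1 / (4 * c3) := rfl
  set cs := cStar lam rho varrho
  have hmem : ∀ r ∈ Ico t₀ t₁, r ∈ Ico t₀ (t₀ + T) := fun r hr => ⟨hr.1, hr.2.trans_le ht₁⟩
  set V : ℝ → ℝ := fun r => generatorEnergy c Q (devϖ z (S r)) (devp f z (S r))
  set b : ℝ → ℝ := fun r => α (mu t₀ T r) * αξ (mu t₀ T r) ^ L2
  have hV : ∀ r ∈ Ico t₀ t₁, ∃ V', HasDerivWithinAt V V' (Ico t₀ t₁) r ∧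
      V' ≤ -(2 * cs * α (mu t₀ T r)) * V r := by
    intro r hr
    refine ⟨_, hasDerivWithinAt_generatorEnergy hQ c (hasDerivWithinAt_devϖ hS z hr)
      (hasDerivWithinAt_devp hS z hr), ?_⟩
    set a := α (mu t₀ T r)
    have ha : 0 < a := hα.kInfty.pos_mu (hmem r hr)
    set w := devϖ z (S r)
    set p := devp f z (S r)
    set F := devGrad f z (S r)
    -- Conservation of ∑ p and stationarity of the total cost at `z`.
    have hp : ∑ i, p i = 0 := by
      simp only [p, devp, Finset.sum_add_distrib]
      rw [sum_p_eq_zero hS h0 hr, sum_gradient_eq_zero (fun i => (hf i).differentiable) hz, add_zero]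
    have hwp : inner ℝ w p = inner ℝ (w - Network.avg N n w) p := by
      rw [inner_sub_left, Network.inner_avg, hp, inner_zero_right, mul_zero, sub_zero]
    have hdis := generator_dissipation hlam hrho (Network.gap hN hG w) hwp
      (devGrad_monotone hf z (S r)) (norm_devGrad_le hf hvarrho z (S r))
    have hle := generatorEnergy_le (rho := rho) (varrho := varrho) hlam hQ1 w p
    change V r ≤ c3 * (‖w‖ ^ 2 + ‖p‖ ^ 2) at hle
    have hle2 : 2 * cs * V r ≤ 1 / 2 * (‖w‖ ^ 2 + ‖p‖ ^ 2) := by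
      rw [hcs]
      calc 2 * (1 / (4 * c3)) * V r
          ≤ 2 * (1 / (4 * c3)) * (c3 * (‖w‖ ^ 2 + ‖p‖ ^ 2)) :=
            mul_le_mul_of_nonneg_left hle (by positivity)
        _ = _ := by field_simp; norm_num
    -- The term ⟨w, p⟩ coming from ‖w‖² cancels against the `Q` term, and the Laplacian drops out of
    -- the rate of `w + p`.
    have hid : c * (inner ℝ w (-(a • (G.lap n w + F + p))) + inner ℝ (Q p) (a • G.lap n w))
        + inner ℝ (w + p) (-(a • (G.lap n w + F + p)) + a • G.lap n w)
        = a * (-(c * (inner ℝ w (G.lap n w) + inner ℝ F w)) - inner ℝ (w + p) (F + p)) := by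
      have e : -(a • (G.lap n w + F + p)) + a • G.lap n w = -(a • (F + p)) := by
        rw [← neg_inj, neg_add, neg_neg, neg_neg, ← sub_eq_add_neg, ← smul_sub]; congr 1; abel
      rw [e, inner_neg_right, inner_neg_right, real_inner_smul_right, real_inner_smul_right,
        real_inner_smul_right, hQ2 p w hp, inner_add_right, inner_add_right w,
        real_inner_comm F w, real_inner_comm p w]
      ring
    rw [hid]
    calc _ ≤ a * -(1 / 2 * (‖w‖ ^ 2 + ‖p‖ ^ 2)) := mul_le_mul_of_nonneg_left hdis ha.le
      _ ≤ a * -(2 * cs * V r) := mul_le_mul_of_nonneg_left (neg_le_neg hle2) ha.le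
      _ = _ := by ring
  choose! V' hV' hVle using hV
  have hb : ∀ r ∈ Ico t₀ t₁, ∃ b', HasDerivAt b b' r ∧ b' ≤ cs * α (mu t₀ T r) * b r :=
    fun r hr => hasDerivWithinAt_weight hL2 hα hξ (hmem r hr)
  choose! b' hb' hble using hb
  have hd : ∀ r ∈ Ico t₀ t₁, HasDerivWithinAt (fun r => b r ^ 2 * V r)
      (2 * b r * b' r * V r + b r ^ 2 * V' r) (Ico t₀ t₁) r := by
    intro r hr
    refine (((hb' r hr).hasDerivWithinAt.pow 2).mul (hV' r hr)).congr_deriv ?_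
    simp
  have hanti : AntitoneOn (fun r => b r ^ 2 * V r) (Ico t₀ t₁) := by
    refine antitoneOn_of_hasDerivWithinAt_nonpos (convex_Ico _ _)
      (fun r hr => (hd r hr).continuousWithinAt)
      (f' := fun r => 2 * b r * b' r * V r + b r ^ 2 * V' r)
      (fun r hr => (hd r (interior_subset hr)).mono interior_subset) fun r hr => ?_
    have hr := interior_subset hr
    have hb0 : 0 < b r := mul_pos (hα.kInfty.pos_mu (hmem r hr))
      (Real.rpow_pos_of_pos (hξ.kInfty.pos_mu (hmem r hr)) _)
    have hV0 : 0 ≤ V r := by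
      have h1 := le_generatorEnergy hQ0 (const1_pos (rho := rho) (varrho := varrho) hlam)
        (devϖ z (S r)) (devp f z (S r))
      have h2 : 0 < 6 / c + 4 := by
        have := const1_pos (rho := rho) (varrho := varrho) hlam
        positivity
      exact (mul_nonneg_iff_of_pos_left h2).1 (le_trans (by positivity) h1)
    have h1 : 2 * b r * b' r * V r ≤ 2 * b r * (cs * α (mu t₀ T r) * b r) * V r :=
      mul_le_mul_of_nonneg_right (mul_le_mul_of_nonneg_left (hble r hr) (by positivity)) hV0
    have h2 : b r ^ 2 * V' r ≤ b r ^ 2 * (-(2 * cs * α (mu t₀ T r)) * V r) :=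
      mul_le_mul_of_nonneg_left (hVle r hr) (by positivity)
    linarith
  exact hanti (left_mem_Ico.2 (ht.1.trans_lt ht.2)) ht ht.1

end Generator

/-! ### Bounds on the generator states and on the reference velocity -/

section GeneratorBound

variable {N n m : ℕ} {G : Network N} {f : Fin N → Vec n → ℝ} {α : ℝ → ℝ}
  {K : Fin N → Gains} {t₀ T : ℝ} {rho varrho : ℝ}

/-- The right-hand side of the `ϖ`-equation of node `i`. -/
def ϖRate (G : Network N) (f : Fin N → Vec n → ℝ) (a : ℝ) (s : Fin N → AgentState n)
    (i : Fin N) : Vec n :=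
  -(a • ((∑ j, G.a i j • ((s i).ϖ - (s j).ϖ)) + gradient (f i) (s i).ϖ + (s i).p))

/-- The initial energy is bounded through `R` alone and the generator ignores the plants, so `B` can
precede the gains `K`. The velocity carries one factor α, which is why its weight is only αξ^{L2}.
-/
theorem exists_generator_bound (hN : 2 ≤ N) (hG : G.graph.Connected) (hrho : 0 < rho)
    (hvarrho : 0 < varrho) (hf : ∀ i, IsAdmissibleCost rho varrho (f i)) {z : Vec n}
    (hz : IsMinOn (fun w => ∑ i, f i w) Set.univ z)
    (hα : IsGeneratorGain (cStar (G.lambda2 hN) rho varrho) α)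
    {L2 : ℝ} (hL2 : 0 < L2) {αξ : ℝ → ℝ}
    (hξ : IsTrackingGain (cStar (G.lambda2 hN) rho varrho) L2 α αξ) (A : Fin N → Agent n) (m : ℕ)
    (t₀ T R : ℝ) :
    ∃ B, 0 ≤ B ∧ ∀ (K : Fin N → Gains) (t₁ : ℝ) (S : ℝ → Fin N → AgentState n), t₁ ≤ t₀ + T →
      IsSolution G f α m A K t₀ T t₁ S → IsGeneratorInit R (S t₀) → ∀ t ∈ Ico t₀ t₁, ∀ i,
        α (mu t₀ T t) * αξ (mu t₀ T t) ^ L2 * ‖(S t i).ϖ - z‖ ≤ B ∧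
        α (mu t₀ T t) * αξ (mu t₀ T t) ^ L2 * ‖(S t i).p + gradient (f i) z‖ ≤ B ∧
        αξ (mu t₀ T t) ^ L2 * ‖ϖRate G f (α (mu t₀ T t)) (S t) i‖ ≤ B := by
  have hlam := (Network.lambda2_pos_and_gap hN hG).1
  obtain ⟨Q, hQ, hQ0, hQ1, hQ2⟩ := Network.exists_lap_inverse hN hG n
  set c := const1 (G.lambda2 hN) rho varrho with hc_def
  have hc : 0 < c := const1_pos hlam
  set c3 := const3 (G.lambda2 hN) rho varrho
  have hc3 : 0 < c3 := const3_pos hlam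
  set C := 6 / c + 4
  have hC : 0 < C := by positivity
  set b₀ := α (mu t₀ T t₀) * αξ (mu t₀ T t₀) ^ L2
  set E₀ := c3 * (∑ _i : Fin N, (R + ‖z‖) ^ 2 + ∑ i, (R + ‖gradient (f i) z‖) ^ 2)
  have hE₀ : 0 ≤ E₀ := mul_nonneg hc3.le (add_nonneg
    (Finset.sum_nonneg fun _ _ => sq_nonneg _) (Finset.sum_nonneg fun _ _ => sq_nonneg _))
  set M := √(C * (b₀ ^ 2 * E₀))
  set L := LinearMap.toContinuousLinearMap (G.lap n)
  have hM : 0 ≤ M := Real.sqrt_nonneg _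
  refine ⟨(‖L‖ + varrho + 1) * M + M, by positivity, ?_⟩
  intro K t₁ S ht₁ hS h0 t ht i
  have ht' : t ∈ Ico t₀ (t₀ + T) := ⟨ht.1, ht.2.trans_le ht₁⟩
  have hW := weighted_energy_le hN hG hrho hvarrho hf hz hα hL2 hξ hQ hQ0 hQ1 hQ2 ht₁ hS h0.1 ht
  have ha : 0 < α (mu t₀ T t) := hα.kInfty.pos_mu ht'
  have hgL : 0 < αξ (mu t₀ T t) ^ L2 := Real.rpow_pos_of_pos (hξ.kInfty.pos_mu ht') _
  set a := α (mu t₀ T t)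
  set gL := αξ (mu t₀ T t) ^ L2
  set w := devϖ z (S t)
  set p := devp f z (S t)
  have hV₀ : generatorEnergy c Q (devϖ z (S t₀)) (devp f z (S t₀)) ≤ E₀ := by
    refine (generatorEnergy_le hlam hQ1 _ _).trans (mul_le_mul_of_nonneg_left ?_ hc3.le)
    rw [PiLp.norm_sq_eq_of_L2, PiLp.norm_sq_eq_of_L2]
    refine add_le_add (Finset.sum_le_sum fun j _ => ?_) (Finset.sum_le_sum fun j _ => ?_)
    · exact pow_le_pow_left₀ (norm_nonneg _)
        ((norm_sub_le _ _).trans (add_le_add_left (h0.2 j).1 _)) 2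
    · exact pow_le_pow_left₀ (norm_nonneg _)
        ((norm_add_le _ _).trans (add_le_add_left (h0.2 j).2 _)) 2
  have hwp : (a * gL) ^ 2 * (‖w‖ ^ 2 + ‖p‖ ^ 2) ≤ M ^ 2 := by
    rw [Real.sq_sqrt (by positivity)]
    calc (a * gL) ^ 2 * (‖w‖ ^ 2 + ‖p‖ ^ 2)
        ≤ (a * gL) ^ 2 * (C * generatorEnergy c Q w p) :=
          mul_le_mul_of_nonneg_left (le_generatorEnergy hQ0 hc w p) (sq_nonneg _)
      _ = C * ((a * gL) ^ 2 * generatorEnergy c Q w p) := by ring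
      _ ≤ C * (b₀ ^ 2 * E₀) := mul_le_mul_of_nonneg_left
          (hW.trans (mul_le_mul_of_nonneg_left hV₀ (sq_nonneg _))) hC.le
  have hw : a * gL * ‖w‖ ≤ M := by
    refine le_of_sq_le_sq (le_trans ?_ hwp) hM
    rw [mul_pow]
    exact mul_le_mul_of_nonneg_left (le_add_of_nonneg_right (sq_nonneg _)) (sq_nonneg _)
  have hp : a * gL * ‖p‖ ≤ M := by
    refine le_of_sq_le_sq (le_trans ?_ hwp) hM
    rw [mul_pow]
    exact mul_le_mul_of_nonneg_left (le_add_of_nonneg_left (sq_nonneg _)) (sq_nonneg _)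
  have hwi : ‖(S t i).ϖ - z‖ ≤ ‖w‖ := PiLp.norm_apply_le w i
  have hpi : ‖(S t i).p + gradient (f i) z‖ ≤ ‖p‖ := PiLp.norm_apply_le p i
  have hab : 0 ≤ a * gL := by positivity
  have hMB : M ≤ (‖L‖ + varrho + 1) * M + M := le_add_of_nonneg_left (by positivity)
  refine ⟨((mul_le_mul_of_nonneg_left hwi hab).trans hw).trans hMB,
    ((mul_le_mul_of_nonneg_left hpi hab).trans hp).trans hMB, ?_⟩
  have hrate : ϖRate G f a (S t) i = -(a • (G.lap n w + devGrad f z (S t) + p)) i := by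
    rw [PiLp.smul_apply, PiLp.add_apply, PiLp.add_apply, lap_devϖ, ϖRate]
    simp only [devGrad, p, devp]
    congr 2; abel
  have h1 : ‖ϖRate G f a (S t) i‖ ≤ a * (‖L‖ * ‖w‖ + varrho * ‖w‖ + ‖p‖) := by
    rw [hrate, norm_neg]
    refine (PiLp.norm_apply_le _ i).trans ?_
    rw [norm_smul, Real.norm_of_nonneg ha.le]
    refine mul_le_mul_of_nonneg_left ((norm_add_le _ _).trans (add_le_add_left ?_ _)) ha.le
    exact (norm_add_le _ _).trans (add_le_add (L.le_opNorm w) (norm_devGrad_le hf hvarrho z (S t)))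
  calc gL * ‖ϖRate G f a (S t) i‖ ≤ gL * (a * (‖L‖ * ‖w‖ + varrho * ‖w‖ + ‖p‖)) :=
        mul_le_mul_of_nonneg_left h1 hgL.le
    _ = (‖L‖ + varrho) * (a * gL * ‖w‖) + a * gL * ‖p‖ := by ring
    _ ≤ (‖L‖ + varrho) * M + M :=
        add_le_add (mul_le_mul_of_nonneg_left hw (by positivity)) hp
    _ ≤ _ := by nlinarith

end GeneratorBound

/-! ### Growth estimates for the controller of one agent -/

section Tracking

open Asymptotics

variable {n : ℕ}

/-- A state of one agent together with its gains, the value `g` of `α_ξ(μ)`, its time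
derivative `g'` and the velocity `v` of the reference signal. -/
structure Config (n : ℕ) where
  K : Gains
  g : ℝ
  g' : ℝ
  v : Vec n
  s : AgentState n

namespace Config

variable (A : Agent n) (m : ℕ) (x : Config n)

/-- The weight `g^{L_q}`. -/
def pw (q : ℕ) : ℝ := x.g ^ expo m A.l q

/-- `ω_q = g^{L_q} x̃_q`. -/
def ω (q : ℕ) : Vec n := x.pw A m q • x.s.xTilde q

/-- `η_q = g^{L_q} ξ̃_q`. -/
def η (q : ℕ) : Vec n := x.pw A m q • A.xiTilde x.K x.g x.s q

/-- The nonlinearity `φ_q(x_q)`. -/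
def φx (q : ℕ) : Vec n := A.φ q (x.s.x q)

/-- The rate of change of `ξ_q` is `rxi q + τ • vxi q`; this is the part independent of `τ`. -/
def rxi : ℕ → Vec n
  | 0 => 0
  | 1 => -((x.K.c 1 * x.g') • x.s.xTilde 1 + (x.K.c 1 * x.g) • (x.s.x 2 - x.v))
  | q + 2 =>
    -((x.K.c (q + 2) * x.g') • x.s.xTilde (q + 2) + (x.K.c (q + 2) * x.g) •
        (x.s.x (q + 3) + A.θ • x.φx A (q + 2)
          + (x.K.υ (q + 2) * x.g) • A.xiTilde x.K x.g x.s (q + 2)))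
      - (-(A.σ * x.g * x.s.θhat) • x.φx A (q + 2) + x.s.θhat • fderiv ℝ (A.φ (q + 2))
        (x.s.x (q + 2)) (x.s.x (q + 3) + A.θ • x.φx A (q + 2)))
      - ((x.K.υ (q + 2) * x.g') • A.xiTilde x.K x.g x.s (q + 2) + (x.K.υ (q + 2) * x.g) •
        (-((x.K.υ (q + 2) * x.g) • A.xiTilde x.K x.g x.s (q + 2)) - rxi (q + 1)))

/-- The coefficient of `τ` in the rate of change of `ξ_q`. -/
def vxi : ℕ → Vec n
  | 0 => 0
  | 1 => 0
  | q + 2 => -x.φx A (q + 2) + (x.K.υ (q + 2) * x.g) • vxi (q + 1)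

end Config

/-- The configurations in a ball of radius `h` whose gains agree with `K` below index `q`. -/
structure IsTame (A : Agent n) (m : ℕ) (g₀ h B : ℝ) (K : Gains) (q : ℕ) (x : Config n) :
    Prop where
  c_eq : ∀ j < q, x.K.c j = K.c j
  υ_eq : ∀ j < q, x.K.υ j = K.υ j
  le_g : g₀ ≤ x.g
  abs_g' : |x.g'| ≤ x.g ^ 2
  norm_v : ‖x.pw A m 1 • x.v‖ ≤ B * x.g
  norm_ω : ∀ j, 1 ≤ j → j ≤ m → ‖x.ω A m j‖ ≤ h
  norm_η : ∀ j, 2 ≤ j → j ≤ m → ‖x.η A m j‖ ≤ h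
  abs_θ : |A.θ - x.s.θhat| ≤ h

theorem expo_succ (m : ℕ) (l : ℝ) (q : ℕ) : expo m l q = expo m l (q + 1) + 1 := by
  unfold expo; push_cast; ring

theorem expo_pos {m : ℕ} {l : ℝ} (hl : 0 < l) {q : ℕ} (hq : q ≤ m + 1) : 0 < expo m l q := by
  have : (q : ℝ) ≤ m + 1 := by exact_mod_cast hq
  unfold expo; linarith

/-- The filter of tame configurations. -/
def tame (A : Agent n) (m : ℕ) (g₀ h B : ℝ) (K : Gains) (q : ℕ) : Filter (Config n) :=
  𝓟 {x | IsTame A m g₀ h B K q x}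

variable {A : Agent n} {m : ℕ} {g₀ h B : ℝ} {K : Gains}

theorem eventually_tame {q : ℕ} {P : Config n → Prop}
    (hP : ∀ x, IsTame A m g₀ h B K q x → P x) : ∀ᶠ x in tame A m g₀ h B K q, P x :=
  eventually_principal.2 hP

theorem tame_anti {q r : ℕ} (hqr : q ≤ r) : tame A m g₀ h B K r ≤ tame A m g₀ h B K q :=
  principal_mono.2 fun _ hx => { hx with
    c_eq := fun j hj => hx.c_eq j (hj.trans_le hqr)
    υ_eq := fun j hj => hx.υ_eq j (hj.trans_le hqr) }

/-- The filter is principal, so big-O along it means one constant valid for all tame configurations.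
-/
theorem isBigO_tame_of_le {E : Type*} [NormedAddCommGroup E] {q : ℕ} {f : Config n → E}
    {g : Config n → ℝ} (C : ℝ) (hf : ∀ x, IsTame A m g₀ h B K q x → ‖f x‖ ≤ C * g x) :
    f =O[tame A m g₀ h B K q] g :=
  IsBigO.of_bound |C| (eventually_tame fun x hx => (hf x hx).trans (by
    rw [Real.norm_eq_abs, ← abs_mul]; exact le_abs_self _))

theorem isBigO_tame_congr {E : Type*} [NormedAddCommGroup E] {q : ℕ} {f f' : Config n → E}
    {g : Config n → ℝ} (hf' : f' =O[tame A m g₀ h B K q] g)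
    (hf : ∀ x, IsTame A m g₀ h B K q x → f x = f' x) : f =O[tame A m g₀ h B K q] g :=
  hf'.congr' (eventually_tame fun x hx => (hf x hx).symm) EventuallyEq.rfl

theorem IsBigO_smul_left {ι E : Type*} [NormedAddCommGroup E] [NormedSpace ℝ E] {F : Filter ι}
    {a : ι → ℝ} {f : ι → E} {g : ι → ℝ} (ha : a =O[F] fun _ => (1 : ℝ)) (hf : f =O[F] g) :
    (fun x => a x • f x) =O[F] g :=
  (ha.smul hf).congr_right fun x => one_smul ℝ (g x)

theorem isBigO_c {q r : ℕ} (h1 : q < r) :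
    (fun x : Config n => x.K.c q) =O[tame A m g₀ h B K r] fun _ => (1 : ℝ) :=
  isBigO_tame_of_le |K.c q| fun x hx => by rw [hx.c_eq q h1]; simp

theorem isBigO_υ {q r : ℕ} (h1 : q < r) :
    (fun x : Config n => x.K.υ q) =O[tame A m g₀ h B K r] fun _ => (1 : ℝ) :=
  isBigO_tame_of_le |K.υ q| fun x hx => by rw [hx.υ_eq q h1]; simp

theorem isBigO_θhat {r : ℕ} :
    (fun x : Config n => x.s.θhat) =O[tame A m g₀ h B K r] fun _ => (1 : ℝ) :=
  isBigO_tame_of_le (|A.θ| + h) fun x hx => by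
    rw [mul_one, Real.norm_eq_abs]
    have h1 : x.s.θhat = A.θ - (A.θ - x.s.θhat) := by ring
    rw [h1]
    exact (abs_sub _ _).trans (add_le_add_right hx.abs_θ _)

theorem isBigO_ω {q r : ℕ} (h1 : 1 ≤ q) (h2 : q ≤ m) :
    (fun x : Config n => x.ω A m q) =O[tame A m g₀ h B K r] fun _ => (1 : ℝ) :=
  isBigO_tame_of_le h fun x hx => by rw [mul_one]; exact hx.norm_ω q h1 h2

theorem isBigO_η {q r : ℕ} (h1 : 2 ≤ q) (h2 : q ≤ m) :
    (fun x : Config n => x.η A m q) =O[tame A m g₀ h B K r] fun _ => (1 : ℝ) :=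
  isBigO_tame_of_le h fun x hx => by rw [mul_one]; exact hx.norm_η q h1 h2

theorem IsTame.g_pos {q : ℕ} {x : Config n} (hx : IsTame A m g₀ h B K q x) (hg₀ : 0 < g₀) :
    0 < x.g := hg₀.trans_le hx.le_g

theorem isBigO_g_inv (hg₀ : 0 < g₀) {r : ℕ} :
    (fun x : Config n => x.g⁻¹) =O[tame A m g₀ h B K r] fun _ => (1 : ℝ) :=
  isBigO_tame_of_le g₀⁻¹ fun x hx => by
    rw [mul_one, Real.norm_of_nonneg (inv_nonneg.2 (hx.g_pos hg₀).le)]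
    exact inv_anti₀ hg₀ hx.le_g

theorem isBigO_one_g (hg₀ : 0 < g₀) {r : ℕ} :
    (fun _ : Config n => (1 : ℝ)) =O[tame A m g₀ h B K r] fun x => x.g :=
  isBigO_tame_of_le g₀⁻¹ fun x hx => by
    rw [norm_one, ← div_eq_inv_mul, one_le_div hg₀]; exact hx.le_g

theorem isBigO_g' (hg₀ : 0 < g₀) {r : ℕ} :
    (fun x : Config n => x.g' * x.g⁻¹) =O[tame A m g₀ h B K r] fun x => x.g :=
  isBigO_tame_of_le 1 fun x hx => by
    have hg := hx.g_pos hg₀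
    rw [norm_mul, Real.norm_eq_abs, Real.norm_of_nonneg (inv_nonneg.2 hg.le), one_mul,
      mul_inv_le_iff₀ hg, ← sq]
    exact hx.abs_g'

theorem isBigO_pw_inv (hg₀ : 0 < g₀) {q r : ℕ} (hq : 0 < expo m A.l q) :
    (fun x : Config n => (x.pw A m q)⁻¹) =O[tame A m g₀ h B K r] fun _ => (1 : ℝ) :=
  isBigO_tame_of_le (g₀ ^ expo m A.l q)⁻¹ fun x hx => by
    have h1 : 0 < g₀ ^ expo m A.l q := Real.rpow_pos_of_pos hg₀ _
    have h2 : g₀ ^ expo m A.l q ≤ x.pw A m q := Real.rpow_le_rpow hg₀.le hx.le_g hq.le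
    rw [mul_one, Real.norm_of_nonneg (inv_nonneg.2 (h1.trans_le h2).le)]
    exact inv_anti₀ h1 h2

theorem Config.pw_pos {x : Config n} (hg : 0 < x.g) (q : ℕ) : 0 < x.pw A m q :=
  Real.rpow_pos_of_pos hg _

/-- One step in the index costs one power of `g`; every factor `g` in the controller is traded for a
weight through this identity. -/
theorem Config.pw_succ {x : Config n} (hg : 0 < x.g) (q : ℕ) :
    x.pw A m (q + 1) * x.g = x.pw A m q := by
  rw [pw, pw, expo_succ m A.l q, Real.rpow_add_one hg.ne']

theorem exists_lipschitz_ball {F : Vec n → Vec n} (hF : LocallyLipschitz F) (r : ℝ) :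
    ∃ L : NNReal, LipschitzOnWith L F (Metric.closedBall 0 r) :=
  hF.locallyLipschitzOn.exists_lipschitzOnWith_of_compact (isCompact_closedBall 0 r)

end Tracking

/-! ### Bounds on the virtual controls and on their rates -/

section Tracking

open Asymptotics

variable {n : ℕ} {A : Agent n} {m : ℕ} {g₀ h B : ℝ} {K : Gains}

theorem pw_smul_x (x : Config n) (k : ℕ) :
    x.pw A m (k + 2) • x.s.x (k + 2) = x.ω A m (k + 2) + x.η A m (k + 2)
      + x.pw A m (k + 2) • A.xi x.K x.g x.s (k + 1) := by
  have h1 : x.s.xTilde (k + 2) = x.s.x (k + 2) - x.s.ξf (k + 2) := if_neg (by omega)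
  have h2 : A.xiTilde x.K x.g x.s (k + 2) = x.s.ξf (k + 2) - A.xi x.K x.g x.s (k + 1) := rfl
  rw [Config.ω, Config.η, h1, h2]
  module

theorem isBigO_pw_x {k : ℕ} (hk : k + 2 ≤ m)
    (hxi : (fun x : Config n => x.pw A m (k + 2) • A.xi x.K x.g x.s (k + 1))
      =O[tame A m g₀ h B K (k + 2)] fun _ => (1 : ℝ)) :
    (fun x : Config n => x.pw A m (k + 2) • x.s.x (k + 2))
      =O[tame A m g₀ h B K (k + 2)] fun _ => (1 : ℝ) :=
  isBigO_tame_congr (((isBigO_ω (by omega) hk).add (isBigO_η (by omega) hk)).add hxi)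
    fun x _ => pw_smul_x x k

theorem isBigO_x (hg₀ : 0 < g₀) (hl : 0 < A.l) {k : ℕ} (hk : k + 2 ≤ m)
    (hx : (fun x : Config n => x.pw A m (k + 2) • x.s.x (k + 2))
      =O[tame A m g₀ h B K (k + 2)] fun _ => (1 : ℝ)) :
    (fun x : Config n => x.s.x (k + 2)) =O[tame A m g₀ h B K (k + 2)] fun _ => (1 : ℝ) :=
  isBigO_tame_congr (IsBigO_smul_left (isBigO_pw_inv hg₀ (expo_pos hl (by omega))) hx)
    fun x hx => (inv_smul_smul₀ (Config.pw_pos (hx.g_pos hg₀) _).ne' _).symm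

/-- The states stay in a fixed ball, on which φ is Lipschitz. Because φ vanishes at 0 this gives a
linear bound, which survives multiplication by the unbounded weight. -/
theorem isBigO_φ_and_fderiv (hφ : IsAdmissibleNonlinearity m A.φ) {k : ℕ} (hk : k + 2 ≤ m)
    (hx : (fun x : Config n => x.s.x (k + 2)) =O[tame A m g₀ h B K (k + 2)] fun _ => (1 : ℝ)) :
    (∃ C, ∀ x, IsTame A m g₀ h B K (k + 2) x → ‖x.φx A (k + 2)‖ ≤ C * ‖x.s.x (k + 2)‖) ∧
    (fun x : Config n => fderiv ℝ (A.φ (k + 2)) (x.s.x (k + 2)))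
      =O[tame A m g₀ h B K (k + 2)] fun _ => (1 : ℝ) := by
  obtain ⟨hφ0, -, hφl⟩ := hφ (k + 2) (by omega) hk
  obtain ⟨C, hC⟩ := isBigO_iff.1 hx
  rw [tame, eventually_principal] at hC
  -- The extra 1 puts the states in the interior of the ball, where the Lipschitz constant also
  -- bounds the derivative.
  obtain ⟨L, hL⟩ := exists_lipschitz_ball hφl (|C| + 1)
  have hmem : ∀ x, IsTame A m g₀ h B K (k + 2) x → ‖x.s.x (k + 2)‖ < |C| + 1 := fun x hx => by
    have := hC x hx
    rw [norm_one, mul_one] at this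
    linarith [le_abs_self C]
  refine ⟨⟨L, fun x hx => ?_⟩, isBigO_tame_of_le L fun x hx => ?_⟩
  · have := hL.norm_sub_le (mem_closedBall_zero_iff.2 (hmem x hx).le)
      (mem_closedBall_zero_iff.2 (by rw [norm_zero]; positivity))
    rwa [hφ0, sub_zero, sub_zero] at this
  · rw [mul_one]
    refine norm_fderiv_le_of_lipschitzOn ℝ ?_ hL
    exact mem_of_superset (Metric.isOpen_ball.mem_nhds (mem_ball_zero_iff.2 (hmem x hx)))
      Metric.ball_subset_closedBall

theorem isBigO_pw_φ {k : ℕ}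
    (hC : ∃ C, ∀ x, IsTame A m g₀ h B K (k + 2) x → ‖x.φx A (k + 2)‖ ≤ C * ‖x.s.x (k + 2)‖)
    (hx : (fun x : Config n => x.pw A m (k + 2) • x.s.x (k + 2))
      =O[tame A m g₀ h B K (k + 2)] fun _ => (1 : ℝ)) :
    (fun x : Config n => x.pw A m (k + 2) • x.φx A (k + 2))
      =O[tame A m g₀ h B K (k + 2)] fun _ => (1 : ℝ) := by
  obtain ⟨C, hC⟩ := hC
  refine IsBigO.trans ?_ hx
  refine IsBigO.of_bound C (eventually_tame fun x hx => ?_)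
  rw [norm_smul, norm_smul, mul_left_comm]
  exact mul_le_mul_of_nonneg_left (hC x hx) (norm_nonneg _)

/-- The weight on the left is one power lower than that of the signals, which pays for the factor
`g` of the gain terms; θhat φ has no such factor and is left with a harmless `g⁻¹`. -/
theorem pw_smul_xi {x : Config n} (hg : 0 < x.g) (k : ℕ) :
    x.pw A m (k + 3) • A.xi x.K x.g x.s (k + 2) = -(x.K.c (k + 2) • x.ω A m (k + 2))
      - x.s.θhat • (x.g⁻¹ • (x.pw A m (k + 2) • x.φx A (k + 2)))
      - x.K.υ (k + 2) • x.η A m (k + 2) := by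
  have h1 : A.xi x.K x.g x.s (k + 2) = -((x.K.c (k + 2) * x.g) • x.s.xTilde (k + 2))
      - x.s.θhat • x.φx A (k + 2) - (x.K.υ (k + 2) * x.g) • A.xiTilde x.K x.g x.s (k + 2) := rfl
  rw [h1, Config.ω, Config.η, ← Config.pw_succ hg (k + 2), smul_smul x.g⁻¹]
  have h2 : x.g⁻¹ * (x.pw A m (k + 2 + 1) * x.g) = x.pw A m (k + 3) := by
    field_simp
  rw [h2]
  module

theorem isBigO_pw_xi_succ (hg₀ : 0 < g₀) {k : ℕ} (hk : k + 2 ≤ m)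
    (hφ : (fun x : Config n => x.pw A m (k + 2) • x.φx A (k + 2))
      =O[tame A m g₀ h B K (k + 2)] fun _ => (1 : ℝ)) :
    (fun x : Config n => x.pw A m (k + 3) • A.xi x.K x.g x.s (k + 2))
      =O[tame A m g₀ h B K (k + 3)] fun _ => (1 : ℝ) := by
  refine isBigO_tame_congr ?_ fun x hx => pw_smul_xi (hx.g_pos hg₀) k
  refine ((IsBigO_smul_left (isBigO_c (by omega)) (isBigO_ω (by omega) hk)).neg_left.sub ?_).sub
    (IsBigO_smul_left (isBigO_υ (by omega)) (isBigO_η (by omega) hk))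
  exact IsBigO_smul_left isBigO_θhat (IsBigO_smul_left (isBigO_g_inv hg₀)
    (hφ.mono (tame_anti (by omega))))

theorem pw_smul_xi_one {x : Config n} (hg : 0 < x.g) :
    x.pw A m 2 • A.xi x.K x.g x.s 1 = -(x.K.c 1 • x.ω A m 1) := by
  have h1 : A.xi x.K x.g x.s 1 = -((x.K.c 1 * x.g) • x.s.xTilde 1) := rfl
  rw [h1, Config.ω, ← Config.pw_succ hg 1]
  module

/-- All signals of the controller with weight `g^{L}` are bounded. -/
theorem isBigO_pw_xi (hm : 2 ≤ m) (hg₀ : 0 < g₀) (hl : 0 < A.l)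
    (hφ : IsAdmissibleNonlinearity m A.φ) :
    ∀ k, k + 1 ≤ m → (fun x : Config n => x.pw A m (k + 2) • A.xi x.K x.g x.s (k + 1))
      =O[tame A m g₀ h B K (k + 2)] fun _ => (1 : ℝ)
  | 0, _ => isBigO_tame_congr (IsBigO_smul_left (isBigO_c (q := 1) (by omega))
      (isBigO_ω le_rfl (by omega))).neg_left fun _ hx => pw_smul_xi_one (hx.g_pos hg₀)
  | k + 1, hk => by
    -- A bound on one virtual control bounds the next state, hence its nonlinearity, hence the next
    -- virtual control.
    have hxi := isBigO_pw_x (by omega) (isBigO_pw_xi hm hg₀ hl hφ k (by omega))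
    exact isBigO_pw_xi_succ hg₀ (by omega)
      (isBigO_pw_φ (isBigO_φ_and_fderiv hφ (by omega) (isBigO_x hg₀ hl (by omega) hxi)).1 hxi)

theorem isBigO_controller (hm : 2 ≤ m) (hg₀ : 0 < g₀) (hl : 0 < A.l)
    (hφ : IsAdmissibleNonlinearity m A.φ) {k : ℕ} (hk : k + 2 ≤ m) :
    ((fun x : Config n => x.pw A m (k + 2) • x.s.x (k + 2))
      =O[tame A m g₀ h B K (k + 2)] fun _ => (1 : ℝ)) ∧
    ((fun x : Config n => x.s.x (k + 2)) =O[tame A m g₀ h B K (k + 2)] fun _ => (1 : ℝ)) ∧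
    ((fun x : Config n => x.pw A m (k + 2) • x.φx A (k + 2))
      =O[tame A m g₀ h B K (k + 2)] fun _ => (1 : ℝ)) ∧
    (fun x : Config n => fderiv ℝ (A.φ (k + 2)) (x.s.x (k + 2)))
      =O[tame A m g₀ h B K (k + 2)] fun _ => (1 : ℝ) := by
  have h1 := isBigO_pw_x (K := K) (g₀ := g₀) (h := h) (B := B) hk
    (isBigO_pw_xi hm hg₀ hl hφ k (by omega))
  have h2 := isBigO_x hg₀ hl hk h1
  have h3 := isBigO_φ_and_fderiv hφ hk h2
  exact ⟨h1, h2, isBigO_pw_φ h3.1 h1, h3.2⟩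

theorem pw_smul_rxi_one {x : Config n} (hg : 0 < x.g) :
    x.pw A m 2 • x.rxi A 1 = -(x.K.c 1 • ((x.g' * x.g⁻¹) • x.ω A m 1))
      - x.K.c 1 • (x.g • (x.pw A m 2 • x.s.x 2)) + x.K.c 1 • (x.pw A m 1 • x.v) := by
  have h1 : x.rxi A 1 = -((x.K.c 1 * x.g') • x.s.xTilde 1
    + (x.K.c 1 * x.g) • (x.s.x 2 - x.v)) := rfl
  rw [h1, Config.ω, ← Config.pw_succ hg 1, smul_smul (x.g' * x.g⁻¹)]
  have h2 : x.g' * x.g⁻¹ * (x.pw A m (1 + 1) * x.g) = x.g' * x.pw A m 2 := by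
    field_simp
  rw [h2]
  module

/-- Each summand is regrouped into scaled signals and factors of known order, with at most one
factor of order `g`. -/
theorem pw_smul_rxi {x : Config n} (hg : 0 < x.g) (k : ℕ) :
    x.pw A m (k + 3) • x.rxi A (k + 2) =
      -(x.K.c (k + 2) • ((x.g' * x.g⁻¹) • x.ω A m (k + 2)))
      - x.K.c (k + 2) • (x.g • (x.pw A m (k + 3) • x.s.x (k + 3)))
      - x.K.c (k + 2) • (A.θ • (x.pw A m (k + 2) • x.φx A (k + 2)))
      - x.K.c (k + 2) • (x.K.υ (k + 2) • (x.g • x.η A m (k + 2)))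
      + A.σ • (x.s.θhat • (x.pw A m (k + 2) • x.φx A (k + 2)))
      - x.s.θhat • (fderiv ℝ (A.φ (k + 2)) (x.s.x (k + 2)))
          (x.pw A m (k + 3) • x.s.x (k + 3)
            + A.θ • (x.g⁻¹ • (x.pw A m (k + 2) • x.φx A (k + 2))))
      - x.K.υ (k + 2) • ((x.g' * x.g⁻¹) • x.η A m (k + 2))
      + x.K.υ (k + 2) • (x.K.υ (k + 2) • (x.g • x.η A m (k + 2)))
      + x.K.υ (k + 2) • (x.pw A m (k + 2) • x.rxi A (k + 1)) := by
  rw [Config.rxi, Config.ω, Config.η, ← Config.pw_succ hg (k + 2), smul_smul (x.g' * x.g⁻¹),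
    smul_smul (x.g' * x.g⁻¹), smul_smul x.g⁻¹]
  have h2 : x.g' * x.g⁻¹ * (x.pw A m (k + 2 + 1) * x.g) = x.g' * x.pw A m (k + 3) := by
    field_simp
  have h3 : x.g⁻¹ * (x.pw A m (k + 2 + 1) * x.g) = x.pw A m (k + 3) := by field_simp
  rw [h2, h3]
  simp only [map_add, map_smul]
  module

/-- Differentiation costs one power of `g`, by |g'| ≤ g² and because the filters run at speed of
order `g`. Only gains of index at most `k + 1` enter, which makes their recursive choice possible.
-/
theorem isBigO_pw_rxi (hm : 2 ≤ m) (hg₀ : 0 < g₀) (hl : 0 < A.l)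
    (hφ : IsAdmissibleNonlinearity m A.φ) :
    ∀ k, k + 1 < m → (fun x : Config n => x.pw A m (k + 2) • x.rxi A (k + 1))
      =O[tame A m g₀ h B K (k + 2)] fun x => x.g
  | 0, _ => by
    have hx := (isBigO_controller (K := K) (g₀ := g₀) (h := h) (B := B) hm hg₀ hl hφ
      (k := 0) (by omega)).1
    have hc := isBigO_c (A := A) (m := m) (g₀ := g₀) (h := h) (B := B) (K := K) (q := 1)
      (r := 2) (by omega)
    refine isBigO_tame_congr ?_ fun x hx => pw_smul_rxi_one (hx.g_pos hg₀)
    refine ((IsBigO_smul_left hc ?_).neg_left.sub (IsBigO_smul_left hc ?_)).add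
      (IsBigO_smul_left hc ?_)
    · exact ((isBigO_g' hg₀).smul (isBigO_ω le_rfl (by omega))).congr_right fun x => mul_one _
    · exact ((isBigO_refl (fun x : Config n => x.g) _).smul hx).congr_right fun x => mul_one _
    · exact isBigO_tame_of_le B fun x hx => hx.norm_v
  | k + 1, hk => by
    have hc := isBigO_c (A := A) (m := m) (g₀ := g₀) (h := h) (B := B) (K := K) (q := k + 2)
      (r := k + 3) (by omega)
    have hυ := isBigO_υ (A := A) (m := m) (g₀ := g₀) (h := h) (B := B) (K := K) (q := k + 2)
      (r := k + 3) (by omega)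
    have hle : tame A m g₀ h B K (k + 3) ≤ tame A m g₀ h B K (k + 2) := tame_anti (by omega)
    obtain ⟨-, -, hφx, hD⟩ := isBigO_controller (K := K) (g₀ := g₀) (h := h) (B := B) hm hg₀ hl hφ
      (k := k) (by omega)
    obtain ⟨hx, -⟩ := isBigO_controller (K := K) (g₀ := g₀) (h := h) (B := B) hm hg₀ hl hφ
      (k := k + 1) (by omega)
    replace hφx := hφx.mono hle
    replace hD := hD.mono hle
    have h1g : (fun _ : Config n => (1 : ℝ)) =O[tame A m g₀ h B K (k + 3)] fun x => x.g :=
      isBigO_one_g hg₀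
    have hω : (fun x : Config n => x.ω A m (k + 2)) =O[tame A m g₀ h B K (k + 3)] fun _ => (1 : ℝ) :=
      isBigO_ω (by omega) (by omega)
    have hη : (fun x : Config n => x.η A m (k + 2)) =O[tame A m g₀ h B K (k + 3)] fun _ => (1 : ℝ) :=
      isBigO_η (by omega) (by omega)
    have hθ : (fun x : Config n => x.s.θhat) =O[tame A m g₀ h B K (k + 3)] fun _ => (1 : ℝ) :=
      isBigO_θhat
    have hgη : (fun x : Config n => x.g • x.η A m (k + 2))
        =O[tame A m g₀ h B K (k + 3)] fun x => x.g :=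
      ((isBigO_refl (fun x : Config n => x.g) _).smul hη).congr_right fun x => mul_one _
    refine isBigO_tame_congr ?_ fun x hx => pw_smul_rxi (hx.g_pos hg₀) k
    refine ((((((((IsBigO_smul_left hc ?_).neg_left.sub (IsBigO_smul_left hc ?_)).sub
      (IsBigO_smul_left hc ?_)).sub (IsBigO_smul_left hc (IsBigO_smul_left hυ hgη))).add ?_).sub
      (IsBigO_smul_left hθ ?_)).sub (IsBigO_smul_left hυ ?_)).add
      (IsBigO_smul_left hυ (IsBigO_smul_left hυ hgη))).add
      (IsBigO_smul_left hυ ((isBigO_pw_rxi hm hg₀ hl hφ k (by omega)).mono hle))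
    · exact ((isBigO_g' hg₀).smul hω).congr_right fun x => mul_one _
    · exact ((isBigO_refl (fun x : Config n => x.g) _).smul hx).congr_right fun x => mul_one _
    · exact (hφx.const_smul_left A.θ).trans h1g
    · exact ((IsBigO_smul_left hθ hφx).const_smul_left A.σ).trans h1g
    · have harg : (fun x : Config n => x.pw A m (k + 3) • x.s.x (k + 3)
            + A.θ • (x.g⁻¹ • (x.pw A m (k + 2) • x.φx A (k + 2))))
          =O[tame A m g₀ h B K (k + 3)] fun _ => (1 : ℝ) :=
        hx.add ((IsBigO_smul_left (isBigO_g_inv hg₀) hφx).const_smul_left A.θ)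
      refine IsBigO.trans ?_ h1g
      refine IsBigO.trans (IsBigO.of_bound 1 (Eventually.of_forall fun x => ?_))
        ((hD.norm_left.mul harg.norm_left).congr_right fun x => mul_one _)
      rw [one_mul, norm_mul, norm_norm, norm_norm]
      exact ContinuousLinearMap.le_opNorm _ _
    · exact ((isBigO_g' hg₀).smul hη).congr_right fun x => mul_one _

/-- The signal τ mixes all levels, so a bound on it would involve gains not yet chosen; its
coefficient involves only those of index at most `k + 1`. -/
theorem isBigO_pw_vxi (hm : 2 ≤ m) (hg₀ : 0 < g₀) (hl : 0 < A.l)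
    (hφ : IsAdmissibleNonlinearity m A.φ) :
    ∀ k, k + 1 < m → (fun x : Config n => x.pw A m (k + 2) • x.vxi A (k + 1))
      =O[tame A m g₀ h B K (k + 2)] fun x => x.g
  | 0, _ => isBigO_tame_of_le 0 fun x _ => by simp [Config.vxi]
  | k + 1, hk => by
    have hle : tame A m g₀ h B K (k + 3) ≤ tame A m g₀ h B K (k + 2) := tame_anti (by omega)
    obtain ⟨-, -, hφx, -⟩ := isBigO_controller (K := K) (g₀ := g₀) (h := h) (B := B) hm hg₀ hl hφ
      (k := k) (by omega)
    refine isBigO_tame_congr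
      (f' := fun x => -(x.g⁻¹ • (x.pw A m (k + 2) • x.φx A (k + 2)))
        + x.K.υ (k + 2) • (x.pw A m (k + 2) • x.vxi A (k + 1))) ?_ fun x hx => ?_
    · exact ((IsBigO_smul_left (isBigO_g_inv hg₀) (hφx.mono hle)).neg_left.trans
        (isBigO_one_g hg₀)).add (IsBigO_smul_left (isBigO_υ (by omega))
        ((isBigO_pw_vxi hm hg₀ hl hφ k (by omega)).mono hle))
    · have hg := hx.g_pos hg₀
      rw [Config.vxi, ← Config.pw_succ hg (k + 2), smul_smul x.g⁻¹]
      have h3 : x.g⁻¹ * (x.pw A m (k + 2 + 1) * x.g) = x.pw A m (k + 3) := by field_simp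
      rw [h3]
      module

/-- Phrased for every `q`, with 0 as a vacuous bound out of range, so that `choose` yields one
function of the gains and the index. -/
theorem exists_gain_bound (hm : 2 ≤ m) (hg₀ : 0 < g₀) (hl : 0 < A.l)
    (hφ : IsAdmissibleNonlinearity m A.φ) (h B : ℝ) (K : Gains) (q : ℕ) :
    ∃ b, 0 ≤ b ∧ ∀ k, q = k + 2 → q ≤ m → ∀ x, IsTame A m g₀ h B K q x →
      ‖x.pw A m q • x.φx A q‖ ≤ b ∧ ‖x.pw A m q • x.rxi A (k + 1)‖ ≤ b * x.g ∧
      ‖x.pw A m q • x.vxi A (k + 1)‖ ≤ b * x.g := by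
  by_cases hq : 2 ≤ q ∧ q ≤ m
  · obtain ⟨k, rfl⟩ := Nat.exists_eq_add_of_le' hq.1
    obtain ⟨C1, h1⟩ := isBigO_iff.1 (isBigO_controller (K := K) (g₀ := g₀) (h := h) (B := B)
      hm hg₀ hl hφ hq.2).2.2.1
    obtain ⟨C2, h2⟩ := isBigO_iff.1 (isBigO_pw_rxi (K := K) (g₀ := g₀) (h := h) (B := B)
      hm hg₀ hl hφ k (by omega))
    obtain ⟨C3, h3⟩ := isBigO_iff.1 (isBigO_pw_vxi (K := K) (g₀ := g₀) (h := h) (B := B)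
      hm hg₀ hl hφ k (by omega))
    rw [tame, eventually_principal] at h1 h2 h3
    refine ⟨|C1| + |C2| + |C3|, by positivity, fun k' hk' _ x hx => ?_⟩
    obtain rfl : k = k' := by omega
    have e1 := h1 x hx
    have e2 := h2 x hx
    have e3 := h3 x hx
    have hg := hx.g_pos hg₀
    rw [norm_one, mul_one] at e1
    rw [Real.norm_of_nonneg hg.le] at e2 e3
    have a1 := abs_nonneg C1
    have a2 := abs_nonneg C2
    have a3 := abs_nonneg C3
    refine ⟨by linarith [le_abs_self C1], e2.trans ?_, e3.trans ?_⟩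
    · exact mul_le_mul_of_nonneg_right (by linarith [le_abs_self C2]) hg.le
    · exact mul_le_mul_of_nonneg_right (by linarith [le_abs_self C3]) hg.le
  · refine ⟨0, le_rfl, fun k hk hq' => absurd ⟨by omega, hq'⟩ hq⟩

end Tracking

/-! ### Choice of the gains -/

/-- Course-of-values recursion: `F q` is shown only the values below `q`, the others being replaced
by 0. -/
theorem exists_strong_recursion (F : ℕ → (ℕ → ℝ) → ℝ) :
    ∃ c : ℕ → ℝ, ∀ q, c q = F q fun j => if j < q then c j else 0 := by
  let c : ℕ → ℝ := WellFounded.fix Nat.lt_wfRel.wf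
    fun q ih => F q fun j => if hj : j < q then ih j hj else 0
  refine ⟨c, fun q => ?_⟩
  have h := WellFounded.fix_eq Nat.lt_wfRel.wf
    (fun q (ih : (j : ℕ) → j < q → ℝ) => F q fun j => if hj : j < q then ih j hj else 0) q
  refine h.trans (congrArg (F q) (funext fun j => ?_))
  by_cases hj : j < q
  · rw [dif_pos hj, if_pos hj]; rfl
  · rw [dif_neg hj, if_neg hj]

section Tracking

variable {n : ℕ} {A : Agent n} {m : ℕ} {g₀ h B : ℝ} {K : Gains}

/-- The part of the gains that does not depend on the radius of the ball. -/
def baseGain (A : Agent n) (m : ℕ) : ℝ := expo m A.l 1 + 2 + A.σ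

/-- `b` bounds the signals of index `q` on the tame configurations. -/
def IsGainBound (A : Agent n) (m : ℕ) (g₀ h B : ℝ) (K : Gains) (b : ℕ → ℝ) : Prop :=
  ∀ k, k + 2 ≤ m → 0 ≤ b (k + 2) ∧ ∀ x, IsTame A m g₀ h B K (k + 2) x →
    ‖x.pw A m (k + 2) • x.φx A (k + 2)‖ ≤ b (k + 2) ∧
    ‖x.pw A m (k + 2) • x.rxi A (k + 1)‖ ≤ b (k + 2) * x.g ∧
    ‖x.pw A m (k + 2) • x.vxi A (k + 1)‖ ≤ b (k + 2) * x.g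

/-- The bound at `q` is evaluated at the gains truncated below `q`, so there is no circularity;
tameness at `q` does not distinguish truncated gains from full ones. -/
theorem exists_gains (hm : 2 ≤ m) (hg₀ : 0 < g₀) (hl : 0 < A.l)
    (hφ : IsAdmissibleNonlinearity m A.φ) (h B : ℝ) :
    ∃ c b : ℕ → ℝ, c 1 = baseGain A m ∧
      IsGainBound A m g₀ h B ⟨c, fun q => 2 * c q⟩ b ∧
      ∀ k, c (k + 2) = baseGain A m + m * b (k + 2) ^ 2 := by
  choose b hb0 hb using fun (K : Gains) (q : ℕ) => exists_gain_bound (A := A) hm hg₀ hl hφ h B K q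
  obtain ⟨c, hc⟩ := exists_strong_recursion fun q c =>
    baseGain A m + if q ≤ 1 then 0 else m * (b ⟨c, fun q => 2 * c q⟩ q) ^ 2
  refine ⟨c, fun q => b ⟨fun j => if j < q then c j else 0,
    fun j => 2 * if j < q then c j else 0⟩ q, ?_, fun k hk => ⟨hb0 _ _, fun x hx => ?_⟩,
    fun k => ?_⟩
  · rw [hc]; simp
  · refine hb _ (k + 2) k rfl hk x { hx with c_eq := fun j hj => ?_, υ_eq := fun j hj => ?_ }
    · exact (hx.c_eq j hj).trans (if_pos hj).symm
    · exact (hx.υ_eq j hj).trans (congrArg (2 * ·) (if_pos hj).symm)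
  · rw [hc]; simp

/-! ### The Lyapunov function of the controller -/

/-- The squared norm of the transformed state. -/
def Config.energy (A : Agent n) (m : ℕ) (x : Config n) : ℝ :=
  ‖x.ω A m 1‖ ^ 2 + ∑ k ∈ Finset.range (m - 1), (‖x.ω A m (k + 2)‖ ^ 2 + ‖x.η A m (k + 2)‖ ^ 2)
    + (A.θ - x.s.θhat) ^ 2

theorem norm_transform_sq (hm : 2 ≤ m) (x : Config n) :
    ‖A.transform m x.K x.g x.s‖ ^ 2 = x.energy A m := by
  obtain ⟨M, rfl⟩ := Nat.exists_eq_add_of_le' (show 1 ≤ m by omega)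
  rw [Agent.transform, WithLp.prod_norm_sq_eq_of_L2, WithLp.prod_norm_sq_eq_of_L2,
    PiLp.norm_sq_eq_of_L2, PiLp.norm_sq_eq_of_L2, Fin.sum_univ_succ, Config.energy,
    Real.norm_eq_abs, sq_abs, Finset.sum_add_distrib, Finset.sum_range, Finset.sum_range]
  simp only [add_assoc]
  rfl

theorem IsTame.of_energy_le {x : Config n} (hh : 0 ≤ h) (hE : x.energy A m ≤ h ^ 2)
    (hg : g₀ ≤ x.g) (hg' : |x.g'| ≤ x.g ^ 2) (hv : ‖x.pw A m 1 • x.v‖ ≤ B * x.g) (q : ℕ) :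
    IsTame A m g₀ h B x.K q x := by
  have hsum : ∀ k ∈ Finset.range (m - 1),
      0 ≤ ‖x.ω A m (k + 2)‖ ^ 2 + ‖x.η A m (k + 2)‖ ^ 2 := fun k _ => by positivity
  have h0 := Finset.sum_nonneg hsum
  unfold Config.energy at hE
  have hle : ∀ k, k + 2 ≤ m → ‖x.ω A m (k + 2)‖ ^ 2 + ‖x.η A m (k + 2)‖ ^ 2 ≤ h ^ 2 := by
    intro k hk
    have := Finset.single_le_sum hsum (Finset.mem_range.2 (show k < m - 1 by omega))
    nlinarith [sq_nonneg ‖x.ω A m 1‖, sq_nonneg (A.θ - x.s.θhat)]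
  refine ⟨fun _ _ => rfl, fun _ _ => rfl, hg, hg', hv, fun j h1 h2 => ?_, fun j h1 h2 => ?_, ?_⟩
  · refine le_of_sq_le_sq ?_ hh
    rcases Nat.lt_or_ge j 2 with hj | hj
    · obtain rfl : j = 1 := by omega
      nlinarith [sq_nonneg (A.θ - x.s.θhat)]
    · obtain ⟨k, rfl⟩ := Nat.exists_eq_add_of_le' hj
      nlinarith [hle k h2, sq_nonneg ‖x.η A m (k + 2)‖]
  · obtain ⟨k, rfl⟩ := Nat.exists_eq_add_of_le' h1
    refine le_of_sq_le_sq ?_ hh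
    nlinarith [hle k h2, sq_nonneg ‖x.ω A m (k + 2)‖]
  · refine abs_le_of_sq_le_sq ?_ hh
    nlinarith [sq_nonneg ‖x.ω A m 1‖]

/-- The exponent 2 L_q splits into one weight for x̃_q and one for φ_q, so τ is expressed by scaled
signals. -/
theorem tau_eq_sum {x : Config n} (hg : 0 < x.g) :
    A.tau m x.g x.s = ∑ k ∈ Finset.range (m - 1),
      inner ℝ (x.ω A m (k + 2)) (x.pw A m (k + 2) • x.φx A (k + 2)) := by
  rw [Agent.tau, ← Finset.Ico_succ_right_eq_Icc, Finset.sum_Ico_eq_sum_range]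
  refine Finset.sum_congr rfl fun k _ => ?_
  rw [add_comm 2 k, Config.ω, Config.pw, real_inner_smul_left, real_inner_smul_right, ← mul_assoc,
    ← Real.rpow_add hg, two_mul]
  rfl

/-- The closed-loop equations of one agent at the time `t`, for a reference signal with
velocity `v`. -/
structure IsFlow (A : Agent n) (m : ℕ) (K : Gains) (γ : ℝ → ℝ) (s : ℝ → AgentState n)
    (I : Set ℝ) (t γ' : ℝ) (v : Vec n) : Prop where
  γ_eq : HasDerivWithinAt γ γ' I t
  ϖ_eq : HasDerivWithinAt (fun r => (s r).ϖ) v I t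
  x_first : HasDerivWithinAt (fun r => (s r).x 1) ((s t).x 2) I t
  x_mid : ∀ q, 2 ≤ q → q < m → HasDerivWithinAt (fun r => (s r).x q)
    ((s t).x (q + 1) + A.θ • A.φ q ((s t).x q)) I t
  x_last : HasDerivWithinAt (fun r => (s r).x m)
    (A.input m K (γ t) (s t) + A.θ • A.φ m ((s t).x m)) I t
  θhat_eq : HasDerivWithinAt (fun r => (s r).θhat)
    (A.tau m (γ t) (s t) - A.σ * γ t * (s t).θhat) I t
  ξf_eq : ∀ q, 2 ≤ q → q ≤ m → HasDerivWithinAt (fun r => (s r).ξf q)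
    ((K.υ q * γ t) • (-(s t).ξf q + A.xi K (γ t) (s t) (q - 1))) I t

namespace IsFlow

variable {γ : ℝ → ℝ} {s : ℝ → AgentState n} {I : Set ℝ} {t γ' : ℝ} {v : Vec n}

/-- The sum `x̃_{q+1} + ξ̃_{q+1}`, and `0` for `q = m`. -/
def next (A : Agent n) (m : ℕ) (x : Config n) (q : ℕ) : Vec n :=
  if q < m then x.s.xTilde (q + 1) + A.xiTilde x.K x.g x.s (q + 1) else 0

theorem xTilde_add_xiTilde (x : Config n) (k : ℕ) :
    x.s.xTilde (k + 2) + A.xiTilde x.K x.g x.s (k + 2)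
      = x.s.x (k + 2) - A.xi x.K x.g x.s (k + 1) := by
  have h1 : x.s.xTilde (k + 2) = x.s.x (k + 2) - x.s.ξf (k + 2) := if_neg (by omega)
  have h2 : A.xiTilde x.K x.g x.s (k + 2) = x.s.ξf (k + 2) - A.xi x.K x.g x.s (k + 1) := rfl
  rw [h1, h2]; abel

theorem xTilde_one (hF : IsFlow A m K γ s I t γ' v) :
    HasDerivWithinAt (fun r => (s r).xTilde 1) ((s t).x 2 - v) I t :=
  hF.x_first.sub hF.ϖ_eq

theorem xTilde_mid (hF : IsFlow A m K γ s I t γ' v) {k : ℕ} (hk : k + 2 < m) :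
    HasDerivWithinAt (fun r => (s r).xTilde (k + 2))
      ((s t).x (k + 3) + A.θ • A.φ (k + 2) ((s t).x (k + 2))
        + (K.υ (k + 2) * γ t) • A.xiTilde K (γ t) (s t) (k + 2)) I t := by
  have h := (hF.x_mid (k + 2) (by omega) hk).sub (hF.ξf_eq (k + 2) (by omega) hk.le)
  have h1 : ∀ r, (s r).xTilde (k + 2) = (s r).x (k + 2) - (s r).ξf (k + 2) :=
    fun r => if_neg (by omega)
  simp only [h1]
  refine h.congr_deriv ?_
  rw [Agent.xiTilde]; module

theorem xiTilde_deriv (hF : IsFlow A m K γ s I t γ' v) {k : ℕ} (hk : k + 2 ≤ m) {d : Vec n}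
    (hd : HasDerivWithinAt (fun r => A.xi K (γ r) (s r) (k + 1)) d I t) :
    HasDerivWithinAt (fun r => A.xiTilde K (γ r) (s r) (k + 2))
      (-((K.υ (k + 2) * γ t) • A.xiTilde K (γ t) (s t) (k + 2)) - d) I t := by
  have h := (hF.ξf_eq (k + 2) (by omega) hk).sub hd
  refine h.congr_deriv ?_
  rw [Agent.xiTilde]; module

/-- Through the filter error the rate of ξ_q contains that of ξ_{q-1}, hence the recursion. The
signal τ enters only through the rate of θhat, and linearly. -/
theorem xi_deriv (hφ : IsAdmissibleNonlinearity m A.φ) (hF : IsFlow A m K γ s I t γ' v) :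
    ∀ k, k + 1 < m → HasDerivWithinAt (fun r => A.xi K (γ r) (s r) (k + 1))
      ((Config.mk K (γ t) γ' v (s t)).rxi A (k + 1)
        + A.tau m (γ t) (s t) • (Config.mk K (γ t) γ' v (s t)).vxi A (k + 1)) I t
  | 0, _ => by
    have h := ((hF.γ_eq.const_mul (K.c 1)).smul hF.xTilde_one).neg
    refine h.congr_deriv ?_
    simp only [Config.rxi, Config.vxi]
    module
  | k + 1, hk => by
    have h1 := (hF.γ_eq.const_mul (K.c (k + 2))).smul (hF.xTilde_mid (by omega))
    have h2 := ((hφ (k + 2) (by omega) (by omega)).2.1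
      ((s t).x (k + 2))).hasFDerivAt.comp_hasDerivWithinAt t (hF.x_mid (k + 2) (by omega) hk)
    have h3 := hF.θhat_eq.smul h2
    have h4 := (hF.γ_eq.const_mul (K.υ (k + 2))).smul
      (hF.xiTilde_deriv (by omega) (hF.xi_deriv hφ k (by omega)))
    refine ((h1.neg.sub h3).sub h4).congr_deriv ?_
    simp only [Config.rxi, Config.vxi, Config.φx, Function.comp_apply]
    module

theorem xTilde_one' (hm : 2 ≤ m) (hF : IsFlow A m K γ s I t γ' v) :
    HasDerivWithinAt (fun r => (s r).xTilde 1)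
      (-((K.c 1 * γ t) • (s t).xTilde 1) + next A m ⟨K, γ t, γ', v, s t⟩ 1 - v) I t := by
  refine hF.xTilde_one.congr_deriv ?_
  rw [next, if_pos (by omega), xTilde_add_xiTilde (A := A) ⟨K, γ t, γ', v, s t⟩ 0]
  simp only [Agent.xi]
  module

/-- The term υ g ξ̃ in ξ_q cancels the filter velocity, and θhat φ cancels the nonlinearity up to
the parameter error. At the last level the input is ξ_m itself, so no next error appears. -/
theorem xTilde_succ' (hF : IsFlow A m K γ s I t γ' v) {k : ℕ} (hk : k + 2 ≤ m) :
    HasDerivWithinAt (fun r => (s r).xTilde (k + 2))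
      (-((K.c (k + 2) * γ t) • (s t).xTilde (k + 2)) + next A m ⟨K, γ t, γ', v, s t⟩ (k + 2)
        + (A.θ - (s t).θhat) • A.φ (k + 2) ((s t).x (k + 2))) I t := by
  have hxi : A.xi K (γ t) (s t) (k + 2) = -((K.c (k + 2) * γ t) • (s t).xTilde (k + 2))
      - (s t).θhat • A.φ (k + 2) ((s t).x (k + 2))
      - (K.υ (k + 2) * γ t) • A.xiTilde K (γ t) (s t) (k + 2) := rfl
  rcases hk.lt_or_eq with hk | rfl
  · refine (hF.xTilde_mid hk).congr_deriv ?_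
    rw [next, if_pos hk, xTilde_add_xiTilde (A := A) ⟨K, γ t, γ', v, s t⟩ (k + 1), hxi]
    module
  · have h := hF.x_last.sub (hF.ξf_eq (k + 2) (by omega) le_rfl)
    have h1 : ∀ r, (s r).xTilde (k + 2) = (s r).x (k + 2) - (s r).ξf (k + 2) :=
      fun r => if_neg (by omega)
    have h2 : HasDerivWithinAt (fun r => (s r).xTilde (k + 2))
        (A.xi K (γ t) (s t) (k + 2) + A.θ • A.φ (k + 2) ((s t).x (k + 2))
          - (K.υ (k + 2) * γ t) • (-(s t).ξf (k + 2) + A.xi K (γ t) (s t) (k + 1))) I t := by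
      simp only [h1]; exact h
    refine h2.congr_deriv ?_
    have h3 : A.xiTilde K (γ t) (s t) (k + 2) = (s t).ξf (k + 2) - A.xi K (γ t) (s t) (k + 1) := rfl
    rw [next, if_neg (lt_irrefl _), hxi, h3]
    module

theorem norm_sq_weighted {L : ℝ} (hγ : 0 < γ t) (hγ' : HasDerivWithinAt γ γ' I t)
    {y : ℝ → Vec n} {y' : Vec n} (hy : HasDerivWithinAt y y' I t) :
    HasDerivWithinAt (fun r => ‖γ r ^ L • y r‖ ^ 2)
      (2 * (L * (γ' / γ t) * ‖γ t ^ L • y t‖ ^ 2 + inner ℝ (γ t ^ L • y t) (γ t ^ L • y'))) I t := by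
  refine ((hγ'.rpow_const (p := L) (Or.inl hγ.ne')).smul hy).norm_sq.congr_deriv ?_
  rw [inner_add_right, Real.rpow_sub_one hγ.ne', ← real_inner_self_eq_norm_sq (γ t ^ L • y t)]
  simp only [Pi.smul_apply', real_inner_smul_left, real_inner_smul_right]
  ring

/-- The energy reads neither `g'` nor `v`, so freezing them at time `t` does not affect the
derivative. -/
theorem energy_deriv (hm : 2 ≤ m) (hφ : IsAdmissibleNonlinearity m A.φ)
    (hF : IsFlow A m K γ s I t γ' v) (hγ : 0 < γ t) {x : Config n}
    (hx : x = ⟨K, γ t, γ', v, s t⟩) :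
    HasDerivWithinAt (fun r => (Config.mk K (γ r) γ' v (s r)).energy A m)
      (2 * ((expo m A.l 1 * (x.g' / x.g) * ‖x.ω A m 1‖ ^ 2 + inner ℝ (x.ω A m 1)
          (x.pw A m 1 • (-((K.c 1 * x.g) • x.s.xTilde 1) + next A m x 1 - v)))
        + ∑ k ∈ Finset.range (m - 1),
          ((expo m A.l (k + 2) * (x.g' / x.g) * ‖x.ω A m (k + 2)‖ ^ 2 + inner ℝ (x.ω A m (k + 2))
              (x.pw A m (k + 2) • (-((K.c (k + 2) * x.g) • x.s.xTilde (k + 2))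
                + next A m x (k + 2) + (A.θ - x.s.θhat) • x.φx A (k + 2))))
          + (expo m A.l (k + 2) * (x.g' / x.g) * ‖x.η A m (k + 2)‖ ^ 2 + inner ℝ (x.η A m (k + 2))
              (x.pw A m (k + 2) • (-((K.υ (k + 2) * x.g) • A.xiTilde x.K x.g x.s (k + 2))
                - (x.rxi A (k + 1) + A.tau m x.g x.s • x.vxi A (k + 1))))))
        + (A.θ - x.s.θhat) * -(A.tau m x.g x.s - A.σ * x.g * x.s.θhat))) I t := by
  subst hx
  have h1 := norm_sq_weighted (L := expo m A.l 1) hγ hF.γ_eq (hF.xTilde_one' hm)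
  have h2 : HasDerivWithinAt (fun r => ∑ k ∈ Finset.range (m - 1),
      (‖γ r ^ expo m A.l (k + 2) • (s r).xTilde (k + 2)‖ ^ 2
        + ‖γ r ^ expo m A.l (k + 2) • A.xiTilde K (γ r) (s r) (k + 2)‖ ^ 2)) _ I t :=
    HasDerivWithinAt.fun_sum fun k hk =>
      (norm_sq_weighted (L := expo m A.l (k + 2)) hγ hF.γ_eq
        (hF.xTilde_succ' (k := k) (by have := Finset.mem_range.1 hk; omega))).add
      (norm_sq_weighted (L := expo m A.l (k + 2)) hγ hF.γ_eq
        (hF.xiTilde_deriv (k := k) (by have := Finset.mem_range.1 hk; omega)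
          (hF.xi_deriv hφ k (by have := Finset.mem_range.1 hk; omega))))
  have h3 := (hF.θhat_eq.const_sub A.θ).pow 2
  refine ((h1.add h2).add h3).congr_deriv ?_
  rw [show ∀ a b c : ℝ, 2 * (a + b + c) = 2 * a + 2 * b + 2 * c from fun a b c => by ring,
    Finset.mul_sum]
  congr 1
  · congr 1
    exact Finset.sum_congr rfl fun k _ => (mul_add _ _ _).symm
  · push_cast; ring

end IsFlow

end Tracking

/-! ### Dissipation of the controller energy and invariance of the ball -/

section Tracking

variable {n : ℕ} {A : Agent n} {m : ℕ} {g₀ h B : ℝ} {K : Gains}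

theorem expo_le_one {m : ℕ} {l : ℝ} (k : ℕ) : expo m l (k + 2) ≤ expo m l 1 := by
  unfold expo; push_cast
  have : (0 : ℝ) ≤ k := k.cast_nonneg
  linarith

theorem growth_term_le {x : Config n} (hg : 0 < x.g) (hg' : |x.g'| ≤ x.g ^ 2) {L L1 : ℝ}
    (hL : 0 ≤ L) (hL1 : L ≤ L1) (y : Vec n) :
    L * (x.g' / x.g) * ‖y‖ ^ 2 ≤ x.g * (L1 * ‖y‖ ^ 2) := by
  have h1 : x.g' / x.g ≤ x.g := by
    rw [div_le_iff₀ hg, ← sq]; exact (le_abs_self _).trans hg'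
  have h2 : L * (x.g' / x.g) ≤ L1 * x.g :=
    (mul_le_mul_of_nonneg_left h1 hL).trans (mul_le_mul_of_nonneg_right hL1 hg.le)
  calc _ ≤ L1 * x.g * ‖y‖ ^ 2 := mul_le_mul_of_nonneg_right h2 (sq_nonneg _)
    _ = _ := by ring

/-- Half of the squared norms of the neighbouring transformed signals. -/
def Config.neighbor (A : Agent n) (m : ℕ) (x : Config n) (q : ℕ) : ℝ :=
  if q < m then 1 / 2 * (‖x.ω A m (q + 1)‖ ^ 2 + ‖x.η A m (q + 1)‖ ^ 2) else 0

/-- Young's inequality; the factor `g` is the ratio of two consecutive weights. -/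
theorem inner_next_le {x : Config n} (hg : 0 < x.g) (q : ℕ) :
    inner ℝ (x.ω A m q) (x.pw A m q • IsFlow.next A m x q)
      ≤ x.g * (‖x.ω A m q‖ ^ 2 + x.neighbor A m q) := by
  unfold IsFlow.next Config.neighbor
  split_ifs with hq
  · have h1 : x.pw A m q • (x.s.xTilde (q + 1) + A.xiTilde x.K x.g x.s (q + 1))
        = x.g • (x.ω A m (q + 1) + x.η A m (q + 1)) := by
      rw [Config.ω, Config.η, ← Config.pw_succ hg q]; module
    rw [h1, real_inner_smul_right, inner_add_right]
    refine mul_le_mul_of_nonneg_left ?_ hg.le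
    have h2 := real_inner_le_norm (x.ω A m q) (x.ω A m (q + 1))
    have h3 := real_inner_le_norm (x.ω A m q) (x.η A m (q + 1))
    nlinarith [sq_nonneg (‖x.ω A m q‖ - ‖x.ω A m (q + 1)‖),
      sq_nonneg (‖x.ω A m q‖ - ‖x.η A m (q + 1)‖)]
  · rw [smul_zero, inner_zero_right, add_zero]; positivity

theorem sum_neighbor (hm : 2 ≤ m) (x : Config n) :
    x.neighbor A m 1 + ∑ k ∈ Finset.range (m - 1), x.neighbor A m (k + 2)
      = 1 / 2 * ∑ k ∈ Finset.range (m - 1), (‖x.ω A m (k + 2)‖ ^ 2 + ‖x.η A m (k + 2)‖ ^ 2) := by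
  have h1 : x.neighbor A m 1 + ∑ k ∈ Finset.range (m - 1), x.neighbor A m (k + 2)
      = ∑ k ∈ Finset.range (m - 1 + 1), x.neighbor A m (k + 1) := by
    rw [Finset.sum_range_succ', add_comm]
  have h2 : x.neighbor A m (m - 1 + 1) = 0 := if_neg (by omega)
  rw [h1, Finset.sum_range_succ, h2, add_zero, Finset.mul_sum]
  refine Finset.sum_congr rfl fun k hk => ?_
  have := Finset.mem_range.1 hk
  exact if_pos (by omega)

/-- Young's inequality splits the reference velocity into ½‖ω_1‖², absorbed by c_1, and ½B², which
goes into `drift`. -/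
theorem ω_one_rate_le {x : Config n} (hg : 0 < x.g) (hg' : |x.g'| ≤ x.g ^ 2)
    (hL : 0 ≤ expo m A.l 1) (hv : ‖x.pw A m 1 • x.v‖ ≤ B * x.g) :
    expo m A.l 1 * (x.g' / x.g) * ‖x.ω A m 1‖ ^ 2 + inner ℝ (x.ω A m 1)
        (x.pw A m 1 • (-((x.K.c 1 * x.g) • x.s.xTilde 1) + IsFlow.next A m x 1 - x.v))
      ≤ x.g * ((expo m A.l 1 + 3 / 2 - x.K.c 1) * ‖x.ω A m 1‖ ^ 2 + x.neighbor A m 1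
          + 1 / 2 * B ^ 2) := by
  have h1 := growth_term_le hg hg' hL le_rfl (x.ω A m 1)
  have h2 := inner_next_le (A := A) (m := m) hg 1
  have h3 : x.pw A m 1 • (-((x.K.c 1 * x.g) • x.s.xTilde 1) + IsFlow.next A m x 1 - x.v)
      = -((x.K.c 1 * x.g) • x.ω A m 1) + x.pw A m 1 • IsFlow.next A m x 1
        - x.pw A m 1 • x.v := by
    rw [Config.ω]; module
  have h4 : -inner ℝ (x.ω A m 1) (x.pw A m 1 • x.v) ≤ ‖x.ω A m 1‖ * (B * x.g) :=
    (neg_le_abs _).trans ((abs_real_inner_le_norm _ _).trans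
      (mul_le_mul_of_nonneg_left hv (norm_nonneg _)))
  have h5 : ‖x.ω A m 1‖ * (B * x.g) ≤ x.g * (1 / 2 * ‖x.ω A m 1‖ ^ 2 + 1 / 2 * B ^ 2) := by
    have := mul_nonneg hg.le (sq_nonneg (‖x.ω A m 1‖ - B))
    nlinarith
  rw [h3, inner_sub_right, inner_add_right, inner_neg_right, real_inner_smul_right,
    real_inner_self_eq_norm_sq]
  nlinarith

/-- The parameter error term is not estimated, because the adaptation law cancels it exactly. -/
theorem ω_rate_le {x : Config n} (hg : 0 < x.g) (hg' : |x.g'| ≤ x.g ^ 2) {k : ℕ}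
    (hL : 0 ≤ expo m A.l (k + 2)) :
    expo m A.l (k + 2) * (x.g' / x.g) * ‖x.ω A m (k + 2)‖ ^ 2 + inner ℝ (x.ω A m (k + 2))
        (x.pw A m (k + 2) • (-((x.K.c (k + 2) * x.g) • x.s.xTilde (k + 2))
          + IsFlow.next A m x (k + 2) + (A.θ - x.s.θhat) • x.φx A (k + 2)))
      ≤ x.g * ((expo m A.l 1 + 1 - x.K.c (k + 2)) * ‖x.ω A m (k + 2)‖ ^ 2
          + x.neighbor A m (k + 2))
        + (A.θ - x.s.θhat)
          * inner ℝ (x.ω A m (k + 2)) (x.pw A m (k + 2) • x.φx A (k + 2)) := by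
  have h1 := growth_term_le hg hg' hL (expo_le_one k) (x.ω A m (k + 2))
  have h2 := inner_next_le (A := A) (m := m) hg (k + 2)
  have h3 : x.pw A m (k + 2) • (-((x.K.c (k + 2) * x.g) • x.s.xTilde (k + 2))
        + IsFlow.next A m x (k + 2) + (A.θ - x.s.θhat) • x.φx A (k + 2))
      = -((x.K.c (k + 2) * x.g) • x.ω A m (k + 2))
        + x.pw A m (k + 2) • IsFlow.next A m x (k + 2)
        + (A.θ - x.s.θhat) • (x.pw A m (k + 2) • x.φx A (k + 2)) := by
    rw [Config.ω]; module
  rw [h3, inner_add_right, inner_add_right, inner_neg_right, real_inner_smul_right,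
    real_inner_smul_right _ (x.pw A m (k + 2) • x.φx A (k + 2)), real_inner_self_eq_norm_sq]
  nlinarith

/-- The τ-independent part of the rate of ξ costs b²‖η‖² and the constant 1/4; the τ part is kept
for an estimate over all levels at once. -/
theorem η_rate_le {x : Config n} (hg : 0 < x.g) (hg' : |x.g'| ≤ x.g ^ 2) {k : ℕ}
    (hL : 0 ≤ expo m A.l (k + 2)) {b τ : ℝ}
    (hr : ‖x.pw A m (k + 2) • x.rxi A (k + 1)‖ ≤ b * x.g)
    (hv : ‖x.pw A m (k + 2) • x.vxi A (k + 1)‖ ≤ b * x.g) :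
    expo m A.l (k + 2) * (x.g' / x.g) * ‖x.η A m (k + 2)‖ ^ 2 + inner ℝ (x.η A m (k + 2))
        (x.pw A m (k + 2) • (-((x.K.υ (k + 2) * x.g) • A.xiTilde x.K x.g x.s (k + 2))
          - (x.rxi A (k + 1) + τ • x.vxi A (k + 1))))
      ≤ x.g * ((expo m A.l 1 + b ^ 2 - x.K.υ (k + 2)) * ‖x.η A m (k + 2)‖ ^ 2 + 1 / 4)
        + x.g * (|τ| * (b * ‖x.η A m (k + 2)‖)) := by
  have h1 := growth_term_le hg hg' hL (expo_le_one k) (x.η A m (k + 2))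
  have h3 : x.pw A m (k + 2) • (-((x.K.υ (k + 2) * x.g) • A.xiTilde x.K x.g x.s (k + 2))
          - (x.rxi A (k + 1) + τ • x.vxi A (k + 1)))
      = -((x.K.υ (k + 2) * x.g) • x.η A m (k + 2)) - x.pw A m (k + 2) • x.rxi A (k + 1)
        - τ • (x.pw A m (k + 2) • x.vxi A (k + 1)) := by
    rw [Config.η]; module
  have h4 : -inner ℝ (x.η A m (k + 2)) (x.pw A m (k + 2) • x.rxi A (k + 1))
      ≤ ‖x.η A m (k + 2)‖ * (b * x.g) :=
    (neg_le_abs _).trans ((abs_real_inner_le_norm _ _).trans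
      (mul_le_mul_of_nonneg_left hr (norm_nonneg _)))
  have h5 : -(τ * inner ℝ (x.η A m (k + 2)) (x.pw A m (k + 2) • x.vxi A (k + 1)))
      ≤ |τ| * (‖x.η A m (k + 2)‖ * (b * x.g)) := by
    refine (neg_le_abs _).trans ?_
    rw [abs_mul]
    exact mul_le_mul_of_nonneg_left ((abs_real_inner_le_norm _ _).trans
      (mul_le_mul_of_nonneg_left hv (norm_nonneg _))) (abs_nonneg _)
  have h6 : ‖x.η A m (k + 2)‖ * (b * x.g) ≤ x.g * (b ^ 2 * ‖x.η A m (k + 2)‖ ^ 2 + 1 / 4) := by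
    have := mul_nonneg hg.le (sq_nonneg (b * ‖x.η A m (k + 2)‖ - 1 / 2))
    nlinarith
  rw [h3, inner_sub_right, inner_sub_right, inner_neg_right, real_inner_smul_right,
    real_inner_smul_right _ (x.pw A m (k + 2) • x.vxi A (k + 1)), real_inner_self_eq_norm_sq]
  nlinarith

/-- The product of the sums is at most half the sum of their squares, and Cauchy–Schwarz makes each
square termwise at the price of the number of terms. That price is why the gains contain m b². -/
theorem mul_sum_le_of_le_sum {M : ℕ} {τ : ℝ} {β w e : ℕ → ℝ}
    (hτ : |τ| ≤ ∑ k ∈ Finset.range M, β k * w k)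
    (h0 : 0 ≤ ∑ k ∈ Finset.range M, β k * e k) :
    |τ| * ∑ k ∈ Finset.range M, β k * e k
      ≤ ∑ k ∈ Finset.range M, M / 2 * β k ^ 2 * (w k ^ 2 + e k ^ 2) := by
  have h1 := mul_le_mul_of_nonneg_right hτ h0
  have h2 := sq_sum_le_card_mul_sum_sq (s := Finset.range M) (f := fun k => β k * w k)
  have h3 := sq_sum_le_card_mul_sum_sq (s := Finset.range M) (f := fun k => β k * e k)
  rw [Finset.card_range] at h2 h3
  have h4 : ∑ k ∈ Finset.range M, (M : ℝ) / 2 * β k ^ 2 * (w k ^ 2 + e k ^ 2)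
      = 1 / 2 * (M * ∑ k ∈ Finset.range M, (β k * w k) ^ 2)
        + 1 / 2 * (M * ∑ k ∈ Finset.range M, (β k * e k) ^ 2) := by
    simp only [Finset.mul_sum, ← Finset.sum_add_distrib]
    exact Finset.sum_congr rfl fun k _ => by ring
  rw [h4]
  nlinarith [sq_nonneg (∑ k ∈ Finset.range M, β k * w k - ∑ k ∈ Finset.range M, β k * e k)]

/-- The constant part of the energy balance. -/
def drift (A : Agent n) (m : ℕ) (B : ℝ) : ℝ := 1 / 2 * B ^ 2 + m / 4 + A.σ / 2 * A.θ ^ 2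

/-- The parameter error times τ appears with opposite signs in the plant errors and in the
adaptation law, and cancels. The gains dominate the growth of the weights, the neighbour terms and
the τ estimate with σ/2 to spare; the leakage in θhat supplies the same rate for the parameter
error. -/
theorem energy_rate_le (hm : 2 ≤ m) (hg₀ : 0 < g₀) (hl : 0 < A.l) (hσ : 0 < A.σ) {c b : ℕ → ℝ}
    (hc1 : c 1 = baseGain A m) (hb : IsGainBound A m g₀ h B ⟨c, fun q => 2 * c q⟩ b)
    (hc : ∀ k, c (k + 2) = baseGain A m + m * b (k + 2) ^ 2) {x : Config n}
    (hxK : x.K = ⟨c, fun q => 2 * c q⟩)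
    (hx : ∀ q, IsTame A m g₀ h B ⟨c, fun q => 2 * c q⟩ q x) :
    (expo m A.l 1 * (x.g' / x.g) * ‖x.ω A m 1‖ ^ 2 + inner ℝ (x.ω A m 1)
          (x.pw A m 1 • (-((x.K.c 1 * x.g) • x.s.xTilde 1) + IsFlow.next A m x 1 - x.v)))
        + ∑ k ∈ Finset.range (m - 1),
          ((expo m A.l (k + 2) * (x.g' / x.g) * ‖x.ω A m (k + 2)‖ ^ 2 + inner ℝ (x.ω A m (k + 2))
              (x.pw A m (k + 2) • (-((x.K.c (k + 2) * x.g) • x.s.xTilde (k + 2))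
                + IsFlow.next A m x (k + 2) + (A.θ - x.s.θhat) • x.φx A (k + 2))))
          + (expo m A.l (k + 2) * (x.g' / x.g) * ‖x.η A m (k + 2)‖ ^ 2 + inner ℝ (x.η A m (k + 2))
              (x.pw A m (k + 2) • (-((x.K.υ (k + 2) * x.g) • A.xiTilde x.K x.g x.s (k + 2))
                - (x.rxi A (k + 1) + A.tau m x.g x.s • x.vxi A (k + 1))))))
        + (A.θ - x.s.θhat) * -(A.tau m x.g x.s - A.σ * x.g * x.s.θhat)
      ≤ x.g * (drift A m B - A.σ / 2 * x.energy A m) := by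
  have hg := (hx 0).g_pos hg₀
  have hg' := (hx 0).abs_g'
  have hLk : ∀ k ∈ Finset.range (m - 1), 0 ≤ expo m A.l (k + 2) := fun k hk =>
    (expo_pos hl (by have := Finset.mem_range.1 hk; omega)).le
  have hL1 : 0 ≤ expo m A.l 1 := (expo_pos hl (by omega)).le
  have hbk : ∀ k ∈ Finset.range (m - 1), 0 ≤ b (k + 2) ∧
      ‖x.pw A m (k + 2) • x.φx A (k + 2)‖ ≤ b (k + 2) ∧
      ‖x.pw A m (k + 2) • x.rxi A (k + 1)‖ ≤ b (k + 2) * x.g ∧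
      ‖x.pw A m (k + 2) • x.vxi A (k + 1)‖ ≤ b (k + 2) * x.g := fun k hk => by
    have hk2 : k + 2 ≤ m := by have := Finset.mem_range.1 hk; omega
    exact ⟨(hb k hk2).1, (hb k hk2).2 x (hx _)⟩
  set τ := A.tau m x.g x.s with hτ_def
  have hτ : τ = ∑ k ∈ Finset.range (m - 1),
      inner ℝ (x.ω A m (k + 2)) (x.pw A m (k + 2) • x.φx A (k + 2)) := tau_eq_sum hg
  have hτle : |τ| ≤ ∑ k ∈ Finset.range (m - 1), b (k + 2) * ‖x.ω A m (k + 2)‖ := by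
    rw [hτ]
    refine (Finset.abs_sum_le_sum_abs _ _).trans (Finset.sum_le_sum fun k hk => ?_)
    refine (abs_real_inner_le_norm _ _).trans ?_
    rw [mul_comm (b _)]
    exact mul_le_mul_of_nonneg_left (hbk k hk).2.1 (norm_nonneg _)
  have hy := mul_sum_le_of_le_sum (β := fun k => b (k + 2)) (w := fun k => ‖x.ω A m (k + 2)‖)
    (e := fun k => ‖x.η A m (k + 2)‖) hτle
    (Finset.sum_nonneg fun k hk => mul_nonneg (hbk k hk).1 (norm_nonneg _))
  have h1 := ω_one_rate_le hg hg' hL1 (hx 0).norm_v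
  have h2 := Finset.sum_le_sum fun k hk => add_le_add
    (ω_rate_le (A := A) (m := m) hg hg' (hLk k hk))
    (η_rate_le (A := A) (m := m) (τ := τ) hg hg' (hLk k hk) (hbk k hk).2.2.1 (hbk k hk).2.2.2)
  refine (add_le_add (add_le_add h1 h2) (le_refl
    ((A.θ - x.s.θhat) * -(τ - A.σ * x.g * x.s.θhat)))).trans ?_
  have hN := sum_neighbor (A := A) hm x
  have hsplit : ∑ k ∈ Finset.range (m - 1),
      (x.g * ((expo m A.l 1 + 1 - x.K.c (k + 2)) * ‖x.ω A m (k + 2)‖ ^ 2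
          + x.neighbor A m (k + 2))
        + (A.θ - x.s.θhat) * inner ℝ (x.ω A m (k + 2)) (x.pw A m (k + 2) • x.φx A (k + 2))
        + (x.g * ((expo m A.l 1 + b (k + 2) ^ 2 - x.K.υ (k + 2)) * ‖x.η A m (k + 2)‖ ^ 2 + 1 / 4)
        + x.g * (|τ| * (b (k + 2) * ‖x.η A m (k + 2)‖))))
      = x.g * (∑ k ∈ Finset.range (m - 1),
          ((expo m A.l 1 + 1 - x.K.c (k + 2)) * ‖x.ω A m (k + 2)‖ ^ 2
          + (expo m A.l 1 + b (k + 2) ^ 2 - x.K.υ (k + 2)) * ‖x.η A m (k + 2)‖ ^ 2 + 1 / 4)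
        + ∑ k ∈ Finset.range (m - 1), x.neighbor A m (k + 2)
        + |τ| * ∑ k ∈ Finset.range (m - 1), b (k + 2) * ‖x.η A m (k + 2)‖)
        + (A.θ - x.s.θhat) * τ := by
    rw [hτ]
    simp only [Finset.mul_sum, ← Finset.sum_add_distrib, mul_add]
    exact Finset.sum_congr rfl fun k _ => by ring
  rw [hsplit]
  have hM : ((m - 1 : ℕ) : ℝ) ≤ m := by exact_mod_cast Nat.sub_le m 1
  have hM1 : (1 : ℝ) + ((m - 1 : ℕ) : ℝ) ≤ m := by
    have : 1 + (m - 1) ≤ m := by omega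
    exact_mod_cast this
  have hM0 : (0 : ℝ) ≤ ((m - 1 : ℕ) : ℝ) := Nat.cast_nonneg _
  -- Termwise comparison: m b² exceeds the (m − 1)/2 · b² of the τ estimate, and the doubled gain υ
  -- also covers the b² from the rate of ξ.
  have hsum : ∑ k ∈ Finset.range (m - 1),
          ((expo m A.l 1 + 1 - x.K.c (k + 2)) * ‖x.ω A m (k + 2)‖ ^ 2
          + (expo m A.l 1 + b (k + 2) ^ 2 - x.K.υ (k + 2)) * ‖x.η A m (k + 2)‖ ^ 2 + 1 / 4)
        + 1 / 2 * ∑ k ∈ Finset.range (m - 1), (‖x.ω A m (k + 2)‖ ^ 2 + ‖x.η A m (k + 2)‖ ^ 2)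
        + ∑ k ∈ Finset.range (m - 1), ((m - 1 : ℕ) : ℝ) / 2 * b (k + 2) ^ 2
          * (‖x.ω A m (k + 2)‖ ^ 2 + ‖x.η A m (k + 2)‖ ^ 2)
      ≤ -(A.σ / 2) * ∑ k ∈ Finset.range (m - 1),
          (‖x.ω A m (k + 2)‖ ^ 2 + ‖x.η A m (k + 2)‖ ^ 2) + m / 4 := by
    have hq : (m : ℝ) / 4 ≥ ∑ _k ∈ Finset.range (m - 1), (1 / 4 : ℝ) := by
      rw [Finset.sum_const, Finset.card_range, nsmul_eq_mul]; linarith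
    refine le_trans ?_ (add_le_add_right hq _)
    simp only [Finset.mul_sum, ← Finset.sum_add_distrib]
    refine Finset.sum_le_sum fun k _ => ?_
    have hck : x.K.c (k + 2) = baseGain A m + m * b (k + 2) ^ 2 := by rw [hxK]; exact hc k
    have hυk : x.K.υ (k + 2) = 2 * (baseGain A m + m * b (k + 2) ^ 2) := by
      rw [hxK]; exact congrArg (2 * ·) (hc k)
    rw [hck, hυk]
    unfold baseGain
    have hb2 : 0 ≤ b (k + 2) ^ 2 := sq_nonneg _
    have e1 : 0 ≤ (m - ((m - 1 : ℕ) : ℝ) / 2) * b (k + 2) ^ 2 := mul_nonneg (by linarith) hb2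
    have e2 : 0 ≤ (2 * m - 1 - ((m - 1 : ℕ) : ℝ) / 2) * b (k + 2) ^ 2 :=
      mul_nonneg (by linarith) hb2
    have f1 : 0 ≤ (1 / 2 + A.σ / 2 + (m - ((m - 1 : ℕ) : ℝ) / 2) * b (k + 2) ^ 2)
        * ‖x.ω A m (k + 2)‖ ^ 2 := by positivity
    have f2 : 0 ≤ (expo m A.l 1 + 7 / 2 + 3 * A.σ / 2
        + (2 * m - 1 - ((m - 1 : ℕ) : ℝ) / 2) * b (k + 2) ^ 2) * ‖x.η A m (k + 2)‖ ^ 2 := by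
      positivity
    linarith
  have hω1 : (expo m A.l 1 + 3 / 2 - x.K.c 1) * ‖x.ω A m 1‖ ^ 2
      ≤ -(A.σ / 2) * ‖x.ω A m 1‖ ^ 2 := by
    have : x.K.c 1 = baseGain A m := by rw [hxK]; exact hc1
    rw [this]; unfold baseGain
    exact mul_le_mul_of_nonneg_right (by linarith) (sq_nonneg _)
  -- The exact identity has a further −½ θhat², which is dropped.
  have hθ : (A.θ - x.s.θhat) * x.s.θhat
      ≤ 1 / 2 * A.θ ^ 2 - 1 / 2 * (A.θ - x.s.θhat) ^ 2 := by
    nlinarith [sq_nonneg x.s.θhat]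
  have hθ' := mul_le_mul_of_nonneg_left hθ (mul_pos hσ hg).le
  have hmain : (expo m A.l 1 + 3 / 2 - x.K.c 1) * ‖x.ω A m 1‖ ^ 2 + x.neighbor A m 1
      + 1 / 2 * B ^ 2 + (∑ k ∈ Finset.range (m - 1),
          ((expo m A.l 1 + 1 - x.K.c (k + 2)) * ‖x.ω A m (k + 2)‖ ^ 2
          + (expo m A.l 1 + b (k + 2) ^ 2 - x.K.υ (k + 2)) * ‖x.η A m (k + 2)‖ ^ 2 + 1 / 4)
        + ∑ k ∈ Finset.range (m - 1), x.neighbor A m (k + 2)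
        + |τ| * ∑ k ∈ Finset.range (m - 1), b (k + 2) * ‖x.η A m (k + 2)‖)
      + A.σ * (1 / 2 * A.θ ^ 2 - 1 / 2 * (A.θ - x.s.θhat) ^ 2)
      ≤ drift A m B - A.σ / 2 * x.energy A m := by
    unfold drift Config.energy
    linarith
  have hfin := mul_le_mul_of_nonneg_left hmain hg.le
  linarith

/-- Barrier argument: the derivative need be negative only when the energy equals h². There the
configuration is tame, so `energy_rate_le` applies, and `hD` makes its bound negative. -/
theorem energy_invariant (hm : 2 ≤ m) (hg₀ : 0 < g₀) (hl : 0 < A.l) (hσ : 0 < A.σ)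
    (hφ : IsAdmissibleNonlinearity m A.φ) (hh : 0 < h)
    (hD : drift A m B < A.σ / 2 * h ^ 2) {c b : ℕ → ℝ}
    (hc1 : c 1 = baseGain A m) (hb : IsGainBound A m g₀ h B ⟨c, fun q => 2 * c q⟩ b)
    (hc : ∀ k, c (k + 2) = baseGain A m + m * b (k + 2) ^ 2)
    {γ γ' : ℝ → ℝ} {v : ℝ → Vec n} {s : ℝ → AgentState n} {a t₁ : ℝ}
    (hγ : ∀ t ∈ Ico a t₁, g₀ ≤ γ t ∧ |γ' t| ≤ γ t ^ 2)
    (hv : ∀ t ∈ Ico a t₁, ‖γ t ^ expo m A.l 1 • v t‖ ≤ B * γ t)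
    (hF : ∀ t ∈ Ico a t₁, IsFlow A m ⟨c, fun q => 2 * c q⟩ γ s (Ico a t₁) t (γ' t) (v t))
    {r t : ℝ} (har : a ≤ r) (hrt : r ≤ t) (ht : t < t₁)
    (hr : (Config.mk ⟨c, fun q => 2 * c q⟩ (γ r) 0 0 (s r)).energy A m ≤ h ^ 2) :
    (Config.mk ⟨c, fun q => 2 * c q⟩ (γ t) 0 0 (s t)).energy A m ≤ h ^ 2 := by
  have hsub : Icc r t ⊆ Ico a t₁ := fun u hu => ⟨har.trans hu.1, hu.2.trans_lt ht⟩
  have hd := fun u (hu : u ∈ Ico a t₁) =>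
    (hF u hu).energy_deriv hm hφ (hg₀.trans_le (hγ u hu).1) rfl
  have hd' : ∀ u ∈ Ico a t₁, ∃ d, HasDerivWithinAt
      (fun u => (Config.mk ⟨c, fun q => 2 * c q⟩ (γ u) 0 0 (s u)).energy A m) d (Ico a t₁) u ∧
      ((Config.mk ⟨c, fun q => 2 * c q⟩ (γ u) 0 0 (s u)).energy A m = h ^ 2 → d < 0) := by
    intro u hu
    refine ⟨_, hd u hu, fun hE => ?_⟩
    have hx : ∀ q, IsTame A m g₀ h B ⟨c, fun q => 2 * c q⟩ q
        ⟨⟨c, fun q => 2 * c q⟩, γ u, γ' u, v u, s u⟩ := fun q =>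
      IsTame.of_energy_le hh.le (x := ⟨⟨c, fun q => 2 * c q⟩, γ u, γ' u, v u, s u⟩) hE.le
        (hγ u hu).1 (hγ u hu).2 (hv u hu) q
    have hle := energy_rate_le hm hg₀ hl hσ hc1 hb hc rfl hx
    have hE' : (Config.mk ⟨c, fun q => 2 * c q⟩ (γ u) (γ' u) (v u) (s u)).energy A m = h ^ 2 := hE
    have hneg : γ u * (drift A m B - A.σ / 2 *
        (Config.mk ⟨c, fun q => 2 * c q⟩ (γ u) (γ' u) (v u) (s u)).energy A m) < 0 := by
      rw [hE']
      exact mul_neg_of_pos_of_neg (hg₀.trans_le (hγ u hu).1) (by linarith)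
    exact mul_neg_of_pos_of_neg two_pos (hle.trans_lt hneg)
  choose! d hd1 hd2 using hd'
  exact image_le_of_deriv_right_lt_deriv_boundary' (B := fun _ => h ^ 2) (B' := fun _ => 0)
    (fun u hu => (hd1 u (hsub hu)).continuousWithinAt.mono hsub)
    (fun u hu => hasDerivWithinAt_Ici_of_Ico (hd1 u (hsub ⟨hu.1, hu.2.le⟩)) (hsub ⟨hu.1, hu.2.le⟩))
    hr continuousOn_const (fun u _ => hasDerivWithinAt_const _ _ _)
    (fun u hu => hd2 u (hsub ⟨hu.1, hu.2.le⟩)) (right_mem_Icc.2 hrt)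

end Tracking

section Tracking

open Asymptotics

variable {n : ℕ} {A : Agent n} {m : ℕ} {g₀ h B : ℝ} {K : Gains}

/-! ### Initialization of the filters -/

/-- The initial virtual controls. -/
def initialXi (A : Agent n) (m : ℕ) (g₀ : ℝ) (s : AgentState n) (k : ℕ) : Vec n :=
  if k = 0 then -((baseGain A m * g₀) • (s.x 1 - s.ϖ)) else -(s.θhat • A.φ (k + 1) (s.x (k + 1)))

/-- The initial filter states; they make the initial virtual controls independent of the gains. -/
def initialFilter (A : Agent n) (m : ℕ) (g₀ : ℝ) (s : AgentState n) (q : ℕ) : Vec n :=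
  (2 : ℝ) • initialXi A m g₀ s (q - 2) - s.x q

/-- Here x̃_q = 2(x_q − ξ_{q-1}) and ξ̃_q = ξ_{q-1} − x_q, so c_q x̃_q + υ_q ξ̃_q = 0 when υ_q =
2c_q, and only −θhat φ_q remains. At the first level the gain is the fixed base gain. -/
theorem xi_initialFilter {c : ℕ → ℝ} (hc1 : c 1 = baseGain A m) (s : AgentState n) :
    ∀ k, A.xi ⟨c, fun q => 2 * c q⟩ g₀ { s with ξf := initialFilter A m g₀ s } (k + 1)
      = initialXi A m g₀ s k
  | 0 => by
    rw [initialXi, if_pos rfl, ← hc1]; rfl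
  | k + 1 => by
    have ih := xi_initialFilter hc1 s k
    rw [Agent.xi, ih]
    have h1 : AgentState.xTilde { s with ξf := initialFilter A m g₀ s } (k + 2)
        = s.x (k + 2) - initialFilter A m g₀ s (k + 2) := if_neg (by omega)
    have h2 : initialFilter A m g₀ s (k + 2) = (2 : ℝ) • initialXi A m g₀ s k - s.x (k + 2) := rfl
    have h3 : initialXi A m g₀ s (k + 1) = -(s.θhat • A.φ (k + 2) (s.x (k + 2))) :=
      if_neg (Nat.succ_ne_zero k)
    rw [h1, h3]
    simp only [h2]
    module

/-- The initial virtual controls do not depend on `c` beyond c_1, and the nonlinearities are bounded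
on the ball of radius `R`. So `E₀` precedes the gains, and the radius h can be chosen before them.
-/
theorem exists_initial_energy_bound (hφ : IsAdmissibleNonlinearity m A.φ)
    (g₀ R : ℝ) :
    ∃ E₀, ∀ c : ℕ → ℝ, c 1 = baseGain A m → ∀ s : AgentState n,
      (∀ q, 1 ≤ q → q ≤ m → ‖s.x q‖ ≤ R) → 1 ≤ m → |s.θhat| ≤ R → ‖s.ϖ‖ ≤ R →
      (Config.mk ⟨c, fun q => 2 * c q⟩ g₀ 0 0
        { s with ξf := initialFilter A m g₀ s }).energy A m ≤ E₀ := by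
  have hφb : ∀ k, ∃ C, k + 1 ≤ m → 1 ≤ k → ∀ y : Vec n, ‖y‖ ≤ R → ‖A.φ (k + 1) y‖ ≤ C := by
    intro k
    by_cases hk : k + 1 ≤ m ∧ 1 ≤ k
    · obtain ⟨C, hC⟩ := (isCompact_closedBall (0 : Vec n) R).exists_bound_of_continuousOn
        (hφ (k + 1) (by omega) hk.1).2.1.continuous.continuousOn
      exact ⟨C, fun _ _ y hy => hC y (mem_closedBall_zero_iff.2 hy)⟩
    · exact ⟨0, fun h1 h2 => absurd ⟨h1, h2⟩ hk⟩
  choose Cφ hCφ using hφb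
  refine ⟨(|g₀ ^ expo m A.l 1| * (R + R)) ^ 2 + ∑ k ∈ Finset.range (m - 1),
    ((|g₀ ^ expo m A.l (k + 2)| * (2 * (R + |baseGain A m * g₀| * (R + R)
      + |R * Cφ k|))) ^ 2 + (|g₀ ^ expo m A.l (k + 2)| * (R
      + |baseGain A m * g₀| * (R + R) + |R * Cφ k|)) ^ 2) + (|A.θ| + R) ^ 2, ?_⟩
  intro c hc1 s hx hm hθ hϖ
  have hR : 0 ≤ R := (abs_nonneg _).trans hθ
  have hx1 : ‖s.x 1 - s.ϖ‖ ≤ R + R := (norm_sub_le _ _).trans (add_le_add (hx 1 le_rfl hm) hϖ)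
  have hdiff : ∀ k ∈ Finset.range (m - 1), ‖s.x (k + 2) - initialXi A m g₀ s k‖
      ≤ R + |baseGain A m * g₀| * (R + R) + |R * Cφ k| := by
    intro k hk
    have hk' := Finset.mem_range.1 hk
    have hxk := hx (k + 2) (by omega) (by omega)
    have hxi : ‖initialXi A m g₀ s k‖ ≤ |baseGain A m * g₀| * (R + R) + |R * Cφ k| := by
      rw [initialXi]
      split_ifs with h0
      · rw [norm_neg, norm_smul, Real.norm_eq_abs]
        exact (mul_le_mul_of_nonneg_left hx1 (abs_nonneg _)).trans
          (le_add_of_nonneg_right (abs_nonneg _))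
      · rw [norm_neg, norm_smul, Real.norm_eq_abs]
        refine le_trans ?_ (le_add_of_nonneg_left (by positivity))
        refine le_trans ?_ (le_abs_self _)
        exact mul_le_mul hθ (hCφ k (by omega) (by omega) _ (hx (k + 1) (by omega) (by omega)))
          (norm_nonneg _) hR
    have := norm_sub_le (s.x (k + 2)) (initialXi A m g₀ s k)
    linarith
  unfold Config.energy
  refine add_le_add (add_le_add ?_ (Finset.sum_le_sum fun k hk => ?_)) ?_
  · refine pow_le_pow_left₀ (norm_nonneg _) ?_ 2
    rw [Config.ω, norm_smul, Real.norm_eq_abs]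
    exact mul_le_mul_of_nonneg_left hx1 (abs_nonneg _)
  · have h2 : initialFilter A m g₀ s (k + 2) = (2 : ℝ) • initialXi A m g₀ s k - s.x (k + 2) := rfl
    have h1 : AgentState.xTilde { s with ξf := initialFilter A m g₀ s } (k + 2)
        = (2 : ℝ) • (s.x (k + 2) - initialXi A m g₀ s k) := by
      have : AgentState.xTilde { s with ξf := initialFilter A m g₀ s } (k + 2)
        = s.x (k + 2) - initialFilter A m g₀ s (k + 2) := if_neg (by omega)
      rw [this, h2]; module
    have h3 : A.xiTilde ⟨c, fun q => 2 * c q⟩ g₀ { s with ξf := initialFilter A m g₀ s } (k + 2)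
        = -(s.x (k + 2) - initialXi A m g₀ s k) := by
      have h4 := xi_initialFilter (g₀ := g₀) hc1 s k
      have h5 : A.xiTilde ⟨c, fun q => 2 * c q⟩ g₀ { s with ξf := initialFilter A m g₀ s } (k + 2)
        = initialFilter A m g₀ s (k + 2) - A.xi ⟨c, fun q => 2 * c q⟩ g₀
          { s with ξf := initialFilter A m g₀ s } (k + 1) := rfl
      rw [h5, h4, h2]; module
    refine add_le_add (pow_le_pow_left₀ (norm_nonneg _) ?_ 2)
      (pow_le_pow_left₀ (norm_nonneg _) ?_ 2)
    · rw [Config.ω, norm_smul, Real.norm_eq_abs, h1, norm_smul, Real.norm_two]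
      exact mul_le_mul_of_nonneg_left (mul_le_mul_of_nonneg_left (hdiff k hk) two_pos.le)
        (abs_nonneg _)
    · rw [Config.η, norm_smul, Real.norm_eq_abs, h3, norm_neg]
      exact mul_le_mul_of_nonneg_left (hdiff k hk) (abs_nonneg _)
  · refine sq_le_sq' ?_ ?_
    · have := neg_abs_le A.θ
      have := (abs_le.1 hθ).2
      change -(|A.θ| + R) ≤ A.θ - s.θhat
      linarith
    · have := le_abs_self A.θ
      have := (abs_le.1 hθ).1
      change A.θ - s.θhat ≤ |A.θ| + R
      linarith

/-! ### Boundedness of the controller signals -/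

theorem isBigO_ξf (hg₀ : 0 < g₀) (hl : 0 < A.l) {k r : ℕ} (hk : k + 2 ≤ m)
    (hx : (fun x : Config n => x.s.x (k + 2)) =O[tame A m g₀ h B K r] fun _ => (1 : ℝ)) :
    (fun x : Config n => x.s.ξf (k + 2)) =O[tame A m g₀ h B K r] fun _ => (1 : ℝ) := by
  refine isBigO_tame_congr (hx.sub (IsBigO_smul_left (isBigO_pw_inv hg₀
    (expo_pos hl (q := k + 2) (by omega))) (isBigO_ω (by omega) hk))) fun x hx => ?_
  have h1 : x.s.xTilde (k + 2) = x.s.x (k + 2) - x.s.ξf (k + 2) := if_neg (by omega)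
  rw [Config.ω, inv_smul_smul₀ (Config.pw_pos (hx.g_pos hg₀) _).ne', h1, sub_sub_cancel]

/-- The input involves the gains of index `m`, hence tameness at `m + 1`, where all gains are fixed.
-/
theorem isBigO_input (hm : 2 ≤ m) (hg₀ : 0 < g₀) (hl : 0 < A.l)
    (hφ : IsAdmissibleNonlinearity m A.φ) :
    (fun x : Config n => A.input m x.K x.g x.s) =O[tame A m g₀ h B K (m + 1)]
      fun _ => (1 : ℝ) := by
  obtain ⟨M, rfl⟩ := Nat.exists_eq_add_of_le' (show 1 ≤ m by omega)
  refine isBigO_tame_congr (IsBigO_smul_left (isBigO_pw_inv hg₀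
    (expo_pos hl (q := M + 2) (by omega))) (isBigO_pw_xi hm hg₀ hl hφ M le_rfl)) fun x hx => ?_
  rw [inv_smul_smul₀ (Config.pw_pos (hx.g_pos hg₀) _).ne']
  rfl

theorem exists_signal_bound (hm : 2 ≤ m) (hg₀ : 0 < g₀) (hl : 0 < A.l)
    (hφ : IsAdmissibleNonlinearity m A.φ) (h B : ℝ) (K : Gains) :
    ∃ C, 0 ≤ C ∧ ∀ x, IsTame A m g₀ h B K (m + 1) x →
      (∀ q, 2 ≤ q → q ≤ m → ‖x.s.x q‖ ≤ C ∧ ‖x.s.ξf q‖ ≤ C) ∧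
      ‖A.input m x.K x.g x.s‖ ≤ C ∧ |x.s.θhat| ≤ C ∧ ‖x.s.xTilde 1‖ ≤ C := by
  have hq : ∀ q, ∃ C, 2 ≤ q → q ≤ m → ∀ x, IsTame A m g₀ h B K (m + 1) x →
      ‖x.s.x q‖ ≤ C ∧ ‖x.s.ξf q‖ ≤ C := by
    intro q
    by_cases hq : 2 ≤ q ∧ q ≤ m
    · obtain ⟨k, rfl⟩ := Nat.exists_eq_add_of_le' hq.1
      have hx := ((isBigO_controller (K := K) (g₀ := g₀) (h := h) (B := B) hm hg₀ hl hφ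
        hq.2).2.1).mono (tame_anti (show k + 2 ≤ m + 1 by omega))
      obtain ⟨C1, h1⟩ := isBigO_iff.1 hx
      obtain ⟨C2, h2⟩ := isBigO_iff.1 (isBigO_ξf hg₀ hl hq.2 hx)
      rw [tame, eventually_principal] at h1 h2
      refine ⟨max C1 C2, fun _ _ x hx => ⟨?_, ?_⟩⟩
      · have := h1 x hx
        rw [norm_one, mul_one] at this
        exact this.trans (le_max_left _ _)
      · have := h2 x hx
        rw [norm_one, mul_one] at this
        exact this.trans (le_max_right _ _)
    · exact ⟨0, fun h1 h2 => absurd ⟨h1, h2⟩ hq⟩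
  choose Cq hCq using hq
  obtain ⟨C1, h1⟩ := isBigO_iff.1 (isBigO_input (K := K) (g₀ := g₀) (h := h) (B := B) hm hg₀ hl hφ)
  obtain ⟨C2, h2⟩ := isBigO_iff.1 (isBigO_θhat (A := A) (m := m) (K := K) (g₀ := g₀) (h := h)
    (B := B) (r := m + 1))
  have h3' : (fun x : Config n => x.s.xTilde 1) =O[tame A m g₀ h B K (m + 1)]
      fun _ => (1 : ℝ) := by
    refine isBigO_tame_congr (IsBigO_smul_left (isBigO_pw_inv hg₀
      (expo_pos hl (q := 1) (by omega))) (isBigO_ω le_rfl (by omega))) fun x hx => ?_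
    rw [Config.ω, inv_smul_smul₀ (Config.pw_pos (hx.g_pos hg₀) _).ne']
  obtain ⟨C3, h3⟩ := isBigO_iff.1 h3'
  rw [tame, eventually_principal] at h1 h2 h3
  have hsum : ∀ q ≤ m, |Cq q| ≤ ∑ q ∈ Finset.range (m + 1), |Cq q| := fun q hq =>
    Finset.single_le_sum (f := fun q => |Cq q|) (fun _ _ => abs_nonneg _)
      (Finset.mem_range.2 (by omega))
  have hs0 : 0 ≤ ∑ q ∈ Finset.range (m + 1), |Cq q| := Finset.sum_nonneg fun _ _ => abs_nonneg _
  have a1 := abs_nonneg C1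
  have a2 := abs_nonneg C2
  have a3 := abs_nonneg C3
  refine ⟨∑ q ∈ Finset.range (m + 1), |Cq q| + |C1| + |C2| + |C3|, by positivity,
    fun x hx => ⟨fun q hq1 hq2 => ?_, ?_, ?_, ?_⟩⟩
  · obtain ⟨e1, e2⟩ := hCq q hq1 hq2 x hx
    have := hsum q hq2
    have := le_abs_self (Cq q)
    exact ⟨by linarith, by linarith⟩
  · have := h1 x hx
    rw [norm_one, mul_one] at this
    linarith [le_abs_self C1]
  · have := h2 x hx
    rw [norm_one, mul_one, Real.norm_eq_abs] at this
    linarith [le_abs_self C2]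
  · have := h3 x hx
    rw [norm_one, mul_one] at this
    linarith [le_abs_self C3]

end Tracking

/-! ### The design for one agent of the network -/

section Design

variable {N n m : ℕ} {G : Network N} {f : Fin N → Vec n → ℝ} {α : ℝ → ℝ}
  {A : Fin N → Agent n} {K : Fin N → Gains} {t₀ T t₁ : ℝ} {S : ℝ → Fin N → AgentState n}

theorem IsSolution.isFlow (hS : IsSolution G f α m A K t₀ T t₁ S) (ht₁ : t₁ ≤ t₀ + T) (i : Fin N)
    (hd : DifferentiableOn ℝ (A i).αξ (Ioi 0)) {t : ℝ} (ht : t ∈ Ico t₀ t₁) :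
    IsFlow (A i) m (K i) (fun r => (A i).αξ (mu t₀ T r)) (fun r => S r i) (Ico t₀ t₁) t
      (deriv (A i).αξ (mu t₀ T t) * mu t₀ T t ^ 2) (ϖRate G f (α (mu t₀ T t)) (S t) i) where
  γ_eq := (hasDerivAt_gain hd ⟨ht.1, ht.2.trans_le ht₁⟩).hasDerivWithinAt
  ϖ_eq := hS.ϖ_eq t ht i
  x_first := hS.x_first t ht i
  x_mid := hS.x_mid t ht i
  x_last := hS.x_last t ht i
  θhat_eq := hS.θhat_eq t ht i
  ξf_eq := hS.ξf_eq t ht i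

theorem transformAt_mem_Omega (hm : 2 ≤ m) {h t : ℝ} {s : Fin N → AgentState n} {i : Fin N} :
    transformAt m A K t₀ T t s i ∈ Omega m n h ↔
      (Config.mk (K i) ((A i).αξ (mu t₀ T t)) 0 0 (s i)).energy (A i) m ≤ h ^ 2 := by
  rw [← norm_transform_sq hm]; rfl

/-- The bounds on the state of an agent that hold along the closed loop. -/
structure IsBoundedBy (A : Agent n) (m : ℕ) (K : Gains) (g C : ℝ) (s : AgentState n) : Prop where
  x : ∀ q, 1 ≤ q → q ≤ m → ‖s.x q‖ ≤ C
  input : ‖A.input m K g s‖ ≤ C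
  ϖ : ‖s.ϖ‖ ≤ C
  p : ‖s.p‖ ≤ C
  θhat : |s.θhat| ≤ C
  ξf : ∀ q, 2 ≤ q → q ≤ m → ‖s.ξf q‖ ≤ C

theorem IsBoundedBy.mono {A : Agent n} {K : Gains} {g C C' : ℝ} {s : AgentState n}
    (hs : IsBoundedBy A m K g C s) (hC : C ≤ C') : IsBoundedBy A m K g C' s :=
  ⟨fun q h1 h2 => (hs.x q h1 h2).trans hC, hs.input.trans hC, hs.ϖ.trans hC, hs.p.trans hC,
    hs.θhat.trans hC, fun q h1 h2 => (hs.ξf q h1 h2).trans hC⟩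

/-- The order of choices avoids circularity: `B` from the generator and `E₀` from the initial data,
then h, then the gains for this h, and last the signal bound for these gains. -/
theorem exists_agent_design {rho varrho : ℝ} (hN : 2 ≤ N) (hm : 2 ≤ m) (hG : G.graph.Connected)
    (hrho : 0 < rho) (hvarrho : 0 < varrho) (hf : ∀ i, IsAdmissibleCost rho varrho (f i))
    {z : Vec n} (hz : IsMinOn (fun w => ∑ i, f i w) Set.univ z) (hT : 0 < T)
    (hα : IsGeneratorGain (cStar (G.lambda2 hN) rho varrho) α) (i : Fin N)
    (hφ : IsAdmissibleNonlinearity m (A i).φ) (hl : 0 < (A i).l) (hσ : 0 < (A i).σ)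
    (hξ : IsTrackingGain (cStar (G.lambda2 hN) rho varrho) (expo m (A i).l 2) α (A i).αξ)
    (R : ℝ) :
    ∃ (c : ℕ → ℝ) (h C : ℝ), 0 < h ∧ (∀ q, 1 ≤ q → 0 < c q) ∧
      (∀ (K : Fin N → Gains), K i = ⟨c, fun q => 2 * c q⟩ →
        (∀ (t₁ : ℝ) (S : ℝ → Fin N → AgentState n), t₁ ≤ t₀ + T →
          IsSolution G f α m A K t₀ T t₁ S → IsGeneratorInit R (S t₀) →
          (∀ s t, t₀ ≤ s → s ≤ t → t < t₁ → transformAt m A K t₀ T s (S s) i ∈ Omega m n h →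
            transformAt m A K t₀ T t (S t) i ∈ Omega m n h) ∧
          (transformAt m A K t₀ T t₀ (S t₀) i ∈ Omega m n h → ∀ t ∈ Ico t₀ t₁,
            IsBoundedBy (A i) m (K i) ((A i).αξ (mu t₀ T t)) C (S t i) ∧
            ‖(S t i).x 1 - z‖ ≤ h * ((A i).αξ (mu t₀ T t) ^ expo m (A i).l 1)⁻¹
              + C * (α (mu t₀ T t) * (A i).αξ (mu t₀ T t) ^ expo m (A i).l 2)⁻¹))) ∧
      ∀ s : AgentState n, (∀ q, 1 ≤ q → q ≤ m → ‖s.x q‖ ≤ R) → |s.θhat| ≤ R → ‖s.ϖ‖ ≤ R →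
        (Config.mk ⟨c, fun q => 2 * c q⟩ ((A i).αξ (mu t₀ T t₀)) 0 0
          { s with ξf := initialFilter (A i) m ((A i).αξ (mu t₀ T t₀)) s }).energy (A i) m
            ≤ h ^ 2 := by
  have ht₀ : t₀ ∈ Ico t₀ (t₀ + T) := ⟨le_rfl, by linarith⟩
  have hL2 : 0 < expo m (A i).l 2 := expo_pos hl (by omega)
  have hL1 : expo m (A i).l 1 = expo m (A i).l 2 + 1 := expo_succ m _ 1
  set g₀ := (A i).αξ (mu t₀ T t₀) with hg₀_def
  have hg₀ : 0 < g₀ := hξ.kInfty.pos_mu ht₀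
  obtain ⟨B, hB, hgen⟩ := exists_generator_bound hN hG hrho hvarrho hf hz hα hL2 hξ A m t₀ T R
  obtain ⟨E₀, hE₀⟩ := exists_initial_energy_bound hφ g₀ R
  -- The first summand makes room for the initial data; the second, thanks to the `+ 1`, puts σ/2 ·
  -- h² strictly above the drift.
  set h := √(|E₀| + 2 / (A i).σ * (|drift (A i) m B| + 1))
  have hh : 0 < h := Real.sqrt_pos.2 (by positivity)
  have hh2 : h ^ 2 = |E₀| + 2 / (A i).σ * (|drift (A i) m B| + 1) :=
    Real.sq_sqrt (by positivity)
  have hE₀h : E₀ ≤ h ^ 2 := by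
    rw [hh2]
    exact (le_abs_self _).trans (le_add_of_nonneg_right (by positivity))
  have hD : drift (A i) m B < (A i).σ / 2 * h ^ 2 := by
    rw [hh2, mul_add]
    have e1 : (A i).σ / 2 * (2 / (A i).σ * (|drift (A i) m B| + 1)) = |drift (A i) m B| + 1 := by
      field_simp
    have e2 : 0 ≤ (A i).σ / 2 * |E₀| := by positivity
    rw [e1]
    linarith [le_abs_self (drift (A i) m B)]
  obtain ⟨c, b, hc1, hb, hc⟩ := exists_gains hm hg₀ hl hφ h B
  obtain ⟨C, hC, hsig⟩ := exists_signal_bound hm hg₀ hl hφ h B ⟨c, fun q => 2 * c q⟩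
  have hbase : 0 < baseGain (A i) m := by
    have := expo_pos hl (q := 1) (m := m) (by omega)
    unfold baseGain; linarith
  -- The weight is nondecreasing in time, so its initial value turns decay estimates into uniform
  -- bounds.
  set k₀ := α (mu t₀ T t₀) * g₀ ^ expo m (A i).l 2
  have hk₀ : 0 < k₀ := mul_pos (hα.kInfty.pos_mu ht₀) (Real.rpow_pos_of_pos hg₀ _)
  set C' := C + B + B / k₀ + ‖z‖ + ‖gradient (f i) z‖
  have hBk : 0 ≤ B / k₀ := by positivity
  have hz0 := norm_nonneg z
  have hgz0 := norm_nonneg (gradient (f i) z)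
  refine ⟨c, h, C', hh, ?_, ?_, ?_⟩
  · intro q hq
    rcases Nat.lt_or_ge q 2 with hq2 | hq2
    · obtain rfl : q = 1 := by omega
      rw [hc1]; exact hbase
    · obtain ⟨k, rfl⟩ := Nat.exists_eq_add_of_le' hq2
      rw [hc]; positivity
  · intro K hK t₁ S ht₁ hS h0
    have hgen' := hgen K t₁ S ht₁ hS h0
    have hmem : ∀ t ∈ Ico t₀ t₁, t ∈ Ico t₀ (t₀ + T) := fun t ht => ⟨ht.1, ht.2.trans_le ht₁⟩
    have hγpos : ∀ t ∈ Ico t₀ t₁, 0 < (A i).αξ (mu t₀ T t) := fun t ht =>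
      hξ.kInfty.pos_mu (hmem t ht)
    have hγ : ∀ t ∈ Ico t₀ t₁, g₀ ≤ (A i).αξ (mu t₀ T t) ∧
        |deriv (A i).αξ (mu t₀ T t) * mu t₀ T t ^ 2| ≤ (A i).αξ (mu t₀ T t) ^ 2 := by
      intro t ht
      refine ⟨hξ.kInfty.mono_mu le_rfl ht.1 (hmem t ht).2, ?_⟩
      rw [abs_of_nonneg (deriv_gain_nonneg hξ.kInfty (hmem t ht))]
      have := deriv_gain_le (k := 1) (by simpa using hξ.deriv_le) (hmem t ht)
      rwa [one_mul] at this
    have hv : ∀ t ∈ Ico t₀ t₁, ‖(A i).αξ (mu t₀ T t) ^ expo m (A i).l 1 •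
        ϖRate G f (α (mu t₀ T t)) (S t) i‖ ≤ B * (A i).αξ (mu t₀ T t) := by
      intro t ht
      have hp := hγpos t ht
      -- As L₁ = L₂ + 1, the generator bound with weight αξ^{L₂} leaves one factor αξ.
      rw [norm_smul, Real.norm_of_nonneg (Real.rpow_nonneg hp.le _), hL1,
        Real.rpow_add_one hp.ne', mul_right_comm]
      exact mul_le_mul_of_nonneg_right (hgen' t ht i).2.2 hp.le
    have hF : ∀ t ∈ Ico t₀ t₁, IsFlow (A i) m ⟨c, fun q => 2 * c q⟩
        (fun r => (A i).αξ (mu t₀ T r)) (fun r => S r i) (Ico t₀ t₁) t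
        (deriv (A i).αξ (mu t₀ T t) * mu t₀ T t ^ 2) (ϖRate G f (α (mu t₀ T t)) (S t) i) := by
      intro t ht
      rw [← hK]
      exact hS.isFlow ht₁ i hξ.differentiableOn ht
    have hinv : ∀ s t, t₀ ≤ s → s ≤ t → t < t₁ →
        transformAt m A K t₀ T s (S s) i ∈ Omega m n h →
          transformAt m A K t₀ T t (S t) i ∈ Omega m n h := by
      intro s t hs hst ht hmem
      rw [transformAt_mem_Omega hm, hK] at hmem ⊢
      exact energy_invariant (γ := fun r => (A i).αξ (mu t₀ T r)) (s := fun r => S r i)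
        hm hg₀ hl hσ hφ hh hD hc1 hb hc hγ hv hF hs hst ht hmem
    refine ⟨hinv, fun hmem0 t ht => ?_⟩
    have hE := hinv t₀ t le_rfl ht.1 ht.2 hmem0
    rw [transformAt_mem_Omega hm, hK] at hE
    have htame : IsTame (A i) m g₀ h B ⟨c, fun q => 2 * c q⟩ (m + 1)
        ⟨⟨c, fun q => 2 * c q⟩, (A i).αξ (mu t₀ T t), deriv (A i).αξ (mu t₀ T t) * mu t₀ T t ^ 2,
          ϖRate G f (α (mu t₀ T t)) (S t) i, S t i⟩ :=
      IsTame.of_energy_le (x := ⟨⟨c, fun q => 2 * c q⟩, (A i).αξ (mu t₀ T t),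
        deriv (A i).αξ (mu t₀ T t) * mu t₀ T t ^ 2, ϖRate G f (α (mu t₀ T t)) (S t) i, S t i⟩)
        hh.le hE (hγ t ht).1 (hγ t ht).2 (hv t ht) _
    obtain ⟨hx, hu, hθ, hx1⟩ := hsig _ htame
    have hω1 := htame.norm_ω 1 le_rfl (by omega)
    obtain ⟨e1, e2, -⟩ := hgen' t ht i
    have hγL : 0 < (A i).αξ (mu t₀ T t) ^ expo m (A i).l 2 := Real.rpow_pos_of_pos (hγpos t ht) _
    have hk : k₀ ≤ α (mu t₀ T t) * (A i).αξ (mu t₀ T t) ^ expo m (A i).l 2 :=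
      mul_le_mul (hα.kInfty.mono_mu le_rfl ht.1 (hmem t ht).2)
        (Real.rpow_le_rpow hg₀.le (hγ t ht).1 hL2.le) (Real.rpow_nonneg hg₀.le _)
        (hα.kInfty.pos_mu (hmem t ht)).le
    set k := α (mu t₀ T t) * (A i).αξ (mu t₀ T t) ^ expo m (A i).l 2
    have hkpos : 0 < k := hk₀.trans_le hk
    have e1' : ‖(S t i).ϖ - z‖ ≤ B / k := by rwa [le_div_iff₀ hkpos, mul_comm]
    have e2' : ‖(S t i).p + gradient (f i) z‖ ≤ B / k := by rwa [le_div_iff₀ hkpos, mul_comm]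
    have hBkk : B / k ≤ B / k₀ := div_le_div_of_nonneg_left hB hk₀ hk
    have hϖ : ‖(S t i).ϖ‖ ≤ B / k₀ + ‖z‖ := by
      have := norm_add_le ((S t i).ϖ - z) z
      rw [sub_add_cancel] at this
      linarith
    have hp : ‖(S t i).p‖ ≤ B / k₀ + ‖gradient (f i) z‖ := by
      have := norm_sub_le ((S t i).p + gradient (f i) z) (gradient (f i) z)
      rw [add_sub_cancel_right] at this
      linarith
    have hxT : (S t i).xTilde 1 = (S t i).x 1 - (S t i).ϖ := rfl
    refine ⟨⟨fun q h1 h2 => ?_, ?_, ?_, ?_, ?_, fun q h1 h2 => ?_⟩, ?_⟩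
    · rcases Nat.lt_or_ge q 2 with hq2 | hq2
      · obtain rfl : q = 1 := by omega
        have := norm_add_le ((S t i).xTilde 1) (S t i).ϖ
        rw [hxT, sub_add_cancel] at this
        rw [hxT] at hx1
        linarith
      · have := (hx q hq2 h2).1
        linarith
    · rw [hK]; linarith
    · linarith
    · linarith
    · linarith
    · have := (hx q h1 h2).2
      linarith
    · have hpw : 0 < (A i).αξ (mu t₀ T t) ^ expo m (A i).l 1 :=
        Real.rpow_pos_of_pos (hγpos t ht) _
      have h3 : ‖(S t i).xTilde 1‖ ≤ h * ((A i).αξ (mu t₀ T t) ^ expo m (A i).l 1)⁻¹ := by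
        rw [← div_eq_mul_inv, le_div_iff₀ hpw, mul_comm]
        rw [Config.ω, norm_smul] at hω1
        refine le_trans (mul_le_mul_of_nonneg_right (le_abs_self _) (norm_nonneg _)) hω1
      have h4 : B / k ≤ C' * k⁻¹ := by
        rw [div_eq_mul_inv]
        exact mul_le_mul_of_nonneg_right (by linarith) (inv_nonneg.2 hkpos.le)
      have h5 := norm_add_le ((S t i).xTilde 1) ((S t i).ϖ - z)
      rw [hxT, sub_add_sub_cancel] at h5
      rw [hxT] at h3
      linarith
  · intro s hx hθ hϖ
    exact (hE₀ c hc1 s hx (by omega) hθ hϖ).trans hE₀h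

end Design

/-! ### Locally Lipschitz maps -/

section LocallyLipschitz

variable {X E F : Type*} [PseudoEMetricSpace X] [NormedAddCommGroup E]
  [NormedAddCommGroup F] [InnerProductSpace ℝ F]

theorem locallyLipschitz_smul [NormedSpace ℝ E] {u : X → ℝ} {v : X → E} (hu : LocallyLipschitz u)
    (hv : LocallyLipschitz v) : LocallyLipschitz fun x => u x • v x :=
  (ContDiff.locallyLipschitz (𝕂 := ℝ) (contDiff_smul (𝕜 := ℝ) (F := E) (n := 1))).comp
    (hu.prodMk hv)

theorem locallyLipschitz_mul {u v : X → ℝ} (hu : LocallyLipschitz u)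
    (hv : LocallyLipschitz v) : LocallyLipschitz fun x => u x * v x :=
  locallyLipschitz_smul hu hv

theorem locallyLipschitz_inner {u v : X → F} (hu : LocallyLipschitz u)
    (hv : LocallyLipschitz v) : LocallyLipschitz fun x => (inner ℝ (u x) (v x) : ℝ) :=
  (ContDiff.locallyLipschitz (𝕂 := ℝ) (contDiff_inner (𝕜 := ℝ) (E := F) (n := 1))).comp
    (hu.prodMk hv)

theorem locallyLipschitz_sum {ι : Type*} {u : ι → X → E} (s : Finset ι)
    (hu : ∀ i ∈ s, LocallyLipschitz (u i)) : LocallyLipschitz fun x => ∑ i ∈ s, u i x := by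
  classical
  induction s using Finset.induction_on with
  | empty => simpa using LocallyLipschitz.const (0 : E)
  | insert i s hi ih =>
    simp only [Finset.sum_insert hi]
    exact (hu i (Finset.mem_insert_self i s)).add
      (ih fun j hj => hu j (Finset.mem_insert_of_mem hj))

theorem locallyLipschitz_pi {ι : Type*} [Fintype ι] {Y : ι → Type*}
    [∀ i, PseudoEMetricSpace (Y i)] {u : X → ∀ i, Y i}
    (hu : ∀ i, LocallyLipschitz fun x => u x i) : LocallyLipschitz u := by
  intro x
  choose K s hs hK using fun i => hu i x
  refine ⟨∑ i, K i, ⋂ i, s i, iInter_mem.2 hs, fun a ha b hb => ?_⟩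
  refine edist_pi_le_iff.2 fun i => (hK i (mem_iInter.1 ha i) (mem_iInter.1 hb i)).trans ?_
  gcongr
  exact Finset.single_le_sum (f := K) (fun _ _ => zero_le) (Finset.mem_univ i)

theorem locallyLipschitz_apply {ι : Type*} [Fintype ι] {Y : ι → Type*}
    [∀ i, PseudoEMetricSpace (Y i)] (i : ι) : LocallyLipschitz fun u : ∀ i, Y i => u i :=
  (LipschitzWith.eval i).locallyLipschitz

end LocallyLipschitz

/-! ### Global solutions of differential equations with an a priori bound -/

section GlobalSolution

variable {P E : Type*} [NormedAddCommGroup P] [NormedAddCommGroup E]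
  {Ψ : P × E → E} {γ : ℝ → P} {a b C : ℝ} {y₀ : E}

theorem lipschitzOnWith_uncurry_right {s : Set P} {u : Set E} {L : NNReal}
    (h : LipschitzOnWith L Ψ (s ×ˢ u)) {p : P} (hp : p ∈ s) :
    LipschitzOnWith L (fun y => Ψ (p, y)) u := fun x hx y hy => by
  have := h (mk_mem_prod hp hx) (mk_mem_prod hp hy)
  rwa [Prod.edist_eq, edist_self, max_eq_right zero_le] at this

variable [NormedSpace ℝ E]

/-- A locally Lipschitz field cut off outside a ball has solutions on compact intervals. -/
theorem exists_solution_of_vanishing [ProperSpace E] (hΨ : LocallyLipschitz Ψ) {b' : ℝ}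
    (hb' : a ≤ b') (hγ : ContinuousOn γ (Icc a b')) (y₀ : E) {r : ℝ}
    (hr : ∀ p y, r ≤ ‖y‖ → Ψ (p, y) = 0) :
    ∃ y : ℝ → E, y a = y₀ ∧
      ∀ t ∈ Icc a b', HasDerivWithinAt y (Ψ (γ t, y t)) (Icc a b') t := by
  have hcγ : IsCompact (γ '' Icc a b') := isCompact_Icc.image_of_continuousOn hγ
  obtain ⟨M, hM⟩ := (hcγ.prod (isCompact_closedBall (0 : E) r)).exists_bound_of_continuousOn
    hΨ.continuous.continuousOn
  -- The field vanishes outside the ball, so its bound on a compact set is global.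
  have hbd : ∀ t ∈ Icc a b', ∀ y, ‖Ψ (γ t, y)‖ ≤ M.toNNReal := by
    intro t ht y
    rcases le_total r ‖y‖ with h | h
    · rw [hr _ _ h, norm_zero]; exact NNReal.coe_nonneg _
    · exact (hM (γ t, y) ⟨mem_image_of_mem _ ht, mem_closedBall_zero_iff.2 h⟩).trans
        (Real.le_coe_toNNReal M)
  -- A ball of radius maximal speed times length cannot be left, so a single Picard–Lindelöf step
  -- covers the interval.
  set ρ : NNReal := M.toNNReal * (b' - a).toNNReal with hρ
  obtain ⟨L, hL⟩ := (hΨ.locallyLipschitzOn).exists_lipschitzOnWith_of_compact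
    (hcγ.prod (isCompact_closedBall y₀ (ρ : ℝ)))
  have hPL : IsPicardLindelof (fun t y => Ψ (γ t, y)) (⟨a, left_mem_Icc.2 hb'⟩ : Icc a b') y₀
      ρ 0 M.toNNReal L :=
    { lipschitzOnWith := fun t ht => lipschitzOnWith_uncurry_right hL (mem_image_of_mem _ ht)
      continuousOn := fun y _ => hΨ.continuous.comp_continuousOn (hγ.prodMk continuousOn_const)
      norm_le := fun t ht y _ => hbd t ht y
      mul_max_le := by
        have : max (b' - a) (a - a) = b' - a := max_eq_left (by linarith)
        simp only [this, hρ, NNReal.coe_mul, NNReal.coe_zero, sub_zero]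
        rw [Real.coe_toNNReal _ (sub_nonneg.2 hb')] }
  exact hPL.exists_eq_forall_mem_Icc_hasDerivWithinAt₀

/-- If all solutions with initial value `y₀` are bounded by `C`, a solution exists up to any
time before `b`. -/
theorem exists_solution_Icc [ProperSpace E] (hΨ : LocallyLipschitz Ψ)
    (hγ : ContinuousOn γ (Ico a b))
    (hbound : ∀ b' ≤ b, ∀ y : ℝ → E, y a = y₀ →
      (∀ t ∈ Ico a b', HasDerivWithinAt y (Ψ (γ t, y t)) (Ico a b') t) →
      ∀ t ∈ Ico a b', ‖y t‖ ≤ C) {b' : ℝ} (hab' : a ≤ b') (hb' : b' < b) :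
    ∃ y : ℝ → E, y a = y₀ ∧ (∀ t ∈ Icc a b', ‖y t‖ < |C| + ‖y₀‖ + 1) ∧
      ∀ t ∈ Icc a b', HasDerivWithinAt y (Ψ (γ t, y t)) (Icc a b') t := by
  -- Larger than both the a priori bound and the initial norm, so the cutoff acts only beyond values
  -- that true solutions reach.
  set r := |C| + ‖y₀‖ + 1 with hr
  have hCr : C < r := by linarith [le_abs_self C, norm_nonneg y₀]
  have hyr : ‖y₀‖ < r := by linarith [abs_nonneg C]
  let χ : E → ℝ := fun y => min (max (r + 1 - ‖y‖) 0) 1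
  have hχ : LocallyLipschitz χ :=
    ((((LocallyLipschitz.const (r + 1)).sub lipschitzWith_one_norm.locallyLipschitz).max_const
      0).min_const 1)
  have hχ1 : ∀ y, ‖y‖ ≤ r → χ y = 1 := fun y hy =>
    min_eq_right ((by linarith : (1 : ℝ) ≤ r + 1 - ‖y‖).trans (le_max_left _ _))
  have hχ0 : ∀ y, r + 1 ≤ ‖y‖ → χ y = 0 := fun y hy => by
    simp only [χ]
    rw [max_eq_right (by linarith), min_eq_left zero_le_one]
  obtain ⟨y, hya, hy⟩ := exists_solution_of_vanishing (Ψ := fun z => χ z.2 • Ψ z)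
    (locallyLipschitz_smul (hχ.comp LipschitzWith.prod_snd.locallyLipschitz) hΨ) hab'
    (hγ.mono fun t ht => ⟨ht.1, ht.2.trans_lt hb'⟩) y₀ (r := r + 1)
    (fun p y hy => by simp only [hχ0 y hy, zero_smul])
  have hcont : ContinuousOn y (Icc a b') := fun t ht => (hy t ht).continuousWithinAt
  have hsol : ∀ t ∈ Icc a b', ‖y t‖ ≤ r →
      HasDerivWithinAt y (Ψ (γ t, y t)) (Icc a b') t := fun t ht htr => by
    have := hy t ht
    simpa only [hχ1 _ htr, one_smul] using this
  -- Let τ be the first time with r ≤ ‖y τ‖. Before τ the cutoff is inactive, so `hbound`, applied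
  -- on [a, τ), gives the bound `C`, which passes to τ by continuity; but C < r.
  have hlt : ∀ t ∈ Icc a b', ‖y t‖ < r := by
    by_contra! hcon
    obtain ⟨t₁, ht₁, ht₁r⟩ := hcon
    have hcl : IsCompact (Icc a b' ∩ {t | r ≤ ‖y t‖}) := by
      refine isCompact_Icc.of_isClosed_subset ?_ inter_subset_left
      exact hcont.norm.preimage_isClosed_of_isClosed isClosed_Icc isClosed_Ici
    obtain ⟨τ, ⟨hτ, hτr⟩, hmin⟩ := hcl.exists_isLeast ⟨t₁, ht₁, ht₁r⟩
    have hbefore : ∀ t ∈ Ico a τ, ‖y t‖ < r := fun t ht => by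
      by_contra! h
      exact absurd (hmin ⟨⟨ht.1, ht.2.le.trans hτ.2⟩, h⟩) (not_le.2 ht.2)
    have haτ : a < τ := lt_of_le_of_ne hτ.1 fun h => by
      have hτr' : r ≤ ‖y τ‖ := hτr
      rw [← h, hya] at hτr'
      exact absurd hτr' (not_le.2 hyr)
    have hsub : Ico a τ ⊆ Icc a b' := fun t ht => ⟨ht.1, ht.2.le.trans hτ.2⟩
    have hle := hbound τ (hτ.2.trans hb'.le) y hya fun t ht =>
      (hsol t (hsub ht) (hbefore t ht).le).mono hsub
    have hne : (𝓝[Ico a τ] τ).NeBot := by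
      rw [← mem_closure_iff_nhdsWithin_neBot, closure_Ico haτ.ne]
      exact right_mem_Icc.2 haτ.le
    have := le_of_tendsto ((hcont τ hτ).norm.mono_left (nhdsWithin_mono τ hsub))
      (eventually_mem_nhdsWithin.mono hle)
    exact absurd (hτr.trans this) (not_le.2 hCr)
  exact ⟨y, hya, hlt, fun t ht => hsol t ht (hlt t ht).le⟩

/-- A locally Lipschitz equation whose solutions satisfy an a priori bound has a global
solution. -/
theorem exists_global_solution [ProperSpace E] (hΨ : LocallyLipschitz Ψ)
    (hγ : ContinuousOn γ (Ico a b)) (hab : a < b)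
    (hbound : ∀ b' ≤ b, ∀ y : ℝ → E, y a = y₀ →
      (∀ t ∈ Ico a b', HasDerivWithinAt y (Ψ (γ t, y t)) (Ico a b') t) →
      ∀ t ∈ Ico a b', ‖y t‖ ≤ C) :
    ∃ y : ℝ → E, y a = y₀ ∧
      ∀ t ∈ Ico a b, HasDerivWithinAt y (Ψ (γ t, y t)) (Ico a b) t := by
  have hex : ∀ b', ∃ y : ℝ → E, a ≤ b' → b' < b → y a = y₀ ∧
      (∀ t ∈ Icc a b', ‖y t‖ < |C| + ‖y₀‖ + 1) ∧
      ∀ t ∈ Icc a b', HasDerivWithinAt y (Ψ (γ t, y t)) (Icc a b') t := by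
    intro b'
    by_cases h : a ≤ b' ∧ b' < b
    · obtain ⟨y, hy⟩ := exists_solution_Icc hΨ hγ hbound h.1 h.2
      exact ⟨y, fun _ _ => hy⟩
    · exact ⟨0, fun h1 h2 => absurd ⟨h1, h2⟩ h⟩
  choose Y hY using hex
  have hderiv : ∀ b', b' < b → ∀ t ∈ Ico a b',
      HasDerivWithinAt (Y b') (Ψ (γ t, Y b' t)) (Ici t) t := fun b' hb' t ht =>
    ((hY b' (ht.1.trans ht.2.le) hb').2.2 t ⟨ht.1, ht.2.le⟩).mono_of_mem_nhdsWithin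
      (mem_of_superset (Icc_mem_nhdsGE ht.2) (Icc_subset_Icc_left ht.1))
  -- All these solutions stay in one ball, where the field is Lipschitz, so they agree on overlaps
  -- and can be glued.
  have huniq : ∀ b₁ b₂ s, b₁ < b → b₂ < b → a ≤ s → s ≤ b₁ → s ≤ b₂ → Y b₁ s = Y b₂ s := by
    intro b₁ b₂ s h1 h2 has hs1 hs2
    have hcγ : IsCompact (γ '' Icc a s) := isCompact_Icc.image_of_continuousOn
      (hγ.mono fun t ht => ⟨ht.1, ht.2.trans_lt (hs1.trans_lt h1)⟩)
    obtain ⟨L, hL⟩ := (hΨ.locallyLipschitzOn).exists_lipschitzOnWith_of_compact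
      (hcγ.prod (isCompact_closedBall (0 : E) (|C| + ‖y₀‖ + 1)))
    have key : ∀ b', b' < b → s ≤ b' → ContinuousOn (Y b') (Icc a s) ∧
        (∀ t ∈ Ico a s, HasDerivWithinAt (Y b') (Ψ (γ t, Y b' t)) (Ici t) t) ∧
        ∀ t ∈ Ico a s, Y b' t ∈ Metric.closedBall (0 : E) (|C| + ‖y₀‖ + 1) := by
      intro b' hb' hs
      obtain ⟨-, e1, e2⟩ := hY b' (has.trans hs) hb'
      refine ⟨fun t ht => ((e2 t ⟨ht.1, ht.2.trans hs⟩).continuousWithinAt).mono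
        (Icc_subset_Icc_right hs), fun t ht => hderiv b' hb' t ⟨ht.1, ht.2.trans_le hs⟩,
        fun t ht => mem_closedBall_zero_iff.2 (e1 t ⟨ht.1, ht.2.le.trans hs⟩).le⟩
    obtain ⟨c1, d1, m1⟩ := key b₁ h1 hs1
    obtain ⟨c2, d2, m2⟩ := key b₂ h2 hs2
    exact ODE_solution_unique_of_mem_Icc_right (v := fun t y => Ψ (γ t, y))
      (fun t ht => lipschitzOnWith_uncurry_right hL (mem_image_of_mem _ ⟨ht.1, ht.2.le⟩))
      c1 d1 m1 c2 d2 m2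
      ((hY b₁ (has.trans hs1) h1).1.trans (hY b₂ (has.trans hs2) h2).1.symm)
      (right_mem_Icc.2 has)
  -- At time t the solution up to the midpoint of t and b is used; it exists past t, and near t it
  -- agrees with the glued curve.
  refine ⟨fun t => Y ((t + b) / 2) t, (hY ((a + b) / 2) (by linarith) (by linarith)).1,
    fun t ht => ?_⟩
  set b₁ := (t + b) / 2 with hb₁
  have htb : t < b := ht.2
  have htb₁ : t < b₁ := by rw [hb₁]; linarith
  have hb₁b : b₁ < b := by rw [hb₁]; linarith
  have hnhds : Ico a b ∩ Iio b₁ ∈ 𝓝[Ico a b] t := inter_mem self_mem_nhdsWithin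
    (mem_nhdsWithin_of_mem_nhds (Iio_mem_nhds htb₁))
  refine HasDerivWithinAt.congr_of_eventuallyEq
    (((hY b₁ (ht.1.trans htb₁.le) hb₁b).2.2 t ⟨ht.1, htb₁.le⟩).mono_of_mem_nhdsWithin
      (mem_of_superset hnhds fun s hs => ⟨hs.1.1, hs.2.le⟩)) ?_ rfl
  filter_upwards [hnhds] with s hs
  exact huniq _ _ s (by linarith [hs.1.2]) hb₁b hs.1.1 (by linarith [hs.1.2]) hs.2.le

end GlobalSolution

section ClosedLoop

variable {N n m : ℕ}

/-! ### The closed loop as a differential equation in a normed space -/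

/-- The entries of the state of one agent that take part in the closed loop. -/
abbrev AgentVar (m n : ℕ) : Type :=
  Vec n × Vec n × (Finset.Icc 1 m → Vec n) × ℝ × (Finset.Icc 2 m → Vec n)

/-- The state with entries `y`, and with those of `s` at the unused indices. -/
def AgentVar.toState (s : AgentState n) (y : AgentVar m n) : AgentState n where
  ϖ := y.1
  p := y.2.1
  x q := if h : q ∈ Finset.Icc 1 m then y.2.2.1 ⟨q, h⟩ else s.x q
  θhat := y.2.2.2.1
  ξf q := if h : q ∈ Finset.Icc 2 m then y.2.2.2.2 ⟨q, h⟩ else s.ξf q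

/-- The used entries of a state. -/
def AgentState.toVar (m : ℕ) (s : AgentState n) : AgentVar m n :=
  (s.ϖ, s.p, fun q => s.x q, s.θhat, fun q => s.ξf q)

theorem toState_toVar (s : AgentState n) : (s.toVar m).toState s = s := by
  cases s
  simp only [AgentVar.toState, AgentState.toVar, dite_eq_ite, ite_self]

theorem toState_x (s : AgentState n) (y : AgentVar m n) {q : ℕ} (hq : q ∈ Finset.Icc 1 m) :
    (y.toState s).x q = y.2.2.1 ⟨q, hq⟩ := dif_pos hq

theorem toState_ξf (s : AgentState n) (y : AgentVar m n) {q : ℕ} (hq : q ∈ Finset.Icc 2 m) :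
    (y.toState s).ξf q = y.2.2.2.2 ⟨q, hq⟩ := dif_pos hq

/-- The right-hand side of the `x_q`-equation. -/
def Agent.xRate (A : Agent n) (m : ℕ) (K : Gains) (g : ℝ) (s : AgentState n) (q : ℕ) : Vec n :=
  (if q = m then A.input m K g s else s.x (q + 1)) + if q = 1 then 0 else A.θ • A.φ q (s.x q)

/-- The right-hand side of the closed loop, as a function of the values `a` of `α(μ)` and `g i`
of `α_ξ(μ)`. -/
def closedLoopRate (G : Network N) (f : Fin N → Vec n → ℝ) (m : ℕ) (A : Fin N → Agent n)
    (K : Fin N → Gains) (a : ℝ) (g : Fin N → ℝ) (s : Fin N → AgentState n) (i : Fin N) :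
    AgentVar m n :=
  (ϖRate G f a s i, a • ∑ j, G.a i j • ((s i).ϖ - (s j).ϖ),
    fun q => (A i).xRate m (K i) (g i) (s i) q,
    (A i).tau m (g i) (s i) - (A i).σ * g i * (s i).θhat,
    fun q => ((K i).υ q * g i) • (-(s i).ξf q + (A i).xi (K i) (g i) (s i) (q - 1)))

section LocallyLipschitz

variable {X : Type*} [PseudoEMetricSpace X]

/-- All entries of a family of states are locally Lipschitz. -/
structure IsLocallyLipschitzState (s : X → AgentState n) : Prop where
  ϖ : LocallyLipschitz fun z => (s z).ϖ
  p : LocallyLipschitz fun z => (s z).p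
  x : ∀ q, LocallyLipschitz fun z => (s z).x q
  θhat : LocallyLipschitz fun z => (s z).θhat
  ξf : ∀ q, LocallyLipschitz fun z => (s z).ξf q

theorem IsLocallyLipschitzState.of_var (s₀ : AgentState n) {y : X → AgentVar m n}
    (hy : LocallyLipschitz y) : IsLocallyLipschitzState fun z => (y z).toState s₀ := by
  have h1 := LipschitzWith.prod_fst.locallyLipschitz.comp hy
  have r1 := LipschitzWith.prod_snd.locallyLipschitz.comp hy
  have h2 := LipschitzWith.prod_fst.locallyLipschitz.comp r1
  have r2 := LipschitzWith.prod_snd.locallyLipschitz.comp r1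
  have h3 := LipschitzWith.prod_fst.locallyLipschitz.comp r2
  have r3 := LipschitzWith.prod_snd.locallyLipschitz.comp r2
  have h4 := LipschitzWith.prod_fst.locallyLipschitz.comp r3
  have h5 := LipschitzWith.prod_snd.locallyLipschitz.comp r3
  refine ⟨h1, h2, fun q => ?_, h4, fun q => ?_⟩
  · by_cases hq : q ∈ Finset.Icc 1 m
    · simp only [toState_x _ _ hq]
      exact (locallyLipschitz_apply (⟨q, hq⟩ : Finset.Icc 1 m)).comp h3
    · simp only [AgentVar.toState, dif_neg hq]
      exact LocallyLipschitz.const _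
  · by_cases hq : q ∈ Finset.Icc 2 m
    · simp only [toState_ξf _ _ hq]
      exact (locallyLipschitz_apply (⟨q, hq⟩ : Finset.Icc 2 m)).comp h5
    · simp only [AgentVar.toState, dif_neg hq]
      exact LocallyLipschitz.const _

variable {A : Agent n} {g : X → ℝ} {s : X → AgentState n}

theorem IsLocallyLipschitzState.xTilde (hs : IsLocallyLipschitzState s) (q : ℕ) :
    LocallyLipschitz fun z => (s z).xTilde q := by
  by_cases hq : q = 1
  · simp only [AgentState.xTilde, if_pos hq]
    exact (hs.x 1).sub hs.ϖ
  · simp only [AgentState.xTilde, if_neg hq]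
    exact (hs.x q).sub (hs.ξf q)

theorem IsLocallyLipschitzState.φ (hs : IsLocallyLipschitzState s)
    (hφ : IsAdmissibleNonlinearity m A.φ) {q : ℕ} (hq : 2 ≤ q) (hqm : q ≤ m) :
    LocallyLipschitz fun z => A.φ q ((s z).x q) :=
  (hφ q hq hqm).2.2.comp (hs.x q)

theorem IsLocallyLipschitzState.xi (hs : IsLocallyLipschitzState s) (hg : LocallyLipschitz g)
    (hφ : IsAdmissibleNonlinearity m A.φ) (K : Gains) :
    ∀ q ≤ m, LocallyLipschitz fun z => A.xi K (g z) (s z) q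
  | 0, _ => LocallyLipschitz.const 0
  | 1, _ => (locallyLipschitz_smul (locallyLipschitz_mul (LocallyLipschitz.const (K.c 1)) hg)
      (hs.xTilde 1)).neg
  | q + 2, hq =>
    ((locallyLipschitz_smul (locallyLipschitz_mul (LocallyLipschitz.const (K.c (q + 2))) hg)
      (hs.xTilde (q + 2))).neg.sub
        (locallyLipschitz_smul hs.θhat (hs.φ hφ (Nat.le_add_left 2 q) hq))).sub
      (locallyLipschitz_smul (locallyLipschitz_mul (LocallyLipschitz.const (K.υ (q + 2))) hg)
        ((hs.ξf (q + 2)).sub (hs.xi hg hφ K (q + 1) (by omega))))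

theorem IsLocallyLipschitzState.tau (hs : IsLocallyLipschitzState s) (hg : LocallyLipschitz g)
    (hφ : IsAdmissibleNonlinearity m A.φ) (hl : 0 < A.l) :
    LocallyLipschitz fun z => A.tau m (g z) (s z) := by
  refine locallyLipschitz_sum _ fun q hq => ?_
  obtain ⟨hq1, hq2⟩ := Finset.mem_Icc.1 hq
  -- With exponent at least 1 the real power is C¹ on the whole line, so `g` needs no sign here.
  have hL : ((1 : ℕ) : ℝ) ≤ 2 * expo m A.l q := by
    have : (q : ℝ) ≤ m := by exact_mod_cast hq2
    unfold expo; push_cast; linarith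
  refine locallyLipschitz_mul ?_ (locallyLipschitz_inner (hs.xTilde q) (hs.φ hφ hq1 hq2))
  exact (ContDiff.locallyLipschitz (𝕂 := ℝ) (Real.contDiff_rpow_const_of_le hL)).comp hg

theorem IsLocallyLipschitzState.xRate (hs : IsLocallyLipschitzState s) (hg : LocallyLipschitz g)
    (hφ : IsAdmissibleNonlinearity m A.φ) (K : Gains) {q : ℕ} (hq : q ∈ Finset.Icc 1 m) :
    LocallyLipschitz fun z => A.xRate m K (g z) (s z) q := by
  obtain ⟨hq1, hq2⟩ := Finset.mem_Icc.1 hq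
  refine LocallyLipschitz.add (f := fun z => if q = m then A.input m K (g z) (s z) else
    (s z).x (q + 1)) (g := fun z => if q = 1 then 0 else A.θ • A.φ q ((s z).x q)) ?_ ?_
  · split_ifs
    · exact hs.xi hg hφ K m le_rfl
    · exact hs.x (q + 1)
  · split_ifs
    · exact LocallyLipschitz.const 0
    · exact locallyLipschitz_smul (LocallyLipschitz.const A.θ) (hs.φ hφ (by omega) hq2)

end LocallyLipschitz

/-- The values of the time-varying gains enter as parameters, so their dependence on time only has
to be continuous. -/
theorem locallyLipschitz_closedLoopRate {X : Type*} [PseudoEMetricSpace X] {G : Network N}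
    {f : Fin N → Vec n → ℝ} {rho varrho : ℝ} (hf : ∀ i, IsAdmissibleCost rho varrho (f i))
    {A : Fin N → Agent n} (hφ : ∀ i, IsAdmissibleNonlinearity m (A i).φ)
    (hl : ∀ i, 0 < (A i).l) (K : Fin N → Gains) {a : X → ℝ} {g : X → Fin N → ℝ}
    {s : X → Fin N → AgentState n} (ha : LocallyLipschitz a)
    (hg : ∀ i, LocallyLipschitz fun z => g z i)
    (hs : ∀ i, IsLocallyLipschitzState fun z => s z i) :
    LocallyLipschitz fun z => closedLoopRate G f m A K (a z) (g z) (s z) := by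
  refine locallyLipschitz_pi fun i => ?_
  have hlap : LocallyLipschitz fun z => ∑ j, G.a i j • ((s z i).ϖ - (s z j).ϖ) :=
    locallyLipschitz_sum _ fun j _ => locallyLipschitz_smul (LocallyLipschitz.const (G.a i j))
      ((hs i).ϖ.sub (hs j).ϖ)
  have hgrad : LocallyLipschitz fun z => gradient (f i) (s z i).ϖ := by
    refine LocallyLipschitz.comp (f := gradient (f i)) ?_ (hs i).ϖ
    refine (LipschitzWith.of_dist_le_mul (K := varrho.toNNReal) fun x y => ?_).locallyLipschitz
    rw [dist_eq_norm, dist_eq_norm]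
    exact ((hf i).lipschitz x y).trans
      (mul_le_mul_of_nonneg_right (Real.le_coe_toNNReal _) (norm_nonneg _))
  refine LocallyLipschitz.prodMk ?_ (LocallyLipschitz.prodMk ?_ (LocallyLipschitz.prodMk ?_
    (LocallyLipschitz.prodMk ?_ ?_)))
  · exact (locallyLipschitz_smul ha ((hlap.add hgrad).add (hs i).p)).neg
  · exact locallyLipschitz_smul ha hlap
  · exact locallyLipschitz_pi fun q => (hs i).xRate (hg i) (hφ i) (K i) q.2
  · exact ((hs i).tau (hg i) (hφ i) (hl i)).sub (locallyLipschitz_mul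
      (locallyLipschitz_mul (LocallyLipschitz.const _) (hg i)) (hs i).θhat)
  · refine locallyLipschitz_pi fun q => ?_
    have hq := Finset.mem_Icc.1 q.2
    exact locallyLipschitz_smul (locallyLipschitz_mul (LocallyLipschitz.const _) (hg i))
      (((hs i).ξf q).neg.add ((hs i).xi (hg i) (hφ i) (K i) (q - 1) (by omega)))

variable {G : Network N} {f : Fin N → Vec n → ℝ} {α : ℝ → ℝ}
  {A : Fin N → Agent n} {K : Fin N → Gains} {t₀ T t₁ : ℝ}

theorem isSolution_toState (hm : 2 ≤ m) {s₀ : Fin N → AgentState n}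
    {y : ℝ → Fin N → AgentVar m n}
    (hy : ∀ t ∈ Ico t₀ t₁, HasDerivWithinAt y (closedLoopRate G f m A K (α (mu t₀ T t))
      (fun i => (A i).αξ (mu t₀ T t)) fun i => (y t i).toState (s₀ i)) (Ico t₀ t₁) t) :
    IsSolution G f α m A K t₀ T t₁ fun t i => (y t i).toState (s₀ i) := by
  have hyi : ∀ t ∈ Ico t₀ t₁, ∀ i, HasDerivWithinAt (fun r => y r i)
      (closedLoopRate G f m A K (α (mu t₀ T t)) (fun i => (A i).αξ (mu t₀ T t))
        (fun i => (y t i).toState (s₀ i)) i) (Ico t₀ t₁) t :=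
    fun t ht => hasDerivWithinAt_pi.1 (hy t ht)
  have hx : ∀ t ∈ Ico t₀ t₁, ∀ i, ∀ q, 1 ≤ q → q ≤ m →
      HasDerivWithinAt (fun r => ((y r i).toState (s₀ i)).x q)
        ((A i).xRate m (K i) ((A i).αξ (mu t₀ T t)) ((y t i).toState (s₀ i)) q)
        (Ico t₀ t₁) t := by
    intro t ht i q hq1 hq2
    have hq : q ∈ Finset.Icc 1 m := Finset.mem_Icc.2 ⟨hq1, hq2⟩
    simp only [toState_x _ _ hq]
    exact hasDerivWithinAt_pi.1 (hyi t ht i).snd.snd.fst ⟨q, hq⟩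
  exact
  { ϖ_eq := fun t ht i => (hyi t ht i).fst
    p_eq := fun t ht i => (hyi t ht i).snd.fst
    x_first := fun t ht i => by
      have := hx t ht i 1 le_rfl (by omega)
      rwa [Agent.xRate, if_neg (by omega), if_pos rfl, add_zero] at this
    x_mid := fun t ht i q hq1 hq2 => by
      have := hx t ht i q (by omega) hq2.le
      rwa [Agent.xRate, if_neg (by omega), if_neg (by omega)] at this
    x_last := fun t ht i => by
      have := hx t ht i m (by omega) le_rfl
      rwa [Agent.xRate, if_pos rfl, if_neg (by omega)] at this
    θhat_eq := fun t ht i => (hyi t ht i).snd.snd.snd.fst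
    ξf_eq := fun t ht i q hq1 hq2 => by
      have hq : q ∈ Finset.Icc 2 m := Finset.mem_Icc.2 ⟨hq1, hq2⟩
      have := hasDerivWithinAt_pi.1 (hyi t ht i).snd.snd.snd.snd ⟨q, hq⟩
      exact this.congr (fun r _ => toState_ξf _ _ hq) (toState_ξf _ _ hq) }

theorem norm_var_le {y : AgentVar m n} {A : Agent n} {K : Gains} {g C : ℝ} {s : AgentState n}
    (hy : IsBoundedBy A m K g C (y.toState s)) : ‖y‖ ≤ C := by
  have hC : 0 ≤ C := (norm_nonneg _).trans hy.ϖ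
  refine max_le hy.ϖ (max_le hy.p (max_le ?_ (max_le hy.θhat ?_)))
  · refine (pi_norm_le_iff_of_nonneg hC).2 fun q => ?_
    obtain ⟨hq1, hq2⟩ := Finset.mem_Icc.1 q.2
    have := hy.x q hq1 hq2
    rwa [toState_x _ _ q.2] at this
  · refine (pi_norm_le_iff_of_nonneg hC).2 fun q => ?_
    obtain ⟨hq1, hq2⟩ := Finset.mem_Icc.1 q.2
    have := hy.ξf q hq1 hq2
    rwa [toState_ξf _ _ q.2] at this

/-- If all solutions of the closed loop from `s₀` are bounded, there is one on the whole
interval. -/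
theorem exists_isSolution {rho varrho : ℝ} (hm : 2 ≤ m)
    (hf : ∀ i, IsAdmissibleCost rho varrho (f i))
    (hφ : ∀ i, IsAdmissibleNonlinearity m (A i).φ) (hl : ∀ i, 0 < (A i).l) (hT : 0 < T)
    (hα : IsKInfty α) (hξ : ∀ i, IsKInfty (A i).αξ) {s₀ : Fin N → AgentState n} {C : ℝ}
    (hC : 0 ≤ C)
    (hbound : ∀ t₁ S, t₁ ≤ t₀ + T → IsSolution G f α m A K t₀ T t₁ S → S t₀ = s₀ →
      ∀ t ∈ Ico t₀ t₁, ∀ i, IsBoundedBy (A i) m (K i) ((A i).αξ (mu t₀ T t)) C (S t i)) :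
    ∃ S, IsSolution G f α m A K t₀ T (t₀ + T) S ∧ S t₀ = s₀ := by
  have hmu : ContinuousOn (mu t₀ T) (Ico t₀ (t₀ + T)) := fun t ht =>
    (hasDerivAt_mu ht).continuousAt.continuousWithinAt
  have hcont : ∀ β, IsKInfty β → ContinuousOn (fun t => β (mu t₀ T t)) (Ico t₀ (t₀ + T)) :=
    fun β hβ => hβ.continuousOn.comp hmu fun t ht => (mu_pos ht).le
  have hfst : LocallyLipschitz (Prod.fst : (ℝ × (Fin N → ℝ)) × (Fin N → AgentVar m n) → _) :=
    LipschitzWith.prod_fst.locallyLipschitz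
  have hΨ : LocallyLipschitz fun z : (ℝ × (Fin N → ℝ)) × (Fin N → AgentVar m n) =>
      closedLoopRate G f m A K z.1.1 z.1.2 fun i => (z.2 i).toState (s₀ i) :=
    locallyLipschitz_closedLoopRate hf hφ hl K
      (LipschitzWith.prod_fst.locallyLipschitz.comp hfst)
      (fun i => (locallyLipschitz_apply i).comp
        (LipschitzWith.prod_snd.locallyLipschitz.comp hfst))
      fun i => .of_var (s₀ i) ((locallyLipschitz_apply i).comp
        LipschitzWith.prod_snd.locallyLipschitz)
  -- The unused entries are filled from `s₀`, so the full initial state is recovered and not only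
  -- its used part.
  have hinit : (fun i => ((s₀ i).toVar m).toState (s₀ i)) = s₀ :=
    funext fun i => toState_toVar (s₀ i)
  obtain ⟨y, hy0, hy⟩ := exists_global_solution (y₀ := fun i => (s₀ i).toVar m) (C := C) hΨ
    (γ := fun t => (α (mu t₀ T t), fun i => (A i).αξ (mu t₀ T t)))
    ((hcont α hα).prodMk (continuousOn_pi.2 fun i => hcont _ (hξ i)))
    (show t₀ < t₀ + T by linarith) fun b' hb' y hya hy t ht => by
      refine (pi_norm_le_iff_of_nonneg hC).2 fun i => norm_var_le
        (hbound b' (fun t i => (y t i).toState (s₀ i)) hb' (isSolution_toState hm hy) ?_ t ht i)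
      simp only [hya, hinit]
  exact ⟨fun t i => (y t i).toState (s₀ i), isSolution_toState hm hy, by simp only [hy0, hinit]⟩

end ClosedLoop

/-! ### Convergence and assembly of the theorem -/

theorem tendsto_tracking_bound {α β : ℝ → ℝ} (hα : IsKInfty α) (hβ : IsKInfty β) {p q : ℝ}
    (hp : 0 < p) (hq : 0 < q) (t₀ T h C : ℝ) :
    Tendsto (fun t => h * (β (mu t₀ T t) ^ p)⁻¹ + C * (α (mu t₀ T t) * β (mu t₀ T t) ^ q)⁻¹)
      (𝓝[<] (T + t₀)) (𝓝 0) := by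
  have hpow : ∀ {r : ℝ}, 0 < r →
      Tendsto (fun t => β (mu t₀ T t) ^ r) (𝓝[<] (T + t₀)) atTop := fun hr =>
    (tendsto_rpow_atTop hr).comp hβ.tendsto_mu
  simpa using ((hpow hp).inv_tendsto_atTop.const_mul h).add
    ((hα.tendsto_mu.atTop_mul_atTop₀ (hpow hq)).inv_tendsto_atTop.const_mul C)

end DPTCO

end

theorem theorem5 {N n m : ℕ} (hN : 2 ≤ N) (hm : 2 ≤ m)
    (G : DPTCO.Network N) (hG : G.graph.Connected)
    (rho varrho : ℝ) (hrho : 0 < rho) (hvarrho : 0 < varrho)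
    (f : Fin N → DPTCO.Vec n → ℝ) (hf : ∀ i, DPTCO.IsAdmissibleCost rho varrho (f i))
    (z : DPTCO.Vec n) (hz : IsMinOn (fun w => ∑ i, f i w) Set.univ z)
    (t₀ T : ℝ) (hT : 0 < T)
    (α : ℝ → ℝ)
    (hα : DPTCO.IsGeneratorGain (DPTCO.cStar (G.lambda2 hN) rho varrho) α)
    (A : Fin N → DPTCO.Agent n)
    (hφ : ∀ i, DPTCO.IsAdmissibleNonlinearity m (A i).φ)
    (hl : ∀ i, 0 < (A i).l) (hσ : ∀ i, 0 < (A i).σ)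
    (hξ : ∀ i, DPTCO.IsTrackingGain (DPTCO.cStar (G.lambda2 hN) rho varrho)
      (DPTCO.expo m (A i).l 2) α (A i).αξ)
    (R : ℝ) :
    ∃ (K : Fin N → DPTCO.Gains) (h : Fin N → ℝ),
      (∀ i, 0 < h i) ∧
      (∀ i q, 1 ≤ q → q ≤ m → 0 < (K i).c q) ∧
      (∀ i q, 2 ≤ q → q ≤ m → 0 < (K i).υ q) ∧
      -- every `Ω(h i)` is invariant along the closed loop
      (∀ (t₁ : ℝ) (S : ℝ → Fin N → DPTCO.AgentState n), t₁ ≤ t₀ + T →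
        DPTCO.IsSolution G f α m A K t₀ T t₁ S → DPTCO.IsGeneratorInit R (S t₀) →
        ∀ (i : Fin N) (s t : ℝ), t₀ ≤ s → s ≤ t → t < t₁ →
          DPTCO.transformAt m A K t₀ T s (S s) i ∈ DPTCO.Omega m n (h i) →
          DPTCO.transformAt m A K t₀ T t (S t) i ∈ DPTCO.Omega m n (h i)) ∧
      -- from these sets the closed loop runs on all of `[t₀, t₀ + T)` and solves the problem
      (∀ s₀ : Fin N → DPTCO.AgentState n, DPTCO.IsGeneratorInit R s₀ →
        (∀ i, DPTCO.transformAt m A K t₀ T t₀ s₀ i ∈ DPTCO.Omega m n (h i)) →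
        (∃ S, DPTCO.IsSolution G f α m A K t₀ T (t₀ + T) S ∧ S t₀ = s₀) ∧
        ∀ S, DPTCO.IsSolution G f α m A K t₀ T (t₀ + T) S → S t₀ = s₀ →
          DPTCO.AchievesAgreement m A K t₀ T z S) ∧
      -- for every initial state of size at most `R` the filters can be started in these sets
      (∀ s₀ : Fin N → DPTCO.AgentState n, DPTCO.IsGeneratorInit R s₀ →
        (∀ i, (∀ q, 1 ≤ q → q ≤ m → ‖(s₀ i).x q‖ ≤ R) ∧ |(s₀ i).θhat| ≤ R) →
        ∃ ξf₀ : Fin N → ℕ → DPTCO.Vec n, ∀ i,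
          DPTCO.transformAt m A K t₀ T t₀ (fun j => { s₀ j with ξf := ξf₀ j }) i
            ∈ DPTCO.Omega m n (h i)) := by
  choose c h C hh hc hK hinit using fun i => DPTCO.exists_agent_design (t₀ := t₀) (T := T) hN hm hG
    hrho hvarrho hf hz hT hα i (hφ i) (hl i) (hσ i) (hξ i) R
  have hbdd : ∀ (t₁ : ℝ) (S : ℝ → Fin N → DPTCO.AgentState n), t₁ ≤ t₀ + T →
      DPTCO.IsSolution G f α m A (fun i => ⟨c i, fun q => 2 * c i q⟩) t₀ T t₁ S →
      DPTCO.IsGeneratorInit R (S t₀) →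
      (∀ i, DPTCO.transformAt m A (fun i => ⟨c i, fun q => 2 * c i q⟩) t₀ T t₀ (S t₀) i
        ∈ DPTCO.Omega m n (h i)) →
      ∀ t ∈ Ico t₀ t₁, ∀ i, DPTCO.IsBoundedBy (A i) m ⟨c i, fun q => 2 * c i q⟩
        ((A i).αξ (DPTCO.mu t₀ T t)) (∑ j, |C j|) (S t i) :=
    -- The sum of the |C j| serves as one bound for all agents.
    fun t₁ S ht₁ hS h0 hΩ t ht i => (((hK i _ rfl t₁ S ht₁ hS h0).2 (hΩ i) t ht).1).mono
      ((le_abs_self _).trans (Finset.single_le_sum (f := fun j => |C j|)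
        (fun _ _ => abs_nonneg _) (Finset.mem_univ i)))
  refine ⟨fun i => ⟨c i, fun q => 2 * c i q⟩, h, hh, fun i q h1 _ => hc i q h1,
    fun i q h1 _ => mul_pos two_pos (hc i q (by omega)),
    fun t₁ S ht₁ hS h0 i => (hK i _ rfl t₁ S ht₁ hS h0).1, fun s₀ h0 hΩ => ⟨?_, ?_⟩, ?_⟩
  · refine DPTCO.exists_isSolution (C := ∑ j, |C j|) hm hf hφ hl hT hα.kInfty (fun i => (hξ i).kInfty)
      (Finset.sum_nonneg fun j _ => abs_nonneg (C j)) fun t₁ S ht₁ hS hS0 => ?_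
    subst hS0
    exact hbdd t₁ S ht₁ hS h0 hΩ
  · intro S hS hS0
    subst hS0
    refine ⟨fun i => ?_, ∑ j, |C j|, fun t ht i => ?_⟩
    · refine squeeze_zero' (Eventually.of_forall fun _ => norm_nonneg _) ?_
        (DPTCO.tendsto_tracking_bound hα.kInfty (hξ i).kInfty
          (DPTCO.expo_pos (m := m) (hl i) (q := 1) (by omega))
          (DPTCO.expo_pos (m := m) (hl i) (q := 2) (by omega)) t₀ T (h i) (C i))
      filter_upwards [Ico_mem_nhdsLT (show t₀ < T + t₀ by linarith)] with t ht
      exact ((hK i _ rfl _ S le_rfl hS h0).2 (hΩ i) t ⟨ht.1, by linarith [ht.2]⟩).2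
    · have := hbdd _ S le_rfl hS h0 hΩ t ht i
      exact ⟨this.x, this.input, this.ϖ, this.p, this.θhat, this.ξf⟩
  · intro s₀ h0 hs
    refine ⟨fun i => DPTCO.initialFilter (A i) m ((A i).αξ (DPTCO.mu t₀ T t₀)) (s₀ i),
      fun i => (DPTCO.transformAt_mem_Omega hm).2 ?_⟩
    exact hinit i (s₀ i) (hs i).1 (hs i).2 (h0.2 i).1
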